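/- Let $K$ be a field of characteristic $0$ containing elements $q,t$ that are algebraically independent over $\mathbb{Q}$; put $p=q/t$ and fix a fourth root $p^{1/4}\in K$ (for instance $K=\mathbb{Q}(q^{1/4},t^{1/4})$). Let $m\ge 2$ and $y_1,\dots,y_m\in K^\times$. **Fock space.** Let $\mathfrak h$ be the Heisenberg algebra with generators $a_n$ ($n\in\mathbb{Z}$) and relations $[a_k,a_n]=k\frac{1-q^{|k|}}{1-t^{|k|}}\delta_{k+n,0}\,a_0$, and let $\mathcal F$ be its Fock representation, with $a_0=1$: $\mathcal F=K[a_{-1},a_{-2},\dots]$, where $a_{-n}$ acts by multiplication and $a_n$ by $n\frac{1-q^n}{1-t^n}\,\partial/\partial a_{-n}$ for $n>0$. Set $$\eta(z)=\exp\Big(\sum_{n>0}\tfrac{1-t^{-n}}{n}a_{-n}z^n\Big)\exp\Big(-\sum_{n>0}\tfrac{1-t^n}{n}a_nz^{-n}\Big),$$ $$\xi(z)=\exp\Big(-\sum_{n>0}\tfrac{1-t^{-n}}{n}p^{-n/2}a_{-n}z^n\Big)\exp\Big(\sum_{n>0}\tfrac{1-t^n}{n}p^{-n/2}a_nz^{-n}\Big),$$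 $$\varphi^+(z)=\exp\Big(-\sum_{n>0}\tfrac{1-t^n}{n}(1-p^{-n})p^{n/4}a_nz^{-n}\Big),\qquad \varphi^-(z)=\exp\Big(\sum_{n>0}\tfrac{1-t^{-n}}{n}(1-p^{-n})p^{n/4}a_{-n}z^n\Big).$$ **Level $m$ representation.** The level one representation $\rho_c$ ($c\in K^\times$) of the Ding–Iohara algebra on $\mathcal F$ is $\gamma^{1/2}\mapsto p^{-1/4}$, $\psi^\pm(z)\mapsto\varphi^\pm(z)$, $x^+(z)\mapsto c\,\eta(z)$, $x^-(z)\mapsto c^{-1}\xi(z)$, and $b_n\mapsto-\frac{1-t^n}{|n|}(p^{|n|/2}-p^{-|n|/2})a_n$ ($n\neq0$), where $\psi^\pm(z)=\psi^\pm_0\exp(\pm\sum_{n>0}b_{\pm n}\gamma^{n/2}z^{\mp n})$. Let $\rho=\rho^{(m)}_y=(\rho_{y_1}\otimes\cdots\otimes\rho_{y_m})\circ\Delta^{(m)}$, acting on $\mathcal F^{\otimes m}$, where $\Delta^{(m)}$ is the iterate of the coproduct $\Delta$ given, with $\gamma_{(1)}=\gamma\otimes1$ and $\gamma_{(2)}=1\otimes\gamma$,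 by $$\Delta(\gamma^{1/2})=\gamma^{1/2}\otimes\gamma^{1/2},\qquad \Delta(b_n)=b_n\otimes\gamma^{-|n|}+1\otimes b_n,$$ $$\Delta(x^+(z))=x^+(z)\otimes1+\psi^-(\gamma_{(1)}^{1/2}z)\otimes x^+(\gamma_{(1)}z),\qquad \Delta(x^-(z))=x^-(\gamma_{(2)}z)\otimes\psi^+(\gamma_{(2)}^{1/2}z)+1\otimes x^-(z).$$ In particular $\gamma$ acts by $p^{-m/2}$, and $\frac1{\gamma^n-\gamma^{-n}}$ below denotes the corresponding element of $K$. Put $$\alpha(z)=\exp\Big(-\sum_{n\ge1}\tfrac{1}{\gamma^n-\gamma^{-n}}b_{-n}z^n\Big),\qquad \beta(z)=\exp\Big(\sum_{n\ge1}\tfrac1{\gamma^n-\gamma^{-n}}b_nz^{-n}\Big),$$ $$t(z)=\alpha(z)x^+(z)\beta(z),\qquad t^*(z)=\alpha(p^{-1}z)^{-1}x^-(p^{-1}\gamma^{-1}z)\beta(\gamma^{-2}p^{-1}z)^{-1},$$ $T_1(z)=\rho(t(z))$ and $T_1^*(z)=\rho(t^*(z))$. **The components.** For $1\le i\le m$,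 with $\eta$ and $\xi$ in the $i$-th tensor component, let $$\widetilde\Lambda_i(z)=\varphi^-(p^{-1/4}z)\otimes\varphi^-(p^{-3/4}z)\otimes\cdots\otimes\varphi^-(p^{-(2i-3)/4}z)\otimes\eta(p^{-(i-1)/2}z)\otimes1\otimes\cdots\otimes1,$$ $$\widetilde\Lambda^*_i(z)=1\otimes\cdots\otimes1\otimes\xi(p^{-(m-i)/2}z)\otimes\varphi^+(p^{-(2m-2i-1)/4}z)\otimes\cdots\otimes\varphi^+(p^{-1/4}z),$$ $$\Lambda_i(z)=\rho(\alpha(z))\,\widetilde\Lambda_i(z)\,\rho(\beta(z)),\qquad \Lambda_i^*(z)=\rho(\alpha(p^{-1}z)^{-1})\,\widetilde\Lambda_i^*(p^{(m-2)/2}z)\,\rho(\beta(\gamma^{-2}p^{-1}z)^{-1}).$$ Normal ordering $:\ :$ moves all $a_n$ with $n>0$ to the right of all $a_{-n}$ with $n>0$. For $2\le i\le m$ let $$T_i(z)=\sum_{1\le j_1<\cdots<j_i\le m}y_{j_1}\cdots y_{j_i}:\Lambda_{j_1}(z)\Lambda_{j_2}(pz)\cdots\Lambda_{j_i}(p^{i-1}z):,$$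 $$T^*_i(z)=\sum_{1\le j_1<\cdots<j_i\le m}y_{j_1}^{-1}\cdots y_{j_i}^{-1}:\Lambda^*_{j_1}(z)\Lambda^*_{j_2}(p^{-1}z)\cdots\Lambda^*_{j_i}(p^{-i+1}z):.$$ Finally let $$f_{1,m}(x)=\exp\Big(\sum_{n\ge1}\frac1n\frac{(1-q^n)(1-t^{-n})(1-p^{(m-1)n})}{1-p^{mn}}x^n\Big),$$ $$\gamma_+(z,w)=\frac{(z-q^{-1}w)(z-qp^{-1}w)}{(z-w)(z-p^{-1}w)},\qquad\gamma_-(z,w)=\frac{(z-qw)(z-q^{-1}pw)}{(z-w)(z-pw)},$$ expanded in the region $|w|<|z|$. Then the following identities of formal series of operators on $\mathcal F^{\otimes m}$ hold. 1. For all $i,j$: $f_{1,m}(w/z)\,\Lambda_i(z)\Lambda_j(w)={:}\Lambda_i(z)\Lambda_j(w){:}\times\begin{cases}1&i=j\\\gamma_+(z,w)&i<j\\\gamma_-(z,w)&i>j.\end{cases}$ 2. $:\Lambda_1(z)\Lambda_2(pz)\cdots\Lambda_m(p^{m-1}z):\;=1$, and $T_m(z)=y_1y_2\cdots y_m$. 3.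 For all $k$: $\Lambda_k^*(z)={:}\prod_{i=1}^{k-1}\Lambda_i(p^{i-1}z)\prod_{l=k+1}^m\Lambda_l(p^{l-2}z){:}$, and $T_1^*(z)=y_1^{-1}\cdots y_m^{-1}\,T_{m-1}(z)$. 4. For all $i,j$: $f_{1,m}(w/z)\,\Lambda^*_i(z)\Lambda^*_j(w)={:}\Lambda^*_i(z)\Lambda^*_j(w){:}\times\begin{cases}1&i=j\\\gamma_-(z,w)&i<j\\\gamma_+(z,w)&i>j.\end{cases}$ 5. $:\Lambda^*_1(z)\Lambda^*_2(p^{-1}z)\cdots\Lambda^*_m(p^{-m+1}z):\;=1$, and $T_m^*(z)=y_1^{-1}y_2^{-1}\cdots y_m^{-1}$. -/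

import Mathlib

open scoped TensorProduct

noncomputable section

namespace LevelRep

/-! ### Formal power series with operator coefficients -/

/-- `exp S` for a formal power series `S` with zero constant term. -/
def expSeries (K : Type*) [Field K] {A : Type*} [Ring A] [Algebra K A] (S : PowerSeries A) :
    PowerSeries A :=
  PowerSeries.mk fun N =>
    ∑ k ∈ Finset.range (N + 1), ((k.factorial : K)⁻¹) • PowerSeries.coeff N (S ^ k)

/-- The series `∑_{n > 0} f n X ^ n`. -/
def posSeries {A : Type*} [Ring A] (f : ℕ → A) : PowerSeries A :=
  PowerSeries.mk fun n => if n = 0 then 0 else f n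

/-- The substitution `X ↦ ζ X`. -/
def scaleSeries {K : Type*} [Field K] {A : Type*} [Ring A] [Algebra K A] (ζ : K)
    (S : PowerSeries A) : PowerSeries A :=
  PowerSeries.mk fun n => ζ ^ n • PowerSeries.coeff n S

/-- The coefficient of `X ^ n` of a power series, for an integer exponent `n`. -/
def intCoeff {A : Type*} [Ring A] (S : PowerSeries A) (n : ℤ) : A :=
  if 0 ≤ n then PowerSeries.coeff n.toNat S else 0

/-! ### The Fock space and its tensor powers -/

/-- The Fock space `𝓕`, induced from the one-dimensional module of the nonnegative Heisenberg
modes: polynomials in the creation operators, the variable `X n` standing for `a_{-n}`, `n > 0`,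
and `1` for the vacuum. -/
abbrev Fock (K : Type*) [Field K] := MvPolynomial ℕ+ K

/-- The tensor power `𝓕^{⊗ m}`. -/
abbrev FockT (K : Type*) [Field K] (m : ℕ) := ⨂[K] _ : Fin m, Fock K

/-- Operators on `𝓕^{⊗ m}`. -/
abbrev Op (K : Type*) [Field K] (m : ℕ) := Module.End K (FockT K m)

/-- The Heisenberg generator `a_n` acting on the Fock space: `a_{-n}` is multiplication by
its variable, `a_0` is the identity, and `a_n = n (1 - q^n) / (1 - t^n) ∂/∂a_{-n}` for `n > 0`. -/
def heis {K : Type*} [Field K] (q t : K) : ℤ → Module.End K (Fock K)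
  | Int.ofNat 0 => 1
  | Int.ofNat (n + 1) =>
      (((n + 1 : ℕ) : K) * (1 - q ^ (n + 1)) / (1 - t ^ (n + 1))) •
        (MvPolynomial.pderiv (R := K) n.succPNat).toLinearMap
  | Int.negSucc n => LinearMap.mulLeft K (MvPolynomial.X n.succPNat)

/-- `1 ⊗ ⋯ ⊗ A ⊗ ⋯ ⊗ 1` with `A` in the `k`-th component. -/
def slot {K : Type*} [Field K] {m : ℕ} (k : Fin m) (A : Module.End K (Fock K)) : Op K m :=
  PiTensorProduct.map (Function.update (fun _ => LinearMap.id) k A)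

/-- The operator `a_{n,(k)}`: the generator `a_n` in the `k`-th tensor component. -/
def heisAt {K : Type*} [Field K] (q t : K) {m : ℕ} (k : Fin m) (n : ℤ) : Op K m :=
  slot k (heis q t n)

/-! ### The degree filtration -/

/-- The part of degree at most `d` of the Fock space, where `a_{-n}` has degree `n`. -/
def fil (K : Type*) [Field K] (d : ℤ) : Submodule K (Fock K) :=
  Submodule.span K {x | ∃ s : ℕ+ →₀ ℕ,
    Finsupp.weight (fun n : ℕ+ => ((n : ℕ) : ℤ)) s ≤ d ∧ x = MvPolynomial.monomial s 1}

/-- The part of degree at most `d` of `𝓕^{⊗ m}`. -/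
def filT (K : Type*) [Field K] (m : ℕ) (d : ℤ) : Submodule K (FockT K m) :=
  Submodule.span K {x | ∃ (e : Fin m → ℤ) (f : Fin m → Fock K),
    (∀ k, f k ∈ fil K (e k)) ∧ ∑ k, e k ≤ d ∧ x = PiTensorProduct.tprod K f}

theorem fil_of_neg (K : Type*) [Field K] {d : ℤ} (hd : d < 0) : fil K d = ⊥ := by
  rw [fil, Submodule.span_eq_bot]
  rintro x ⟨s, hs, rfl⟩
  exfalso
  have : 0 ≤ Finsupp.weight (fun n : ℕ+ => ((n : ℕ) : ℤ)) s := by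
    rw [Finsupp.weight_apply]
    exact Finset.sum_nonneg fun i _ => by positivity
  omega

theorem exists_fil {K : Type*} [Field K] (x : Fock K) : ∃ d, 0 ≤ d ∧ x ∈ fil K d := by
  induction x using MvPolynomial.induction_on' with
  | monomial s a =>
    refine ⟨max 0 (Finsupp.weight (fun n : ℕ+ => ((n : ℕ) : ℤ)) s), le_max_left _ _, ?_⟩
    have : MvPolynomial.monomial s a = a • MvPolynomial.monomial s (1 : K) := by
      simp [MvPolynomial.smul_monomial]
    rw [this]
    exact Submodule.smul_mem _ _ (Submodule.subset_span ⟨s, le_max_right _ _, rfl⟩)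
  | add x y hx hy =>
    obtain ⟨d, hd, hx⟩ := hx
    obtain ⟨e, he, hy⟩ := hy
    have mono : ∀ {d e : ℤ}, d ≤ e → fil K d ≤ fil K e := fun h =>
      Submodule.span_mono fun x ⟨s, hs, hx⟩ => ⟨s, hs.trans h, hx⟩
    exact ⟨max d e, le_max_of_le_left hd,
      add_mem (mono (le_max_left _ _) hx) (mono (le_max_right _ _) hy)⟩

theorem heis_fil {K : Type*} [Field K] (q t : K) {n : ℕ} (hn : n ≠ 0) {d : ℤ} {x : Fock K}
    (hx : x ∈ fil K d) : heis q t n x ∈ fil K (d - n) := by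
  obtain ⟨n, rfl⟩ := Nat.exists_eq_succ_of_ne_zero hn
  change ((_ : K) • (MvPolynomial.pderiv (R := K) n.succPNat).toLinearMap) x ∈ fil K (d - (n.succ : ℕ))
  rw [LinearMap.smul_apply]
  refine Submodule.smul_mem _ _ ?_
  revert hx
  revert x
  suffices h : fil K d ≤ (fil K (d - (n.succ : ℕ))).comap
      (MvPolynomial.pderiv (R := K) n.succPNat).toLinearMap from fun x hx => h hx
  rw [fil, Submodule.span_le]
  rintro _ ⟨s, hs, rfl⟩
  change MvPolynomial.pderiv (R := K) n.succPNat (MvPolynomial.monomial s 1) ∈ fil K (d - (n.succ : ℕ))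
  rw [MvPolynomial.pderiv_monomial]
  by_cases h0 : s n.succPNat = 0
  · simp [h0]
  · have key : MvPolynomial.monomial (s - Finsupp.single n.succPNat 1)
        (1 * (s n.succPNat : K)) =
        (s n.succPNat : K) • MvPolynomial.monomial (s - Finsupp.single n.succPNat 1) (1 : K) := by
      simp [MvPolynomial.smul_monomial]
    rw [key]
    refine Submodule.smul_mem _ _ (Submodule.subset_span ⟨_, ?_, rfl⟩)
    have hle : Finsupp.single n.succPNat 1 ≤ s := by
      rw [Finsupp.single_le_iff]; omega
    have h2 := congrArg (Finsupp.weight (fun n : ℕ+ => ((n : ℕ) : ℤ)))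
      (tsub_add_cancel_of_le hle)
    rw [map_add, Finsupp.weight_single] at h2
    simp only [Nat.succPNat_coe, one_smul] at h2
    omega

theorem filT_of_neg (K : Type*) [Field K] (m : ℕ) {d : ℤ} (hd : d < 0) : filT K m d = ⊥ := by
  rw [filT, Submodule.span_eq_bot]
  rintro x ⟨e, f, hf, he, rfl⟩
  obtain ⟨k, hk⟩ : ∃ k, e k < 0 := by
    by_contra! h
    have := Finset.sum_nonneg fun k (_ : k ∈ Finset.univ) => h k
    omega
  have h0 : f k = 0 := by simpa [fil_of_neg K hk] using hf k
  exact MultilinearMap.map_coord_zero _ k h0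

theorem exists_filT {K : Type*} [Field K] {m : ℕ} (x : FockT K m) : ∃ d, x ∈ filT K m d := by
  induction x using PiTensorProduct.induction_on with
  | smul_tprod r f =>
    choose e _ he using fun k => exists_fil (f k)
    exact ⟨∑ k, e k, Submodule.smul_mem _ _ (Submodule.subset_span ⟨e, f, he, le_rfl, rfl⟩)⟩
  | add x y hx hy =>
    obtain ⟨d, hx⟩ := hx
    obtain ⟨e, hy⟩ := hy
    have mono : ∀ {d e : ℤ}, d ≤ e → filT K m d ≤ filT K m e := fun h =>
      Submodule.span_mono fun x ⟨e, f, hf, hs, hx⟩ => ⟨e, f, hf, hs.trans h, hx⟩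
    exact ⟨max d e, add_mem (mono (le_max_left _ _) hx) (mono (le_max_right _ _) hy)⟩

theorem heisAt_filT {K : Type*} [Field K] (q t : K) {m : ℕ} (k : Fin m) {n : ℕ} (hn : n ≠ 0)
    {d : ℤ} {x : FockT K m} (hx : x ∈ filT K m d) :
    heisAt q t k n x ∈ filT K m (d - n) := by
  revert hx
  revert x
  suffices h : filT K m d ≤ (filT K m (d - n)).comap (heisAt q t k n) from fun x hx => h hx
  rw [filT, Submodule.span_le]
  rintro _ ⟨e, f, hf, he, rfl⟩
  change heisAt q t k n (PiTensorProduct.tprod K f) ∈ filT K m (d - n)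
  rw [heisAt, slot, PiTensorProduct.map_tprod]
  refine Submodule.subset_span ⟨Function.update e k (e k - n), _, fun j => ?_, ?_, rfl⟩
  · by_cases hj : j = k
    · subst hj
      simpa using heis_fil q t hn (hf j)
    · simpa [Function.update_of_ne hj] using hf j
  · rw [Finset.sum_update_of_mem (Finset.mem_univ k)]
    have := Finset.add_sum_erase Finset.univ e (Finset.mem_univ k)
    rw [Finset.sdiff_singleton_eq_erase]
    omega

/-- The series `∑ D_n z^{-n}` with operator coefficients such that `D_n` lowers the degree by at
least `n`. Every such series acts on each vector as a polynomial in `z^{-1}`. -/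
def lowering (K : Type*) [Field K] (m : ℕ) : Subalgebra K (PowerSeries (Op K m)) where
  carrier := {D | ∀ (n : ℕ) (d : ℤ), ∀ v ∈ filT K m d,
    PowerSeries.coeff n D v ∈ filT K m (d - n)}
  mul_mem' {D E} hD hE n d v hv := by
    rw [PowerSeries.coeff_mul, LinearMap.sum_apply]
    refine Submodule.sum_mem _ fun ij hij => ?_
    rw [Finset.HasAntidiagonal.mem_antidiagonal] at hij
    have := hD ij.1 _ _ (hE ij.2 d v hv)
    rwa [show d - (ij.2 : ℤ) - ij.1 = d - n by omega] at this
  add_mem' {D E} hD hE n d v hv := by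
    rw [map_add]
    exact add_mem (hD n d v hv) (hE n d v hv)
  algebraMap_mem' r n d v hv := by
    rw [PowerSeries.algebraMap_apply, PowerSeries.coeff_C]
    split_ifs with h
    · subst h
      simpa [Module.algebraMap_end_apply] using Submodule.smul_mem _ r hv
    · simp

theorem mem_lowering {K : Type*} [Field K] {m : ℕ} {D : PowerSeries (Op K m)} :
    D ∈ lowering K m ↔ ∀ (n : ℕ) (d : ℤ), ∀ v ∈ filT K m d,
      PowerSeries.coeff n D v ∈ filT K m (d - n) := Iff.rfl

theorem posSeries_mem {K : Type*} [Field K] (q t : K) {m : ℕ} (f : ℕ → Op K m)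
    (hf : ∀ n : ℕ, n ≠ 0 → f n ∈ Submodule.span K (Set.range fun k : Fin m => heisAt q t k (n : ℤ))) :
    posSeries f ∈ lowering K m := by
  intro n d v hv
  rw [posSeries, PowerSeries.coeff_mk]
  split_ifs with h
  · simp
  · have := hf n h
    generalize f n = g at this
    induction this using Submodule.span_induction with
    | mem x hx =>
      obtain ⟨k, rfl⟩ := hx
      exact heisAt_filT q t k h hv
    | zero => simp
    | add x y _ _ hx hy => exact add_mem hx hy
    | smul c x _ hx => exact Submodule.smul_mem _ c hx

theorem expSeries_mem {K : Type*} [Field K] {m : ℕ} {S : PowerSeries (Op K m)}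
    (hS : S ∈ lowering K m) : expSeries K S ∈ lowering K m := by
  intro n d v hv
  rw [expSeries, PowerSeries.coeff_mk, LinearMap.sum_apply]
  exact Submodule.sum_mem _ fun k _ => Submodule.smul_mem _ _ (pow_mem hS k n d v hv)

theorem scaleSeries_mem {K : Type*} [Field K] {m : ℕ} (ζ : K) {S : PowerSeries (Op K m)}
    (hS : S ∈ lowering K m) : scaleSeries ζ S ∈ lowering K m := by
  intro n d v hv
  rw [scaleSeries, PowerSeries.coeff_mk]
  exact Submodule.smul_mem _ _ (hS n d v hv)

theorem lowering_finite {K : Type*} [Field K] {m : ℕ} (D : lowering K m) (v : FockT K m) :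
    {n | PowerSeries.coeff n D.1 v ≠ 0}.Finite := by
  obtain ⟨d, hd⟩ := exists_filT v
  refine (Set.finite_Iic d.toNat).subset fun n hn => ?_
  by_contra h
  have h1 := D.2 n d v hd
  rw [filT_of_neg K m (by simp at h; omega)] at h1
  exact hn (by simpa using h1)

theorem lowering_finite₂ {K : Type*} [Field K] {m : ℕ} (D E : lowering K m) (v : FockT K m) :
    {l : ℕ × ℕ | PowerSeries.coeff l.1 D.1 (PowerSeries.coeff l.2 E.1 v) ≠ 0}.Finite := by
  obtain ⟨d, hd⟩ := exists_filT v
  refine ((Set.finite_Iic d.toNat).prod (Set.finite_Iic d.toNat)).subset fun l hl => ?_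
  by_contra h
  have h1 := D.2 l.1 _ _ (E.2 l.2 d v hd)
  rw [filT_of_neg K m (by simp only [Set.mem_prod, Set.mem_Iic] at h; omega)] at h1
  exact hl (by simpa using h1)

/-! ### Fields on `𝓕^{⊗ m}`

A field `A(z) = ∑_n A_n z^n` is a `VertexOperator`: it sends a vector `v` to a Laurent series
`A(z) v` in `z`. -/

/-- The pointwise finite sum of a family of operators. -/
def locSum {K : Type*} [Field K] {V : Type*} [AddCommGroup V] [Module K V] {ι : Type*}
    (F : ι → Module.End K V) (hF : ∀ v, {i | F i v ≠ 0}.Finite) : Module.End K V where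
  toFun v := ∑ᶠ i, F i v
  map_add' u v := by
    simp only [map_add]
    exact finsum_add_distrib (hF u) (hF v)
  map_smul' c v := by
    simp only [map_smul, RingHom.id_apply]
    exact (smul_finsum c _).symm

/-- The coefficient of `z ^ n` of a field. -/
abbrev modeOf {K : Type*} [Field K] {m : ℕ} (A : VertexOperator K (FockT K m)) (n : ℤ) : Op K m :=
  HVertexOperator.coeff A n

theorem exists_modeOf_eq_zero {K : Type*} [Field K] {m : ℕ} (A : VertexOperator K (FockT K m))
    (v : FockT K m) : ∃ M : ℤ, ∀ n < M, modeOf A n v = 0 :=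
  ⟨_, fun n hn => VertexOperator.coeff_eq_zero_of_lt_order A n v hn⟩

/-- The constant field `1`. -/
def oneField (K : Type*) [Field K] (m : ℕ) : VertexOperator K (FockT K m) :=
  VertexOperator.of_coeff (fun n => if n = 0 then 1 else 0) fun _ => ⟨0, fun n hn => by
    by_contra h
    exact hn (by simp [show n ≠ 0 by omega])⟩

/-- The field `A(ζ z)`. -/
def scaleField {K : Type*} [Field K] {m : ℕ} (ζ : K) (A : VertexOperator K (FockT K m)) :
    VertexOperator K (FockT K m) :=
  VertexOperator.of_coeff (fun n => ζ ^ n • modeOf A n) fun v => by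
    obtain ⟨M, hM⟩ := exists_modeOf_eq_zero A v
    refine ⟨M, fun n hn => ?_⟩
    by_contra h
    exact hn (by simp only [LinearMap.smul_apply, hM n (by omega), smul_zero])

/-- The product `C(z) A(z)` of a series `C(z) = ∑_{j ≥ 0} C_j z^j` and a field `A(z)`. -/
def lmulField {K : Type*} [Field K] {m : ℕ} (C : PowerSeries (Op K m))
    (A : VertexOperator K (FockT K m)) : VertexOperator K (FockT K m) :=
  VertexOperator.of_coeff
    (fun n => locSum (fun j : ℕ => PowerSeries.coeff j C * modeOf A (n - j)) fun v => by
      obtain ⟨M, hM⟩ := exists_modeOf_eq_zero A v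
      refine (Set.finite_Iic (n - M).toNat).subset fun j hj => ?_
      by_contra h
      exact hj (by
        rw [Module.End.mul_apply, hM _ (by simp only [Set.mem_Iic] at h; omega), map_zero]))
    fun v => by
      obtain ⟨M, hM⟩ := exists_modeOf_eq_zero A v
      refine ⟨M, fun n hn => ?_⟩
      by_contra h
      refine hn ?_
      change ∑ᶠ j : ℕ, _ = _
      refine finsum_eq_zero_of_forall_eq_zero fun j => ?_
      rw [Module.End.mul_apply, hM _ (by omega), map_zero]

/-- The product `A(z) D(z)` of a field `A(z)` and a series `D(z) = ∑_{l ≥ 0} D_l z^{-l}`. -/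
def rmulField {K : Type*} [Field K] {m : ℕ} (A : VertexOperator K (FockT K m))
    (D : lowering K m) : VertexOperator K (FockT K m) :=
  VertexOperator.of_coeff
    (fun n => locSum (fun l : ℕ => modeOf A (n + l) * PowerSeries.coeff l D.1) fun v =>
      (lowering_finite D v).subset fun l hl h0 => hl (by rw [Module.End.mul_apply, h0, map_zero]))
    fun v => by
      choose M hM using fun l : ℕ => exists_modeOf_eq_zero A (PowerSeries.coeff l D.1 v)
      obtain ⟨B, hB⟩ : BddBelow ((fun l : ℕ => M l - l) ''
          {l | PowerSeries.coeff l D.1 v ≠ 0}) := ((lowering_finite D v).image _).bddBelow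
      refine ⟨B, fun n hn => ?_⟩
      by_contra h
      refine hn ?_
      change ∑ᶠ l : ℕ, _ = _
      refine finsum_eq_zero_of_forall_eq_zero fun l => ?_
      rw [Module.End.mul_apply]
      by_cases hl : PowerSeries.coeff l D.1 v = 0
      · rw [hl, map_zero]
      · have := hB ⟨l, hl, rfl⟩
        exact hM l _ (by dsimp only at this; omega)

/-! ### Normal ordering -/

/-- A normally ordered operator `C(z) D(z)`: a series `C(z)` in `z` of creation operators and
a series `D(z)` in `z⁻¹` of annihilation operators. The (componentwise) product of two such pairs
`(C, D)` and `(C', D')` is the normally ordered product `C(z) C'(z) D(z) D'(z)`, with all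
creation operators on the left of all annihilation operators. -/
abbrev Ordered (K : Type*) [Field K] (m : ℕ) := PowerSeries (Op K m) × lowering K m

/-- The field `C(z) D(z)` of a normally ordered operator. -/
def Ordered.field {K : Type*} [Field K] {m : ℕ} (S : Ordered K m) :
    VertexOperator K (FockT K m) :=
  lmulField S.1 (rmulField (oneField K m) S.2)

/-- The substitution `z ↦ ζ z` in a series in `z⁻¹`. -/
def scaleLow {K : Type*} [Field K] {m : ℕ} (ζ : K) (D : lowering K m) : lowering K m :=
  ⟨scaleSeries ζ⁻¹ D.1, scaleSeries_mem _ D.2⟩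

/-- The substitution `z ↦ ζ z` in a normally ordered operator. -/
def Ordered.scale {K : Type*} [Field K] {m : ℕ} (ζ : K) (S : Ordered K m) : Ordered K m :=
  (scaleSeries ζ S.1, scaleLow ζ S.2)

/-- The exponents `(b, a)` of `w ^ b z ^ a`, ordered lexicographically: Hahn series with these
exponents contain the iterated Laurent series in `K((z))((w))`, in which functions of `z` and `w`
are expanded in the region `|w| < |z|`. -/
abbrev Exps := ℤ ×ₗ ℤ

theorem isPWO_support_of_bdd {M : Type*} [Zero M] (f : Exps → M) (B : ℤ)
    (hf : ∀ g, f g ≠ 0 → B ≤ (ofLex g).1 ∧ B ≤ (ofLex g).2) : (Function.support f).IsPWO := by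
  have h1 : (Set.Ici B).IsPWO := (BddBelow.isWF ⟨B, fun _ h => h⟩).isPWO
  refine ((h1.prod h1).image_of_monotone Prod.Lex.toLex_mono).mono fun g hg => ?_
  exact ⟨ofLex g, hf g hg, rfl⟩

/-- The normally ordered product `:S(z) T(w):`, that is `C(z) C'(w) D(z) D'(w)` for
`S = (C, D)` and `T = (C', D')`. -/
def ordered₂ {K : Type*} [Field K] {m : ℕ} (S T : Ordered K m) :
    HVertexOperator Exps K (FockT K m) (FockT K m) :=
  HVertexOperator.of_coeff
    (fun g => locSum (fun l : ℕ × ℕ =>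
        intCoeff S.1 ((ofLex g).2 + l.1) * intCoeff T.1 ((ofLex g).1 + l.2) *
          (PowerSeries.coeff l.1 S.2.1 * PowerSeries.coeff l.2 T.2.1)) fun v =>
      (lowering_finite₂ S.2 T.2 v).subset fun l hl h0 => hl (by
        rw [Module.End.mul_apply, Module.End.mul_apply (PowerSeries.coeff l.1 _), h0, map_zero]))
    fun v => by
      obtain ⟨d, hd⟩ : BddAbove ((fun l : ℕ × ℕ => (max l.1 l.2 : ℤ)) '' {l : ℕ × ℕ |
        PowerSeries.coeff l.1 S.2.1 (PowerSeries.coeff l.2 T.2.1 v) ≠ 0}) :=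
          ((lowering_finite₂ S.2 T.2 v).image _).bddAbove
      refine isPWO_support_of_bdd _ (-d) fun g hg => ?_
      by_contra h
      refine hg ?_
      change ∑ᶠ l : ℕ × ℕ, _ = _
      refine finsum_eq_zero_of_forall_eq_zero fun l => ?_
      rw [Module.End.mul_apply, Module.End.mul_apply (PowerSeries.coeff l.1 _)]
      by_cases hl : PowerSeries.coeff l.1 S.2.1 (PowerSeries.coeff l.2 T.2.1 v) = 0
      · rw [hl, map_zero]
      · have := hd ⟨l, hl, rfl⟩
        dsimp only at this
        rcases not_and_or.mp h with h | h
        · rw [intCoeff, intCoeff, if_neg (show ¬ 0 ≤ (ofLex g).1 + (l.2 : ℤ) by omega)]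
          simp
        · rw [intCoeff, if_neg (show ¬ 0 ≤ (ofLex g).2 + (l.1 : ℤ) by omega)]
          simp

/-! ### Scalar functions of `z` and `w` -/

/-- The variable `z`. -/
def zVar (K : Type*) [Field K] : HahnSeries Exps K := HahnSeries.single (toLex (0, 1)) 1

/-- The variable `w`. -/
def wVar (K : Type*) [Field K] : HahnSeries Exps K := HahnSeries.single (toLex (1, 0)) 1

/-- The substitution `X ↦ w / z` in a power series. -/
def atRatio {K : Type*} [Field K] : PowerSeries K →+* HahnSeries Exps K :=
  (HahnSeries.embDomainRingHom
    { toFun := fun l : ℕ => (toLex ((l : ℤ), -(l : ℤ)) : Exps)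
      map_zero' := rfl
      map_add' := fun a b => by
        apply ofLex.injective
        ext
        · exact Nat.cast_add a b
        · change -((a + b : ℕ) : ℤ) = -(a : ℤ) + -(b : ℤ)
          omega }
    (fun a b h => by
      have h1 : (a : ℤ) = b := congrArg (fun g : Exps => (ofLex g).1) h
      exact_mod_cast h1)
    (fun a b => by
      change toLex ((a : ℤ), -(a : ℤ)) ≤ toLex ((b : ℤ), -(b : ℤ)) ↔ a ≤ b
      rw [Prod.Lex.toLex_le_toLex]
      omega)).comp HahnSeries.toPowerSeries.symm.toRingHom

/-- The function `f_{k,l}`, as a power series in its argument; here `p = q / t`. -/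
def fSeries {K : Type*} [Field K] (q t : K) (k l : ℕ) : PowerSeries K :=
  expSeries K (posSeries fun n =>
    1 / (n : K) * ((1 - q ^ n) * (1 - t ^ (-(n : ℤ))) *
      ((q / t) ^ (((k : ℤ) - 1) * n) - (q / t) ^ (((l : ℤ) - 1) * n)) /
        (1 - (q / t) ^ (l * n))))

/-- The function `γ_+(z, w; q, t)`. -/
def gammaPlus {K : Type*} [Field K] (q t : K) : HahnSeries Exps K :=
  (zVar K - q⁻¹ • wVar K) * (zVar K - (q * t⁻¹) • wVar K) /
    ((zVar K - wVar K) * (zVar K - t⁻¹ • wVar K))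

/-- The function `γ_-(z, w; q, t)`. -/
def gammaMinus {K : Type*} [Field K] (q t : K) : HahnSeries Exps K :=
  (zVar K - q • wVar K) * (zVar K - (q⁻¹ * t) • wVar K) /
    ((zVar K - wVar K) * (zVar K - t • wVar K))

/-! ### Level one vertex operators

From here on `r` is a fourth root of `p = q / t`, so that `p ^ (j / 4)` is `r ^ j`. The operators
below act in the `k`-th component of `𝓕^{⊗ m}`. -/

/-- The creation series `exp (∑_{n > 0} c_n a_{-n,(k)} z^n)`. -/
def creation {K : Type*} [Field K] (q t : K) {m : ℕ} (k : Fin m) (c : ℕ → K) :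
    PowerSeries (Op K m) :=
  expSeries K (posSeries fun n => c n • heisAt q t k (-(n : ℤ)))

/-- The annihilation series `exp (∑_{n > 0} c_n a_{n,(k)} z^{-n})`. -/
def annihilation {K : Type*} [Field K] (q t : K) {m : ℕ} (k : Fin m) (c : ℕ → K) :
    lowering K m :=
  ⟨expSeries K (posSeries fun n => c n • heisAt q t k (n : ℤ)),
    expSeries_mem (posSeries_mem q t _ fun _ _ =>
      Submodule.smul_mem _ _ (Submodule.subset_span ⟨k, rfl⟩))⟩

/-- The vertex operator `η(z)`. -/
def eta {K : Type*} [Field K] (q t : K) {m : ℕ} (k : Fin m) : Ordered K m :=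
  (creation q t k fun n => (1 - t ^ (-(n : ℤ))) / n,
    annihilation q t k fun n => -((1 - t ^ n) / n))

/-- The vertex operator `ξ(z)`. -/
def xi {K : Type*} [Field K] (q t r : K) {m : ℕ} (k : Fin m) : Ordered K m :=
  (creation q t k fun n => -((1 - t ^ (-(n : ℤ))) / n * r ^ (-2 * (n : ℤ))),
    annihilation q t k fun n => (1 - t ^ n) / n * r ^ (-2 * (n : ℤ)))

/-- The vertex operator `φ⁺(z)`. -/
def phiPlus {K : Type*} [Field K] (q t r : K) {m : ℕ} (k : Fin m) : lowering K m :=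
  annihilation q t k fun n => -((1 - t ^ n) / n * (1 - (q / t) ^ (-(n : ℤ))) * r ^ n)

/-- The vertex operator `φ⁻(z)`. -/
def phiMinus {K : Type*} [Field K] (q t r : K) {m : ℕ} (k : Fin m) : PowerSeries (Op K m) :=
  creation q t k fun n => (1 - t ^ (-(n : ℤ))) / n * (1 - (q / t) ^ (-(n : ℤ))) * r ^ n

/-- The image of `b_n` under the level one representation:
`b_n ↦ - (1 - t^n) / |n| * (p^{|n|/2} - p^{-|n|/2}) a_n`. -/
def levelOneB {K : Type*} [Field K] (q t r : K) {m : ℕ} (k : Fin m) (n : ℤ) : Op K m :=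
  (-((1 - t ^ n) / (n.natAbs : K) *
    (r ^ (2 * (n.natAbs : ℤ)) - r ^ (-2 * (n.natAbs : ℤ))))) • heisAt q t k n

/-! ### The level `m` representation `ρ_y^{(m)} = (ρ_{y_1} ⊗ ⋯ ⊗ ρ_{y_m}) ∘ Δ^{(m)}`

On each tensor component `γ^{1/2}` acts by `p^{-1/4} = r⁻¹`, `ψ^±(z)` by `φ^±(z)`, `x⁺(z)` by
`y_k η(z)` and `x⁻(z)` by `y_k⁻¹ ξ(z)`. The images of the generating currents on `𝓕^{⊗ m}` are
obtained by applying the coproduct once for each component, starting from the counit. -/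

/-- The image of `b_n`, from `Δ(b_n) = b_n ⊗ γ^{-|n|} + 1 ⊗ b_n`. -/
def rhoB {K : Type*} [Field K] (q t r : K) (m : ℕ) (n : ℤ) : Op K m :=
  (List.finRange m).foldl
    (fun B k => ((r ^ (-2 : ℤ)) ^ (-(n.natAbs : ℤ))) • B + levelOneB q t r k n) 0

/-- The image of `x⁺(z)`, from
`Δ(x⁺(z)) = x⁺(z) ⊗ 1 + ψ⁻(γ_{(1)}^{1/2} z) ⊗ x⁺(γ_{(1)} z)`. -/
def rhoXPlus {K : Type*} [Field K] (q t r : K) {m : ℕ} (y : Fin m → Kˣ) :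
    VertexOperator K (FockT K m) :=
  (List.finRange m).foldr
    (fun k X => (y k : K) • (eta q t k).field +
      lmulField (scaleSeries r⁻¹ (phiMinus q t r k)) (scaleField (r⁻¹ ^ 2) X)) 0

/-- The image of `x⁻(z)`, from
`Δ(x⁻(z)) = x⁻(γ_{(2)} z) ⊗ ψ⁺(γ_{(2)}^{1/2} z) + 1 ⊗ x⁻(z)`. -/
def rhoXMinus {K : Type*} [Field K] (q t r : K) {m : ℕ} (y : Fin m → Kˣ) :
    VertexOperator K (FockT K m) :=
  (List.finRange m).foldl
    (fun X k => rmulField (scaleField (r⁻¹ ^ 2) X) (scaleLow r⁻¹ (phiPlus q t r k)) +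
      ((y k)⁻¹ : K) • (xi q t r k).field) 0

/-- The value `p^{-m/2}` of `γ` at level `m`. -/
def levelGamma {K : Type*} [Field K] (r : K) (m : ℕ) : K := (r⁻¹ ^ 2) ^ m

/-- The image of `α(z) ^ ε`, where `ε = ± 1`. -/
def rhoAlpha {K : Type*} [Field K] (q t r : K) (m : ℕ) (ε : K) : PowerSeries (Op K m) :=
  expSeries K (posSeries fun n =>
    (-(ε / (levelGamma r m ^ n - levelGamma r m ^ (-(n : ℤ))))) • rhoB q t r m (-(n : ℤ)))

theorem rhoB_mem {K : Type*} [Field K] (q t r : K) (m : ℕ) (n : ℤ) :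
    rhoB q t r m n ∈ Submodule.span K (Set.range fun k : Fin m => heisAt q t k n) := by
  rw [rhoB]
  suffices h : ∀ (l : List (Fin m)) (B : Op K m),
      B ∈ Submodule.span K (Set.range fun k : Fin m => heisAt q t k n) →
      l.foldl (fun B k => ((r ^ (-2 : ℤ)) ^ (-(n.natAbs : ℤ))) • B + levelOneB q t r k n) B ∈
        Submodule.span K (Set.range fun k : Fin m => heisAt q t k n) from
    h _ _ (Submodule.zero_mem _)
  intro l
  induction l with
  | nil => exact fun B hB => hB
  | cons k l ih =>
    intro B hB
    exact ih _ (add_mem (Submodule.smul_mem _ _ hB)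
      (Submodule.smul_mem _ _ (Submodule.subset_span ⟨k, rfl⟩)))

/-- The image of `β(z) ^ ε`, where `ε = ± 1`. -/
def rhoBeta {K : Type*} [Field K] (q t r : K) (m : ℕ) (ε : K) : lowering K m :=
  ⟨expSeries K (posSeries fun n =>
    (ε / (levelGamma r m ^ n - levelGamma r m ^ (-(n : ℤ)))) • rhoB q t r m (n : ℤ)),
    expSeries_mem (posSeries_mem q t _ fun n _ => Submodule.smul_mem _ _ (rhoB_mem q t r m n))⟩

/-! ### The currents of the deformed `W`-algebra -/

/-- `T_1(z)`, the image of `t(z) = α(z) x⁺(z) β(z)`. -/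
def tOne {K : Type*} [Field K] (q t r : K) {m : ℕ} (y : Fin m → Kˣ) :
    VertexOperator K (FockT K m) :=
  lmulField (rhoAlpha q t r m 1) (rmulField (rhoXPlus q t r y) (rhoBeta q t r m 1))

/-- `T_1^*(z)`, the image of
`t^*(z) = α(p⁻¹ z)⁻¹ x⁻(p⁻¹ γ⁻¹ z) β(γ⁻² p⁻¹ z)⁻¹`. -/
def tOneStar {K : Type*} [Field K] (q t r : K) {m : ℕ} (y : Fin m → Kˣ) :
    VertexOperator K (FockT K m) :=
  lmulField (scaleSeries (q / t)⁻¹ (rhoAlpha q t r m (-1)))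
    (rmulField (scaleField ((q / t)⁻¹ * (levelGamma r m)⁻¹) (rhoXMinus q t r y))
      (scaleLow ((levelGamma r m)⁻¹ ^ 2 * (q / t)⁻¹) (rhoBeta q t r m (-1))))

/-- `Λ̃_i(z) = φ⁻(p^{-1/4} z) ⊗ φ⁻(p^{-3/4} z) ⊗ ⋯ ⊗ η(p^{-(i-1)/2} z) ⊗ 1 ⊗ ⋯ ⊗ 1`. -/
def lambdaTilde {K : Type*} [Field K] (q t r : K) {m : ℕ} (i : Fin m) : Ordered K m :=
  ((List.finRange m).map fun k =>
    if k < i then (scaleSeries (r ^ (-(2 * (k : ℤ) + 1))) (phiMinus q t r k), 1)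
    else if k = i then (eta q t k).scale (r ^ (-2 * (i : ℤ)))
    else 1).prod

/-- `Λ̃_i^*(z) = 1 ⊗ ⋯ ⊗ 1 ⊗ ξ(p^{-(m-i)/2} z) ⊗ φ⁺(p^{-(2m-2i-1)/4} z) ⊗ ⋯ ⊗ φ⁺(p^{-1/4} z)`. -/
def lambdaTildeStar {K : Type*} [Field K] (q t r : K) {m : ℕ} (i : Fin m) : Ordered K m :=
  ((List.finRange m).map fun k =>
    if k < i then 1
    else if k = i then (xi q t r k).scale (r ^ (-2 * ((m : ℤ) - 1 - i)))
    else (1, scaleLow (r ^ (-(2 * ((m : ℤ) - 1 - k) + 1))) (phiPlus q t r k))).prod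

/-- `Λ_i(z) = ρ(α(z)) Λ̃_i(z) ρ(β(z))`; this product is already normally ordered. -/
def lambda {K : Type*} [Field K] (q t r : K) {m : ℕ} (i : Fin m) : Ordered K m :=
  (rhoAlpha q t r m 1, 1) * lambdaTilde q t r i * (1, rhoBeta q t r m 1)

/-- `Λ_i^*(z) = ρ(α(p⁻¹ z)⁻¹) Λ̃_i^*(p^{(m-2)/2} z) ρ(β(γ⁻² p⁻¹ z)⁻¹)`; this product is already
normally ordered. -/
def lambdaStar {K : Type*} [Field K] (q t r : K) {m : ℕ} (i : Fin m) : Ordered K m :=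
  (scaleSeries (q / t)⁻¹ (rhoAlpha q t r m (-1)), 1) *
    (lambdaTildeStar q t r i).scale (r ^ (2 * ((m : ℤ) - 2))) *
    (1, scaleLow ((levelGamma r m)⁻¹ ^ 2 * (q / t)⁻¹) (rhoBeta q t r m (-1)))

/-- `T_i(z)`: for `i ≠ 1` the sum over `j_1 < ⋯ < j_i` of
`y_{j_1} ⋯ y_{j_i} :Λ_{j_1}(z) Λ_{j_2}(p z) ⋯ Λ_{j_i}(p^{i-1} z):`. -/
def tCurrent {K : Type*} [Field K] (q t r : K) {m : ℕ} (y : Fin m → Kˣ) (i : ℕ) :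
    VertexOperator K (FockT K m) :=
  if i = 1 then tOne q t r y
  else ∑ j : Fin i ↪o Fin m, (∏ a, (y (j a) : K)) •
    (List.ofFn fun a : Fin i => (lambda q t r (j a)).scale ((q / t) ^ (a : ℕ))).prod.field

/-- `T_i^*(z)`: for `i ≠ 1` the sum over `j_1 < ⋯ < j_i` of
`y_{j_1}⁻¹ ⋯ y_{j_i}⁻¹ :Λ_{j_1}^*(z) Λ_{j_2}^*(p⁻¹ z) ⋯ Λ_{j_i}^*(p^{-i+1} z):`. -/
def tCurrentStar {K : Type*} [Field K] (q t r : K) {m : ℕ} (y : Fin m → Kˣ) (i : ℕ) :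
    VertexOperator K (FockT K m) :=
  if i = 1 then tOneStar q t r y
  else ∑ j : Fin i ↪o Fin m, (∏ a, ((y (j a) : K))⁻¹) •
    (List.ofFn fun a : Fin i => (lambdaStar q t r (j a)).scale ((q / t)⁻¹ ^ (a : ℕ))).prod.field

end LevelRep

end

/-! Every current here is a vertex operator, an exponential of creation modes times an exponential
of annihilation modes, and so is determined by its exponents `A k n`, `B k n` (tensor component k,
mode n). Normally ordered multiplication adds exponents (`vop_add`), and rescaling z multiplies the
n-th ones by n-th powers. Identities between normally ordered products are therefore linear
identities between exponents. By Wick's formula (`C_coeff_expSeries_mul_expSeries`, packaged as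
`comp_vop`), an operator product is the normally ordered product times the exponential of a series
in w/z whose coefficients are bilinear in the exponents.

Fix n and put x = p^(n/2). Up to sign and a factor (1 - t^(∓n))/n, the exponents of Λ_i and Λ_i^*
are powers of x and their differences, coming from Λ̃_i and Λ̃_i^*, plus monomial multiples of c =
`wCoeff x m`, coming from α and β (`lambda_eq`, `lambdaStar_eq`). The cancellations rest on c (1 +
x^2 + ... + x^(2m-2)) = -x^(m-1), its image under x ↦ x⁻¹, and telescoping. Summed with the weights
x^(2i), or x^(-2i) on the annihilation side, the exponents of all Λ_i cancel; with index k left out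
they give those of Λ_k^*. The same happens for Λ^* with inverse weights.

For the operator products, the bilinear sum for (i, j) is c x^(m-1) plus 1, 1 - x^(-2) or 0 as i =
j, i < j or i > j, while f_{1,m} contributes 1 + c x^(m-1). The difference is 0, x^(-2) or 1, and
exponentiating it against (1 - q^n)(1 - t^(-n))/n gives 1, γ_+ or γ_-. For Λ^* the last two are
exchanged.

Unrolling the coproduct (`foldr_field`, `foldl_field`) shows that T_1 and T_1^* are the expected
sums of the Λ_i and Λ_i^*. The claims on T_m, T_m^* and T_{m-1} then follow because the only
increasing self-map of m indices is the identity and an increasing choice of m - 1 of them omits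
exactly one.

Algebraic independence enters only through q, t ≠ 0, t^n ≠ 1 and p^n ≠ 1 for n > 0. -/

noncomputable section

namespace LevelRep

/-! ### The Euler operator and exponentials -/

section Euler

variable {A : Type*} [Ring A]

/-- The Euler operator `X d/dX` on power series. -/
def euler (S : PowerSeries A) : PowerSeries A :=
  PowerSeries.mk fun n => (n : A) * PowerSeries.coeff n S

@[simp]
theorem coeff_euler (n : ℕ) (S : PowerSeries A) :
    PowerSeries.coeff n (euler S) = (n : A) * PowerSeries.coeff n S :=
  PowerSeries.coeff_mk _ _

theorem euler_add (S T : PowerSeries A) : euler (S + T) = euler S + euler T := by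
  ext n; simp [mul_add]

theorem euler_sub (S T : PowerSeries A) : euler (S - T) = euler S - euler T := by
  ext n; simp [mul_sub]

theorem euler_mul (S T : PowerSeries A) : euler (S * T) = euler S * T + S * euler T := by
  ext n
  simp only [coeff_euler, map_add, PowerSeries.coeff_mul, Finset.mul_sum]
  rw [← Finset.sum_add_distrib]
  refine Finset.sum_congr rfl fun ij hij => ?_
  rw [Finset.HasAntidiagonal.mem_antidiagonal] at hij
  rw [← hij, Nat.cast_add, add_mul, mul_assoc, ← mul_assoc (PowerSeries.coeff ij.1 S) (ij.2 : A),
    (Nat.cast_commute ij.2 (PowerSeries.coeff ij.1 S)).symm.eq, mul_assoc]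

theorem euler_one : euler (1 : PowerSeries A) = 0 := by
  ext n
  rw [coeff_euler, PowerSeries.coeff_one]
  split_ifs with h <;> simp [h]

theorem euler_C (a : A) : euler (PowerSeries.C a) = 0 := by
  ext n
  rw [coeff_euler, PowerSeries.coeff_C]
  split_ifs with h <;> simp [h]

/-- The coefficients need not commute, so the terms of the Leibniz rule can be collected only
because S commutes with its own derivative. -/
theorem euler_pow {S : PowerSeries A} (hS : Commute S (euler S)) (k : ℕ) :
    euler (S ^ (k + 1)) = ((k + 1 : ℕ) : PowerSeries A) * (euler S * S ^ k) := by
  induction k with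
  | zero => simp
  | succ k ih =>
    rw [pow_succ, euler_mul, ih, mul_assoc, mul_assoc, ← pow_succ, (hS.pow_left _).eq,
      Nat.cast_succ (k + 1), add_mul, one_mul]

theorem commute_of_coeff {S T : PowerSeries A}
    (h : ∀ i j, Commute (PowerSeries.coeff i S) (PowerSeries.coeff j T)) : Commute S T := by
  ext n
  rw [PowerSeries.coeff_mul, PowerSeries.coeff_mul, ← Finset.Nat.sum_antidiagonal_swap]
  exact Finset.sum_congr rfl fun ij _ => h _ _

theorem coeff_posSeries (f : ℕ → A) (n : ℕ) :
    PowerSeries.coeff n (posSeries f) = if n = 0 then 0 else f n :=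
  PowerSeries.coeff_mk _ _

theorem posSeries_add (f g : ℕ → A) : posSeries (f + g) = posSeries f + posSeries g := by
  ext n
  simp only [coeff_posSeries, map_add, Pi.add_apply]
  split_ifs <;> simp

theorem posSeries_congr {f g : ℕ → A} (h : ∀ n, n ≠ 0 → f n = g n) :
    posSeries f = posSeries g := by
  ext n
  simp only [coeff_posSeries]
  split_ifs with hn
  · rfl
  · exact h n hn

theorem posSeries_zero : posSeries (0 : ℕ → A) = 0 := by
  ext n
  simp [coeff_posSeries]

theorem constantCoeff_posSeries (f : ℕ → A) : PowerSeries.constantCoeff (posSeries f) = 0 := by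
  rw [← PowerSeries.coeff_zero_eq_constantCoeff_apply, coeff_posSeries, if_pos rfl]

theorem coeff_pow_eq_zero {S : PowerSeries A} (hS : PowerSeries.constantCoeff S = 0) {k N : ℕ}
    (h : N < k) : PowerSeries.coeff N (S ^ k) = 0 := by
  induction k generalizing N with
  | zero => omega
  | succ k ih =>
    rw [pow_succ, PowerSeries.coeff_mul]
    refine Finset.sum_eq_zero fun ij hij => ?_
    rw [Finset.HasAntidiagonal.mem_antidiagonal] at hij
    by_cases h2 : ij.2 = 0
    · rw [h2, PowerSeries.coeff_zero_eq_constantCoeff_apply, hS, mul_zero]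
    · rw [ih (by omega), zero_mul]

/-! ### Exponentials, rescaling, and the Euler equation -/

variable {K : Type*} [Field K] [Algebra K A]

theorem coeff_smul_field (c : K) (n : ℕ) (S : PowerSeries A) :
    PowerSeries.coeff n (c • S) = c • PowerSeries.coeff n S := rfl

theorem euler_smul (c : K) (S : PowerSeries A) : euler (c • S) = c • euler S := by
  ext n; simp

theorem coeff_expSeries (S : PowerSeries A) (N : ℕ) :
    PowerSeries.coeff N (expSeries K S) =
      ∑ k ∈ Finset.range (N + 1), ((k.factorial : K)⁻¹) • PowerSeries.coeff N (S ^ k) :=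
  PowerSeries.coeff_mk _ _

/-- S ^ k starts in degree k, so the truncation in `expSeries` may be lengthened; different
coefficients can then be computed over a common range. -/
theorem coeff_expSeries_of_lt {S : PowerSeries A} (hS : PowerSeries.constantCoeff S = 0)
    {N M : ℕ} (h : N < M) :
    PowerSeries.coeff N (expSeries K S) =
      ∑ k ∈ Finset.range M, ((k.factorial : K)⁻¹) • PowerSeries.coeff N (S ^ k) := by
  rw [coeff_expSeries]
  refine Finset.sum_subset (Finset.range_mono h) fun k _ hk => ?_
  rw [coeff_pow_eq_zero hS (by simpa using hk), smul_zero]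

theorem constantCoeff_expSeries (S : PowerSeries A) :
    PowerSeries.constantCoeff (expSeries K S) = 1 := by
  rw [← PowerSeries.coeff_zero_eq_constantCoeff_apply, coeff_expSeries]
  simp

theorem expSeries_zero : expSeries K (0 : PowerSeries A) = 1 := by
  ext N
  rw [coeff_expSeries, Finset.sum_eq_single 0]
  · simp
  · intro k _ hk; simp [hk]
  · simp

theorem scaleSeries_mul (ζ : K) (S T : PowerSeries A) :
    scaleSeries ζ (S * T) = scaleSeries ζ S * scaleSeries ζ T := by
  ext n
  simp only [scaleSeries, PowerSeries.coeff_mk, PowerSeries.coeff_mul, Finset.smul_sum]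
  refine Finset.sum_congr rfl fun ij hij => ?_
  rw [Finset.HasAntidiagonal.mem_antidiagonal] at hij
  rw [smul_mul_smul_comm, ← pow_add, hij]

theorem scaleSeries_one (ζ : K) : scaleSeries ζ (1 : PowerSeries A) = 1 := by
  ext n
  simp only [scaleSeries, PowerSeries.coeff_mk, PowerSeries.coeff_one]
  split_ifs with h <;> simp [h]

theorem scaleSeries_scaleSeries (a b : K) (S : PowerSeries A) :
    scaleSeries a (scaleSeries b S) = scaleSeries (a * b) S := by
  ext n
  simp only [scaleSeries, PowerSeries.coeff_mk, smul_smul, mul_pow]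

theorem one_scaleSeries (S : PowerSeries A) : scaleSeries (1 : K) S = S := by
  ext n
  simp only [scaleSeries, PowerSeries.coeff_mk, one_pow, one_smul]

theorem scaleSeries_expSeries (ζ : K) (S : PowerSeries A) :
    scaleSeries ζ (expSeries K S) = expSeries K (scaleSeries ζ S) := by
  have hpow : ∀ k, scaleSeries ζ (S ^ k) = scaleSeries ζ S ^ k := by
    intro k
    induction k with
    | zero => simpa using scaleSeries_one ζ
    | succ k ih => rw [pow_succ, scaleSeries_mul, ih, pow_succ]
  ext N
  rw [coeff_expSeries, scaleSeries, PowerSeries.coeff_mk, coeff_expSeries, Finset.smul_sum]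
  refine Finset.sum_congr rfl fun k _ => ?_
  rw [← hpow, scaleSeries, PowerSeries.coeff_mk, smul_comm]

theorem commute_coeff_expSeries {a : A} {S : PowerSeries A}
    (h : ∀ j, Commute a (PowerSeries.coeff j S)) (N : ℕ) :
    Commute a (PowerSeries.coeff N (expSeries K S)) := by
  have hpow : ∀ k j, Commute a (PowerSeries.coeff j (S ^ k)) := by
    intro k
    induction k with
    | zero =>
      intro j
      rw [pow_zero, PowerSeries.coeff_one]
      split_ifs <;> simp
    | succ k ih =>
      intro j
      rw [pow_succ, PowerSeries.coeff_mul]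
      exact Commute.sum_right _ _ _ fun ij _ => (ih _).mul_right (h _)
  rw [coeff_expSeries]
  exact Commute.sum_right _ _ _ fun k _ => (hpow k N).smul_right _

theorem commute_of_coeff_expSeries {S T : PowerSeries A}
    (h : ∀ i j, Commute (PowerSeries.coeff i S) (PowerSeries.coeff j T)) :
    Commute S (expSeries K T) :=
  commute_of_coeff fun i j => commute_coeff_expSeries (h i) j

variable [CharZero K]

/-- With constant term 1, this first-order equation characterises the exponential. It replaces
manipulation of the factorial series in what follows. -/
theorem euler_expSeries {S : PowerSeries A} (h0 : PowerSeries.constantCoeff S = 0)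
    (hS : Commute S (euler S)) : euler (expSeries K S) = euler S * expSeries K S := by
  ext N
  -- The range on the left is one longer than on the right: its term k = 0 is killed by the Euler
  -- operator, and the term k + 1 matches the term k on the right.
  rw [coeff_euler, coeff_expSeries_of_lt h0 (Nat.lt_succ_of_lt N.lt_succ_self),
    PowerSeries.coeff_mul]
  have h1 : ∀ ij ∈ Finset.HasAntidiagonal.antidiagonal N,
      PowerSeries.coeff ij.1 (euler S) * PowerSeries.coeff ij.2 (expSeries K S) =
        ∑ k ∈ Finset.range (N + 1), ((k.factorial : K)⁻¹) •
          (PowerSeries.coeff ij.1 (euler S) * PowerSeries.coeff ij.2 (S ^ k)) := by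
    intro ij hij
    rw [Finset.HasAntidiagonal.mem_antidiagonal] at hij
    rw [coeff_expSeries_of_lt (M := N + 1) h0 (by omega), Finset.mul_sum]
    simp only [mul_smul_comm]
  rw [Finset.sum_congr rfl h1, Finset.sum_comm, Finset.sum_range_succ', mul_add]
  simp only [← Finset.smul_sum, ← PowerSeries.coeff_mul]
  rw [pow_zero, show ((N : A) * ((Nat.factorial 0 : K)⁻¹ • PowerSeries.coeff N (1 : PowerSeries A)))
    = 0 by rw [PowerSeries.coeff_one]; split_ifs with h <;> simp [h], add_zero, Finset.mul_sum]
  refine Finset.sum_congr rfl fun k _ => ?_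
  rw [mul_smul_comm, ← coeff_euler, euler_pow hS]
  have h2 : ((k + 1 : ℕ) : PowerSeries A) * (euler S * S ^ k) =
      ((k + 1 : ℕ) : K) • (euler S * S ^ k) := by
    rw [← nsmul_eq_mul, Nat.cast_smul_eq_nsmul]
  rw [h2, coeff_smul_field, smul_smul]
  congr 1
  have h3 : ((k + 1 : ℕ) : K) ≠ 0 := Nat.cast_ne_zero.mpr k.succ_ne_zero
  have h4 : ((k.factorial : ℕ) : K) ≠ 0 := Nat.cast_ne_zero.mpr k.factorial_ne_zero
  rw [Nat.factorial_succ]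
  push_cast at h3 ⊢
  field_simp

/-- Uniqueness for the Euler equation. Since `euler S` has no constant term, degree N expresses N
times the coefficient of P through lower coefficients of P, and characteristic zero allows division
by N. -/
theorem eq_zero_of_euler_eq (K : Type*) [Field K] [Algebra K A] [CharZero K]
    {S P : PowerSeries A} (hP : PowerSeries.constantCoeff P = 0) (h : euler P = euler S * P) : P = 0 := by
  ext N
  rw [map_zero]
  induction N using Nat.strong_induction_on with
  | _ N ih =>
    rcases Nat.eq_zero_or_pos N with rfl | hN
    · rw [PowerSeries.coeff_zero_eq_constantCoeff_apply, hP]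
    · have h1 := congrArg (PowerSeries.coeff N) h
      rw [coeff_euler, PowerSeries.coeff_mul, Finset.sum_eq_zero] at h1
      · rw [← nsmul_eq_mul, ← Nat.cast_smul_eq_nsmul K] at h1
        exact (smul_eq_zero_iff_right (Nat.cast_ne_zero.mpr hN.ne')).mp h1
      · intro ij hij
        rw [Finset.HasAntidiagonal.mem_antidiagonal] at hij
        by_cases h2 : ij.1 = 0
        · rw [h2, coeff_euler]; simp
        · rw [ih ij.2 (by omega), mul_zero]

theorem commute_euler {S T : PowerSeries A}
    (h : ∀ i j, Commute (PowerSeries.coeff i S) (PowerSeries.coeff j T)) :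
    Commute S (euler T) :=
  commute_of_coeff fun i j => by
    rw [coeff_euler]; exact (Nat.cast_commute j _).symm.mul_right (h i j)

/-- Both sides have constant term 1 and solve the Euler equation with exponent S + T. -/
theorem expSeries_add {S T : PowerSeries A} (hS : PowerSeries.constantCoeff S = 0)
    (hT : PowerSeries.constantCoeff T = 0)
    (hSS : ∀ i j, Commute (PowerSeries.coeff i S) (PowerSeries.coeff j S))
    (hTT : ∀ i j, Commute (PowerSeries.coeff i T) (PowerSeries.coeff j T))
    (hST : ∀ i j, Commute (PowerSeries.coeff i S) (PowerSeries.coeff j T)) :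
    expSeries K (S + T) = expSeries K S * expSeries K T := by
  have hadd : ∀ i j, Commute (PowerSeries.coeff i (S + T)) (PowerSeries.coeff j (S + T)) := by
    intro i j
    simp only [map_add]
    exact ((hSS i j).add_right (hST i j)).add_left ((hST j i).symm.add_right (hTT i j))
  have hE : Commute (euler T) (expSeries K S) := by
    refine commute_of_coeff_expSeries fun i j => ?_
    rw [coeff_euler]
    exact (Nat.cast_commute i _).mul_left (hST j i).symm
  rw [← sub_eq_zero]
  refine eq_zero_of_euler_eq K (S := S + T) ?_ ?_
  · rw [map_sub, map_mul]
    simp only [constantCoeff_expSeries, mul_one, sub_self]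
  · rw [euler_sub, euler_expSeries (by rw [map_add, hS, hT, add_zero]) (commute_euler hadd),
      euler_mul, euler_expSeries hS (commute_euler hSS), euler_expSeries hT (commute_euler hTT),
      euler_add, mul_sub, ← mul_assoc (expSeries K S), ← hE.eq]
    noncomm_ring

/-- If `b S = S b + c X ^ n` with `c` a scalar, then `b exp S = exp S b + c X ^ n exp S`. -/
theorem C_mul_expSeries {S : PowerSeries A} (hS : PowerSeries.constantCoeff S = 0)
    (hSS : ∀ i j, Commute (PowerSeries.coeff i S) (PowerSeries.coeff j S)) {n : ℕ} (hn : n ≠ 0)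
    (b : A) (c : K) (h : PowerSeries.C b * S = S * PowerSeries.C b + c • PowerSeries.X ^ n) :
    PowerSeries.C b * expSeries K S =
      expSeries K S * PowerSeries.C b + c • (PowerSeries.X ^ n * expSeries K S) := by
  rw [← sub_eq_zero]
  have hX : euler ((PowerSeries.X : PowerSeries A) ^ n) = (n : K) • PowerSeries.X ^ n := by
    ext k
    rw [coeff_euler, coeff_smul_field, PowerSeries.coeff_X_pow]
    split_ifs with hk <;> simp [hk, Algebra.smul_def]
  have h1 := congrArg euler h
  rw [euler_mul, euler_add, euler_mul, euler_C, euler_smul, hX, zero_mul, zero_add, mul_zero,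
    add_zero] at h1
  have hXc : ∀ T : PowerSeries A, PowerSeries.X ^ n * T = T * PowerSeries.X ^ n :=
    fun T => ((PowerSeries.commute_X T).symm.pow_left n).eq
  -- Differentiating the hypothesis shows that moving b past `euler S` costs n c X ^ n, which
  -- cancels the derivative of the factor X ^ n; the difference of the two sides thus solves the
  -- Euler equation of S.
  refine eq_zero_of_euler_eq K (S := S) ?_ ?_
  · simp [constantCoeff_expSeries, hn]
  · rw [euler_sub, euler_add, euler_mul, euler_mul, euler_smul, euler_mul, euler_C,
      euler_expSeries hS (commute_euler hSS), hX, zero_mul, mul_zero, add_zero, zero_add,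
      ← mul_assoc, h1, ← mul_assoc (PowerSeries.X ^ n), hXc (euler S)]
    simp only [mul_sub, mul_add, add_mul, smul_mul_assoc, mul_smul_comm, smul_add, mul_assoc]
    abel

theorem euler_map {B : Type*} [Ring B] (φ : A →+* B) (S : PowerSeries A) :
    euler (PowerSeries.map φ S) = PowerSeries.map φ (euler S) := by
  ext n; simp

/-- Wick's formula: if the coefficients of `T` and `S` commute up to the scalars `c n`, then
`exp T(y) exp S(w) = exp (∑ c n w ^ n y ^ n) exp S(w) exp T(y)`. -/
theorem C_coeff_expSeries_mul_expSeries {S T : PowerSeries A} (hS : PowerSeries.constantCoeff S = 0)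
    (hT : PowerSeries.constantCoeff T = 0)
    (hSS : ∀ i j, Commute (PowerSeries.coeff i S) (PowerSeries.coeff j S))
    (hTT : ∀ i j, Commute (PowerSeries.coeff i T) (PowerSeries.coeff j T)) (c : ℕ → K)
    (hTS : ∀ n, n ≠ 0 → PowerSeries.C (PowerSeries.coeff n T) * S =
      S * PowerSeries.C (PowerSeries.coeff n T) + c n • PowerSeries.X ^ n) (l : ℕ) :
    PowerSeries.C (PowerSeries.coeff l (expSeries K T)) * expSeries K S =
      ∑ a ∈ Finset.HasAntidiagonal.antidiagonal l,
        PowerSeries.coeff a.1 (expSeries K (posSeries c)) • (PowerSeries.X ^ a.1 * (expSeries K S *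
          PowerSeries.C (PowerSeries.coeff a.2 (expSeries K T)))) := by
  set E := expSeries K S with hE
  set g := expSeries K (posSeries c) with hg
  -- The outer variable y carries the degree in T, the inner variable w the degree in S. `D'` is exp
  -- T(y), `C'` is exp S(w), `G` is the scalar factor in yw, and `τ`, `Γ` are the logarithmic
  -- derivatives in y of `D'` and `G`.
  let D' : PowerSeries (PowerSeries A) := PowerSeries.map PowerSeries.C (expSeries K T)
  let τ : PowerSeries (PowerSeries A) := PowerSeries.map PowerSeries.C (euler T)
  let C' : PowerSeries (PowerSeries A) := PowerSeries.C E
  let G : PowerSeries (PowerSeries A) :=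
    PowerSeries.mk fun s => PowerSeries.coeff s g • PowerSeries.X ^ s
  let Γ : PowerSeries (PowerSeries A) :=
    PowerSeries.mk fun s => PowerSeries.coeff s (euler (posSeries c)) • PowerSeries.X ^ s
  have hD : euler D' = τ * D' := by
    rw [euler_map, euler_expSeries hT (commute_euler hTT), map_mul]
  have hG : euler G = Γ * G := by
    have h1 := euler_expSeries (K := K) (constantCoeff_posSeries c)
      (commute_of_coeff fun i j => Commute.all _ _)
    ext1 n
    rw [coeff_euler, PowerSeries.coeff_mul, PowerSeries.coeff_mk, ← nsmul_eq_mul, ← smul_assoc,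
      nsmul_eq_mul, ← coeff_euler, hg, h1, PowerSeries.coeff_mul, Finset.sum_smul]
    refine Finset.sum_congr rfl fun a ha => ?_
    rw [Finset.HasAntidiagonal.mem_antidiagonal] at ha
    rw [PowerSeries.coeff_mk, PowerSeries.coeff_mk, smul_mul_smul_comm, ← pow_add, ha]
  -- Moving τ past exp S(w) produces exactly the logarithmic derivative of the scalar factor; this
  -- is where the commutation relation enters.
  have hC : τ * C' = C' * τ + Γ * C' := by
    ext1 n
    rw [map_add, PowerSeries.coeff_mul_C, PowerSeries.coeff_C_mul, PowerSeries.coeff_mul_C,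
      PowerSeries.coeff_map, coeff_euler, PowerSeries.coeff_mk, coeff_euler, coeff_posSeries]
    split_ifs with hn
    · simp [hn]
    · have h1 := C_mul_expSeries hS hSS hn _ _ (hTS n hn)
      rw [map_mul, map_natCast, mul_assoc, h1, mul_add, mul_smul, Nat.cast_smul_eq_nsmul,
        nsmul_eq_mul, ← mul_assoc, (Nat.cast_commute n E).eq, mul_assoc]
      simp only [smul_mul_assoc, mul_assoc]
      rfl
  have hGτ : Commute τ G := commute_of_coeff fun i j => by
    rw [PowerSeries.coeff_mk]
    exact ((PowerSeries.commute_X _).pow_right j).smul_right _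
  have hGΓ : Commute Γ G := commute_of_coeff fun i j => by
    rw [PowerSeries.coeff_mk, PowerSeries.coeff_mk]
    exact (((Commute.refl _).pow_pow i j).smul_right _).smul_left _
  -- Both products solve the same Euler equation in y, with exponent T, and agree at y = 0.
  have key : D' * C' - G * (C' * D') = 0 := by
    refine eq_zero_of_euler_eq K (S := PowerSeries.map PowerSeries.C T) ?_ ?_
    · have h1 : PowerSeries.coeff 0 (expSeries K T) = 1 := by
        rw [PowerSeries.coeff_zero_eq_constantCoeff_apply, constantCoeff_expSeries]
      have h2 : PowerSeries.coeff 0 g = 1 := by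
        rw [PowerSeries.coeff_zero_eq_constantCoeff_apply, constantCoeff_expSeries]
      rw [map_sub, map_mul, map_mul, map_mul, sub_eq_zero]
      simp only [← PowerSeries.coeff_zero_eq_constantCoeff_apply]
      simp only [D', C', G, PowerSeries.coeff_map, h1, PowerSeries.coeff_mk, h2,
        PowerSeries.coeff_zero_C]
      simp
    · have hC0 : euler C' = 0 := euler_C _
      rw [euler_sub, euler_mul, euler_mul, euler_mul, hD, hG, hC0, euler_map, mul_zero, add_zero,
        zero_mul, zero_add]
      change _ = τ * _
      rw [mul_sub, ← mul_assoc τ G, hGτ.eq, mul_assoc G τ, ← mul_assoc τ C', hC, add_mul, mul_add,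
        hGΓ.eq]
      simp only [mul_assoc]
      abel
  have h1 := congrArg (PowerSeries.coeff l) (sub_eq_zero.mp key)
  rw [PowerSeries.coeff_mul_C, PowerSeries.coeff_map, PowerSeries.coeff_mul] at h1
  rw [h1]
  refine Finset.sum_congr rfl fun a _ => ?_
  rw [PowerSeries.coeff_mk, PowerSeries.coeff_C_mul, PowerSeries.coeff_map, smul_mul_assoc]

end Euler

/-! ### Heisenberg relations on the tensor power -/

section Heisenberg

variable {K : Type*} [Field K] {m : ℕ}

theorem slot_mul (k : Fin m) (A B : Module.End K (Fock K)) :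
    slot k (A * B) = slot k A * slot k B := by
  rw [slot, slot, slot, ← PiTensorProduct.map_mul]
  congr 1
  funext j
  by_cases h : j = k
  · subst h; simp
  · simp only [Function.update_of_ne h]; rfl

theorem slot_commute {k l : Fin m} (h : k ≠ l) (A B : Module.End K (Fock K)) :
    Commute (slot k A) (slot l B) := by
  rw [Commute, SemiconjBy, slot, slot, ← PiTensorProduct.map_mul, ← PiTensorProduct.map_mul]
  congr 1
  funext j
  by_cases hk : j = k
  · subst hk; simp only [Function.update_self, Function.update_of_ne h]; rfl
  · simp only [Function.update_of_ne hk]; rfl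

theorem slot_one (k : Fin m) : slot k (1 : Module.End K (Fock K)) = 1 := by
  rw [slot, ← PiTensorProduct.map_one]
  congr 1
  funext j
  by_cases h : j = k
  · subst h; simp
  · simp only [Function.update_of_ne h]; rfl

theorem slot_add (k : Fin m) (A B : Module.End K (Fock K)) :
    slot k (A + B) = slot k A + slot k B :=
  PiTensorProduct.map_update_add _ _ _ _

theorem slot_smul (k : Fin m) (c : K) (A : Module.End K (Fock K)) :
    slot k (c • A) = c • slot k A :=
  PiTensorProduct.map_update_smul _ _ _ _

theorem heis_neg (q t : K) {n : ℕ} (hn : n ≠ 0) :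
    heis q t (-(n : ℤ)) =
      LinearMap.mulLeft K (MvPolynomial.X (n.toPNat (Nat.pos_of_ne_zero hn))) := by
  obtain ⟨n, rfl⟩ := Nat.exists_eq_succ_of_ne_zero hn
  rfl

theorem heis_pos (q t : K) {n : ℕ} (hn : n ≠ 0) :
    heis q t (n : ℤ) = ((n : K) * (1 - q ^ n) / (1 - t ^ n)) •
      (MvPolynomial.pderiv (R := K) (n.toPNat (Nat.pos_of_ne_zero hn))).toLinearMap := by
  obtain ⟨n, rfl⟩ := Nat.exists_eq_succ_of_ne_zero hn
  rfl

/-- The commutator of two derivations is a derivation, and this one kills every variable. -/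
theorem pderiv_commute (a b : ℕ+) :
    Commute ((MvPolynomial.pderiv (R := K) a).toLinearMap : Module.End K (Fock K))
      (MvPolynomial.pderiv (R := K) b).toLinearMap := by
  have h : ⁅MvPolynomial.pderiv (R := K) a, MvPolynomial.pderiv (R := K) b⁆ = 0 := by
    refine MvPolynomial.derivation_ext fun i => ?_
    rw [Derivation.commutator_apply, MvPolynomial.pderiv_X, MvPolynomial.pderiv_X]
    simp [Pi.single_apply, apply_ite]
  refine LinearMap.ext fun x => ?_
  have h1 := congrArg (fun D => D x) h
  simpa [Derivation.commutator_apply, sub_eq_zero] using h1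

theorem heis_neg_commute (q t : K) {a b : ℕ} (ha : a ≠ 0) (hb : b ≠ 0) :
    Commute (heis q t (-(a : ℤ))) (heis q t (-(b : ℤ))) := by
  rw [heis_neg q t ha, heis_neg q t hb]
  exact LinearMap.ext fun x => mul_left_comm _ _ _

theorem heis_pos_commute (q t : K) {a b : ℕ} (ha : a ≠ 0) (hb : b ≠ 0) :
    Commute (heis q t (a : ℤ)) (heis q t (b : ℤ)) := by
  rw [heis_pos q t ha, heis_pos q t hb]
  exact ((pderiv_commute _ _).smul_right _).smul_left _

theorem heis_pos_mul_neg (q t : K) {a b : ℕ} (ha : a ≠ 0) (hb : b ≠ 0) :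
    heis q t (a : ℤ) * heis q t (-(b : ℤ)) = heis q t (-(b : ℤ)) * heis q t (a : ℤ) +
      (if a = b then (a : K) * (1 - q ^ a) / (1 - t ^ a) else 0) • 1 := by
  rw [heis_pos q t ha, heis_neg q t hb]
  refine LinearMap.ext fun x => ?_
  change ((a : K) * (1 - q ^ a) / (1 - t ^ a)) • MvPolynomial.pderiv _ (MvPolynomial.X _ * x) =
    MvPolynomial.X _ * (((a : K) * (1 - q ^ a) / (1 - t ^ a)) • MvPolynomial.pderiv _ x) +
      (if a = b then (a : K) * (1 - q ^ a) / (1 - t ^ a) else 0) • x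
  rw [Derivation.leibniz, MvPolynomial.pderiv_X, smul_eq_mul, smul_eq_mul, smul_add,
    mul_smul_comm, Pi.single_apply]
  have : (b.toPNat (Nat.pos_of_ne_zero hb) = a.toPNat (Nat.pos_of_ne_zero ha)) ↔ a = b := by
    rw [← PNat.coe_inj]; exact eq_comm
  simp only [this]
  split_ifs with h
  · simp
  · simp

theorem heisAt_neg_commute (q t : K) (k l : Fin m) {a b : ℕ} (ha : a ≠ 0) (hb : b ≠ 0) :
    Commute (heisAt q t k (-(a : ℤ))) (heisAt q t l (-(b : ℤ))) := by
  by_cases h : k = l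
  · subst h
    rw [Commute, SemiconjBy, heisAt, heisAt, ← slot_mul, ← slot_mul, (heis_neg_commute q t ha hb).eq]
  · exact slot_commute h _ _

theorem heisAt_pos_commute (q t : K) (k l : Fin m) {a b : ℕ} (ha : a ≠ 0) (hb : b ≠ 0) :
    Commute (heisAt q t k (a : ℤ)) (heisAt q t l (b : ℤ)) := by
  by_cases h : k = l
  · subst h
    rw [Commute, SemiconjBy, heisAt, heisAt, ← slot_mul, ← slot_mul, (heis_pos_commute q t ha hb).eq]
  · exact slot_commute h _ _

theorem heisAt_pos_mul_neg (q t : K) (k l : Fin m) {a b : ℕ} (ha : a ≠ 0) (hb : b ≠ 0) :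
    heisAt q t k (a : ℤ) * heisAt q t l (-(b : ℤ)) =
      heisAt q t l (-(b : ℤ)) * heisAt q t k (a : ℤ) +
      (if k = l then if a = b then (a : K) * (1 - q ^ a) / (1 - t ^ a) else 0 else 0) • 1 := by
  by_cases h : k = l
  · subst h
    rw [if_pos rfl, heisAt, heisAt, ← slot_mul, ← slot_mul, heis_pos_mul_neg q t ha hb, slot_add,
      slot_smul, slot_one]
  · rw [if_neg h, zero_smul, add_zero]
    exact slot_commute h _ _

end Heisenberg

/-! ### Exponentials of linear combinations of Heisenberg generators -/

section Exponentials

variable {K : Type*} [Field K] {m : ℕ}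

theorem coeff_posSeries_op (f : ℕ → Op K m) (n : ℕ) :
    PowerSeries.coeff n (posSeries f) = if n = 0 then 0 else f n :=
  coeff_posSeries f n

theorem coeff_smul_op (c : K) (n : ℕ) (S : PowerSeries (Op K m)) :
    PowerSeries.coeff n (c • S) = c • PowerSeries.coeff n S := rfl

/-- The exponent `∑_{n > 0} ∑_k A_{k,n} a_{-n,(k)} z ^ n`. -/
def creExponent (q t : K) (A : Fin m → ℕ → K) : PowerSeries (Op K m) :=
  posSeries fun n => ∑ k, A k n • heisAt q t k (-(n : ℤ))

/-- The exponent `∑_{n > 0} ∑_k B_{k,n} a_{n,(k)} z ^ {-n}`. -/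
def annExponent (q t : K) (B : Fin m → ℕ → K) : PowerSeries (Op K m) :=
  posSeries fun n => ∑ k, B k n • heisAt q t k (n : ℤ)

theorem coeff_creExponent (q t : K) (A : Fin m → ℕ → K) (n : ℕ) :
    PowerSeries.coeff n (creExponent q t A) =
      if n = 0 then 0 else ∑ k, A k n • heisAt q t k (-(n : ℤ)) :=
  coeff_posSeries_op _ n

theorem coeff_annExponent (q t : K) (B : Fin m → ℕ → K) (n : ℕ) :
    PowerSeries.coeff n (annExponent q t B) =
      if n = 0 then 0 else ∑ k, B k n • heisAt q t k (n : ℤ) :=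
  coeff_posSeries_op _ n

theorem annExponent_mem (q t : K) (B : Fin m → ℕ → K) : annExponent q t B ∈ lowering K m :=
  posSeries_mem q t _ fun _ _ => Submodule.sum_mem _ fun k _ =>
    Submodule.smul_mem _ _ (Submodule.subset_span ⟨k, rfl⟩)

/-- The series `exp (∑_{n > 0} ∑_k A_{k,n} a_{-n,(k)} z ^ n)`. -/
def cre (q t : K) (A : Fin m → ℕ → K) : PowerSeries (Op K m) :=
  expSeries K (creExponent q t A)

/-- The series `exp (∑_{n > 0} ∑_k B_{k,n} a_{n,(k)} z ^ {-n})`. -/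
def ann (q t : K) (B : Fin m → ℕ → K) : lowering K m :=
  ⟨expSeries K (annExponent q t B), expSeries_mem (annExponent_mem q t B)⟩

/-- The vertex operator with creation exponents `A` and annihilation exponents `B`. -/
def vop (q t : K) (A B : Fin m → ℕ → K) : Ordered K m := (cre q t A, ann q t B)

theorem creExponent_commute (q t : K) (A A' : Fin m → ℕ → K) (i j : ℕ) :
    Commute (PowerSeries.coeff i (creExponent q t A))
      (PowerSeries.coeff j (creExponent q t A')) := by
  rw [coeff_creExponent, coeff_creExponent]
  split_ifs with hi hj hj
  · exact Commute.zero_left _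
  · exact Commute.zero_left _
  · exact Commute.zero_right _
  · exact Commute.sum_left _ _ _ fun k _ => Commute.sum_right _ _ _ fun l _ =>
      ((heisAt_neg_commute q t k l hi hj).smul_right _).smul_left _

theorem annExponent_commute (q t : K) (B B' : Fin m → ℕ → K) (i j : ℕ) :
    Commute (PowerSeries.coeff i (annExponent q t B))
      (PowerSeries.coeff j (annExponent q t B')) := by
  rw [coeff_annExponent, coeff_annExponent]
  split_ifs with hi hj hj
  · exact Commute.zero_left _
  · exact Commute.zero_left _
  · exact Commute.zero_right _
  · exact Commute.sum_left _ _ _ fun k _ => Commute.sum_right _ _ _ fun l _ =>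
      ((heisAt_pos_commute q t k l hi hj).smul_right _).smul_left _

theorem creExponent_add (q t : K) (A A' : Fin m → ℕ → K) :
    creExponent q t (A + A') = creExponent q t A + creExponent q t A' := by
  rw [creExponent, creExponent, creExponent, ← posSeries_add]
  refine posSeries_congr fun n _ => ?_
  simp only [Pi.add_apply, add_smul, Finset.sum_add_distrib]

theorem annExponent_add (q t : K) (A A' : Fin m → ℕ → K) :
    annExponent q t (A + A') = annExponent q t A + annExponent q t A' := by
  rw [annExponent, annExponent, annExponent, ← posSeries_add]
  refine posSeries_congr fun n _ => ?_
  simp only [Pi.add_apply, add_smul, Finset.sum_add_distrib]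

/-- `posSeries` discards index 0, so exponents containing a division by n need comparing only where
n is nonzero. -/
theorem cre_congr (q t : K) {A A' : Fin m → ℕ → K} (h : ∀ n, n ≠ 0 → ∀ k, A k n = A' k n) :
    cre q t A = cre q t A' := by
  rw [cre, cre, creExponent, creExponent, posSeries_congr fun n hn => ?_]
  simp only [h n hn]

theorem ann_congr (q t : K) {B B' : Fin m → ℕ → K} (h : ∀ n, n ≠ 0 → ∀ k, B k n = B' k n) :
    ann q t B = ann q t B' := by
  refine Subtype.ext ?_
  change expSeries K (posSeries _) = expSeries K (posSeries _)
  rw [posSeries_congr fun n hn => ?_]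
  simp only [h n hn]

theorem vop_congr (q t : K) {A A' B B' : Fin m → ℕ → K} (hA : ∀ n, n ≠ 0 → ∀ k, A k n = A' k n)
    (hB : ∀ n, n ≠ 0 → ∀ k, B k n = B' k n) : vop q t A B = vop q t A' B' := by
  rw [vop, vop, cre_congr q t hA, ann_congr q t hB]

theorem scale_cre (q t ζ : K) (A : Fin m → ℕ → K) :
    scaleSeries ζ (cre q t A) = cre q t fun k n => ζ ^ n * A k n := by
  rw [cre, scaleSeries_expSeries, cre]
  congr 1
  ext1 n
  rw [scaleSeries, PowerSeries.coeff_mk, coeff_creExponent, coeff_creExponent]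
  split_ifs
  · simp
  · simp only [Finset.smul_sum, smul_smul]

theorem scale_ann (q t ζ : K) (B : Fin m → ℕ → K) :
    scaleLow ζ (ann q t B) = ann q t fun k n => ζ⁻¹ ^ n * B k n := by
  refine Subtype.ext ?_
  rw [scaleLow, ann, ann]
  change scaleSeries _ (expSeries K _) = expSeries K _
  rw [scaleSeries_expSeries]
  congr 1
  ext1 n
  rw [scaleSeries, PowerSeries.coeff_mk, coeff_annExponent, coeff_annExponent]
  split_ifs
  · simp
  · simp only [Finset.smul_sum, smul_smul]

theorem scale_vop (q t ζ : K) (A B : Fin m → ℕ → K) :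
    (vop q t A B).scale ζ = vop q t (fun k n => ζ ^ n * A k n) fun k n => ζ⁻¹ ^ n * B k n := by
  rw [vop, Ordered.scale, scale_cre, scale_ann, vop]

theorem cre_zero (q t : K) : cre q t (0 : Fin m → ℕ → K) = 1 := by
  have h : creExponent q t (0 : Fin m → ℕ → K) = 0 :=
    (congrArg posSeries (funext fun n => by simp)).trans posSeries_zero
  rw [cre, h]
  exact expSeries_zero

theorem ann_zero (q t : K) : ann q t (0 : Fin m → ℕ → K) = 1 := by
  have h : annExponent q t (0 : Fin m → ℕ → K) = 0 :=
    (congrArg posSeries (funext fun n => by simp)).trans posSeries_zero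
  refine Subtype.ext ?_
  change expSeries K _ = 1
  rw [h]
  exact expSeries_zero

theorem vop_zero (q t : K) : vop q t (0 : Fin m → ℕ → K) 0 = 1 := by
  rw [vop, cre_zero, ann_zero]; rfl

theorem sum_single_smul (k : Fin m) (c : K) (f : Fin m → Op K m) :
    ∑ l, (if l = k then c else 0) • f l = c • f k := by
  simp

theorem creation_eq (q t : K) (k : Fin m) (c : ℕ → K) :
    creation q t k c = cre q t fun l n => if l = k then c n else 0 := by
  rw [creation, cre, creExponent]
  simp only [sum_single_smul]

theorem annihilation_eq (q t : K) (k : Fin m) (c : ℕ → K) :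
    annihilation q t k c = ann q t fun l n => if l = k then c n else 0 := by
  refine Subtype.ext ?_
  change expSeries K _ = expSeries K _
  rw [annExponent]
  simp only [sum_single_smul]

variable [CharZero K]

theorem cre_add (q t : K) (A A' : Fin m → ℕ → K) :
    cre q t (A + A') = cre q t A * cre q t A' := by
  rw [cre, creExponent_add]
  exact expSeries_add (constantCoeff_posSeries _) (constantCoeff_posSeries _)
    (creExponent_commute q t _ _) (creExponent_commute q t _ _) (creExponent_commute q t _ _)

theorem ann_add (q t : K) (B B' : Fin m → ℕ → K) :
    ann q t (B + B') = ann q t B * ann q t B' := by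
  refine Subtype.ext ?_
  change expSeries K _ = expSeries K _ * expSeries K _
  rw [annExponent_add]
  exact expSeries_add (constantCoeff_posSeries _) (constantCoeff_posSeries _)
    (annExponent_commute q t _ _) (annExponent_commute q t _ _) (annExponent_commute q t _ _)

theorem vop_add (q t : K) (A A' B B' : Fin m → ℕ → K) :
    vop q t (A + A') (B + B') = vop q t A B * vop q t A' B' := by
  rw [vop, cre_add, ann_add]; rfl

theorem prod_ofFn_vop (q t : K) {n : ℕ} (A B : Fin n → Fin m → ℕ → K) :
    (List.ofFn fun i => vop q t (A i) (B i)).prod = vop q t (∑ i, A i) (∑ i, B i) := by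
  induction n with
  | zero => simp [vop_zero]
  | succ n ih =>
    rw [List.ofFn_succ, List.prod_cons, ih, ← vop_add, Fin.sum_univ_succ, Fin.sum_univ_succ]

/-- The operator product of annihilation and creation exponentials. -/
theorem ann_mul_cre (q t : K) (A B : Fin m → ℕ → K) (l : ℕ) :
    PowerSeries.C (PowerSeries.coeff l (ann q t B).1) * cre q t A =
      ∑ a ∈ Finset.HasAntidiagonal.antidiagonal l,
        PowerSeries.coeff a.1 (expSeries K (posSeries fun n =>
            (n : K) * (1 - q ^ n) / (1 - t ^ n) * ∑ k, B k n * A k n)) •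
          (PowerSeries.X ^ a.1 * (cre q t A *
            PowerSeries.C (PowerSeries.coeff a.2 (ann q t B).1))) := by
  refine C_coeff_expSeries_mul_expSeries (S := creExponent q t A) (T := annExponent q t B)
    (constantCoeff_posSeries _) (constantCoeff_posSeries _)
    (creExponent_commute q t _ _) (annExponent_commute q t _ _) _ ?_ l
  intro n hn
  ext1 j
  rw [map_add, PowerSeries.coeff_C_mul, PowerSeries.coeff_mul_C, coeff_smul_op,
    PowerSeries.coeff_X_pow, coeff_annExponent, coeff_creExponent, if_neg hn]
  split_ifs with hj hjn hjn
  · omega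
  · simp
  -- In equal degrees the double sum over components picks up a scalar only on its diagonal; that
  -- scalar is the coefficient of the contraction.
  · subst hjn
    rw [Finset.sum_mul_sum, Finset.sum_mul_sum, Finset.sum_comm, Finset.mul_sum, Finset.sum_smul,
      ← Finset.sum_add_distrib]
    refine Finset.sum_congr rfl fun k _ => ?_
    have h : ∀ l : Fin m, B l j • heisAt q t l (j : ℤ) * A k j • heisAt q t k (-(j : ℤ)) =
        A k j • heisAt q t k (-(j : ℤ)) * B l j • heisAt q t l (j : ℤ) +
          (if l = k then (j : K) * (1 - q ^ j) / (1 - t ^ j) * (B l j * A l j) else 0) •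
            (1 : Op K m) := by
      intro l
      rw [smul_mul_smul_comm, smul_mul_smul_comm, heisAt_pos_mul_neg q t l k hj hj, smul_add,
        mul_comm (A k j), smul_smul]
      congr 2
      split_ifs with hlk hjj
      · subst hlk; ring
      · exact absurd rfl hjj
      · simp
    rw [Finset.sum_congr rfl fun l _ => h l, Finset.sum_add_distrib, ← Finset.sum_smul]
    simp
  · rw [smul_zero, add_zero, Finset.sum_mul_sum, Finset.sum_mul_sum, Finset.sum_comm]
    refine Finset.sum_congr rfl fun k _ => Finset.sum_congr rfl fun l _ => ?_
    rw [smul_mul_smul_comm, smul_mul_smul_comm, heisAt_pos_mul_neg q t l k hn hj,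
      if_neg (Ne.symm hjn), ite_self, zero_smul, add_zero, mul_comm (A k j)]

end Exponentials

/-! ### Modes of fields -/

section Fields

variable {K : Type*} [Field K] {m : ℕ}

theorem field_ext {A B : VertexOperator K (FockT K m)}
    (h : ∀ n v, modeOf A n v = modeOf B n v) : A = B :=
  HVertexOperator.coeff_inj (funext fun n => LinearMap.ext fun v => h n v)

theorem modeOf_lmulField (C : PowerSeries (Op K m)) (A : VertexOperator K (FockT K m)) (n : ℤ)
    (v : FockT K m) :
    modeOf (lmulField C A) n v = ∑ᶠ j : ℕ, PowerSeries.coeff j C (modeOf A (n - j) v) := rfl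

theorem modeOf_rmulField (A : VertexOperator K (FockT K m)) (D : lowering K m) (n : ℤ)
    (v : FockT K m) :
    modeOf (rmulField A D) n v = ∑ᶠ l : ℕ, modeOf A (n + l) (PowerSeries.coeff l D.1 v) := rfl

theorem modeOf_scaleField (ζ : K) (A : VertexOperator K (FockT K m)) (n : ℤ) (v : FockT K m) :
    modeOf (scaleField ζ A) n v = ζ ^ n • modeOf A n v := rfl

theorem modeOf_oneField (n : ℤ) (v : FockT K m) :
    modeOf (oneField K m) n v = if n = 0 then v else 0 := by
  change (if n = 0 then (1 : Op K m) else 0) v = _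
  split_ifs <;> rfl

theorem finite_lmul (C : PowerSeries (Op K m)) (A : VertexOperator K (FockT K m)) (n : ℤ)
    (v : FockT K m) :
    (Function.support fun j : ℕ => PowerSeries.coeff j C (modeOf A (n - j) v)).Finite := by
  obtain ⟨M, hM⟩ := exists_modeOf_eq_zero A v
  refine (Set.finite_Iic (n - M).toNat).subset fun j hj => ?_
  by_contra h
  exact hj (by
    change PowerSeries.coeff j C (modeOf A (n - j) v) = 0
    rw [hM _ (by simp only [Set.mem_Iic] at h; omega), map_zero])

theorem finite_rmul (A : VertexOperator K (FockT K m)) (D : lowering K m) (n : ℤ)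
    (v : FockT K m) :
    (Function.support fun l : ℕ => modeOf A (n + l) (PowerSeries.coeff l D.1 v)).Finite :=
  (lowering_finite D v).subset fun l hl h0 => hl (by
    change modeOf A (n + l) (PowerSeries.coeff l D.1 v) = 0
    rw [h0, map_zero])

theorem modeOf_add (A B : VertexOperator K (FockT K m)) (n : ℤ) :
    modeOf (A + B) n = modeOf A n + modeOf B n := by
  rw [modeOf, map_add]; rfl

theorem modeOf_smul (c : K) (A : VertexOperator K (FockT K m)) (n : ℤ) :
    modeOf (c • A) n = c • modeOf A n := by
  rw [modeOf, map_smul]; rfl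

theorem lmulField_add (C : PowerSeries (Op K m)) (A B : VertexOperator K (FockT K m)) :
    lmulField C (A + B) = lmulField C A + lmulField C B := by
  refine field_ext fun n v => ?_
  rw [modeOf_add, LinearMap.add_apply, modeOf_lmulField, modeOf_lmulField, modeOf_lmulField,
    ← finsum_add_distrib (finite_lmul C A n v) (finite_lmul C B n v)]
  simp only [modeOf_add, LinearMap.add_apply, map_add]

theorem lmulField_smul (C : PowerSeries (Op K m)) (c : K) (A : VertexOperator K (FockT K m)) :
    lmulField C (c • A) = c • lmulField C A := by
  refine field_ext fun n v => ?_
  rw [modeOf_smul, LinearMap.smul_apply, modeOf_lmulField, modeOf_lmulField, smul_finsum]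
  simp only [modeOf_smul, LinearMap.smul_apply, map_smul]

theorem rmulField_add (A B : VertexOperator K (FockT K m)) (D : lowering K m) :
    rmulField (A + B) D = rmulField A D + rmulField B D := by
  refine field_ext fun n v => ?_
  rw [modeOf_add, LinearMap.add_apply, modeOf_rmulField, modeOf_rmulField, modeOf_rmulField,
    ← finsum_add_distrib (finite_rmul A D n v) (finite_rmul B D n v)]
  simp only [modeOf_add, LinearMap.add_apply]

theorem rmulField_smul (c : K) (A : VertexOperator K (FockT K m)) (D : lowering K m) :
    rmulField (c • A) D = c • rmulField A D := by
  refine field_ext fun n v => ?_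
  rw [modeOf_smul, LinearMap.smul_apply, modeOf_rmulField, modeOf_rmulField, smul_finsum]
  simp only [modeOf_smul, LinearMap.smul_apply]

theorem scaleField_add (ζ : K) (A B : VertexOperator K (FockT K m)) :
    scaleField ζ (A + B) = scaleField ζ A + scaleField ζ B := by
  refine field_ext fun n v => ?_
  simp only [modeOf_add, LinearMap.add_apply, modeOf_scaleField, smul_add]

theorem scaleField_smul (ζ c : K) (A : VertexOperator K (FockT K m)) :
    scaleField ζ (c • A) = c • scaleField ζ A := by
  refine field_ext fun n v => ?_
  simp only [modeOf_smul, LinearMap.smul_apply, modeOf_scaleField, smul_comm c]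

/-- Multiplication by a series on the left, as a linear map on fields. -/
def lmulLin (C : PowerSeries (Op K m)) :
    VertexOperator K (FockT K m) →ₗ[K] VertexOperator K (FockT K m) where
  toFun := lmulField C
  map_add' := lmulField_add C
  map_smul' := lmulField_smul C

/-- Multiplication by a series on the right, as a linear map on fields. -/
def rmulLin (D : lowering K m) :
    VertexOperator K (FockT K m) →ₗ[K] VertexOperator K (FockT K m) where
  toFun A := rmulField A D
  map_add' A B := rmulField_add A B D
  map_smul' c A := rmulField_smul c A D

/-- Rescaling of the variable, as a linear map on fields. -/
def scaleLin (ζ : K) : VertexOperator K (FockT K m) →ₗ[K] VertexOperator K (FockT K m) where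
  toFun := scaleField ζ
  map_add' := scaleField_add ζ
  map_smul' := scaleField_smul ζ

theorem modeOf_rmul_oneField (D : lowering K m) (n : ℤ) (v : FockT K m) :
    modeOf (rmulField (oneField K m) D) n v =
      if n ≤ 0 then PowerSeries.coeff (-n).toNat D.1 v else 0 := by
  rw [modeOf_rmulField]
  simp only [modeOf_oneField]
  split_ifs with h
  · rw [finsum_eq_single _ (-n).toNat fun l hl => if_neg (by omega), if_pos (by omega)]
  · exact finsum_eq_zero_of_forall_eq_zero fun l => if_neg (by omega)

end Fields

/-! ### Rearranging finite sums -/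

section Sums

theorem finsum_comp_eq {α β M : Type*} [AddCommMonoid M] {e : α → β} (he : Function.Injective e)
    (g : β → M) (hg : ∀ b, g b ≠ 0 → b ∈ Set.range e) : ∑ᶠ a, g (e a) = ∑ᶠ b, g b := by
  rw [← finsum_mem_range he, finsum_mem_def]
  refine finsum_congr fun b => ?_
  by_cases hb : b ∈ Set.range e
  · rw [Set.indicator_of_mem hb]
  · rw [Set.indicator_of_notMem hb]
    by_contra h
    exact hb (hg b (Ne.symm h))

/-- Pairs are grouped by total degree; finite support justifies the interchange of sums. -/
theorem finsum_antidiagonal {M : Type*} [AddCommMonoid M] (f : ℕ × ℕ → M)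
    (hf : (Function.support f).Finite) :
    ∑ᶠ l, ∑ a ∈ Finset.HasAntidiagonal.antidiagonal l, f a = ∑ᶠ a, f a := by
  rw [finsum_eq_sum_of_support_toFinset_subset f hf subset_rfl]
  have h1 : ∀ l, ∑ a ∈ Finset.HasAntidiagonal.antidiagonal l, f a =
      ∑ a ∈ hf.toFinset, if a.1 + a.2 = l then f a else 0 := by
    intro l
    rw [← Finset.sum_filter]
    refine (Finset.sum_subset (fun a ha => ?_) fun a ha h => ?_).symm
    · rw [Finset.mem_filter] at ha
      rw [Finset.HasAntidiagonal.mem_antidiagonal, ha.2]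
    · rw [Finset.HasAntidiagonal.mem_antidiagonal] at ha
      by_contra h0
      exact h (Finset.mem_filter.mpr ⟨by simpa using h0, ha⟩)
  simp only [h1]
  rw [finsum_sum_comm]
  · refine Finset.sum_congr rfl fun a _ => ?_
    rw [finsum_eq_single _ (a.1 + a.2) fun l hl => if_neg (Ne.symm hl), if_pos rfl]
  · intro a _
    refine (Set.finite_singleton (a.1 + a.2)).subset fun l hl => ?_
    by_contra h
    exact hl (if_neg fun h1 => h (by simp [h1]))

theorem finsum_prod_snd_fst {α β M : Type*} [AddCommMonoid M] (f : α × β → M)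
    (hf : (Function.support f).Finite) : ∑ᶠ b, ∑ᶠ a, f (a, b) = ∑ᶠ x, f x := by
  rw [← finsum_comp_eq (Equiv.prodComm β α).injective f fun b _ => (Equiv.prodComm β α).surjective b,
    finsum_curry]
  · rfl
  · exact (hf.image (Equiv.prodComm α β)).subset fun x hx => ⟨(x.2, x.1), hx, rfl⟩

end Sums

/-! ### Products of normally ordered operators -/

section Products

variable {K : Type*} [Field K] {m : ℕ}

theorem intCoeff_natCast {A : Type*} [Ring A] (S : PowerSeries A) (n : ℕ) :
    intCoeff S (n : ℤ) = PowerSeries.coeff n S := by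
  rw [intCoeff, if_pos (Int.natCast_nonneg n), Int.toNat_natCast]

theorem intCoeff_of_neg {A : Type*} [Ring A] (S : PowerSeries A) {n : ℤ} (hn : n < 0) :
    intCoeff S n = 0 :=
  if_neg (not_le.mpr hn)

theorem intCoeff_natCast_op (S : PowerSeries (Op K m)) (n : ℕ) :
    intCoeff S (n : ℤ) = PowerSeries.coeff n S := intCoeff_natCast S n

theorem intCoeff_scale (ζ : K) (S : PowerSeries (Op K m)) (n : ℤ) :
    intCoeff (scaleSeries ζ S) n = ζ ^ n • intCoeff S n := by
  rcases lt_or_ge n 0 with h | h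
  · rw [intCoeff_of_neg _ h, intCoeff_of_neg _ h, smul_zero]
  · lift n to ℕ using h
    rw [intCoeff_natCast_op, intCoeff_natCast_op, scaleSeries, PowerSeries.coeff_mk, zpow_natCast]

theorem intCoeff_mul_apply (C S : PowerSeries (Op K m)) (n : ℤ) (v : FockT K m) :
    intCoeff (C * S) n v = ∑ᶠ j : ℕ, PowerSeries.coeff j C (intCoeff S (n - j) v) := by
  rcases lt_or_ge n 0 with h | h
  · rw [intCoeff_of_neg _ h, LinearMap.zero_apply]
    refine (finsum_eq_zero_of_forall_eq_zero fun j => ?_).symm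
    rw [intCoeff_of_neg _ (by omega), LinearMap.zero_apply, map_zero]
  · lift n to ℕ using h
    rw [intCoeff_natCast_op, PowerSeries.coeff_mul, LinearMap.sum_apply,
      Finset.Nat.sum_antidiagonal_eq_sum_range_succ_mk]
    rw [finsum_eq_sum_of_support_subset (s := Finset.range n.succ)]
    · refine Finset.sum_congr rfl fun j hj => ?_
      rw [Finset.mem_range] at hj
      rw [show (n : ℤ) - j = ((n - j : ℕ) : ℤ) by omega, intCoeff_natCast_op]
      rfl
    · intro j hj
      by_contra h
      refine hj ?_
      simp only [Finset.coe_range, Set.mem_Iio] at h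
      change PowerSeries.coeff j C (intCoeff S (n - j) v) = 0
      rw [intCoeff_of_neg _ (by omega), LinearMap.zero_apply, map_zero]

/-- By definition the mode is a sum over the creation degree j. Reindexing by the annihilation
degree l = j - n is done inside ℤ, where `intCoeff` vanishes at negative degrees and both sums
extend to all integers. -/
theorem modeOf_field (S : Ordered K m) (n : ℤ) (v : FockT K m) :
    modeOf S.field n v = ∑ᶠ l : ℕ, intCoeff S.1 (n + l) (PowerSeries.coeff l S.2.1 v) := by
  rw [Ordered.field, modeOf_lmulField]
  simp only [modeOf_rmul_oneField]
  let g : ℤ → FockT K m := fun z => intCoeff S.1 (n + z) (intCoeff S.2.1 z v)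
  have h1 := finsum_comp_eq (e := fun l : ℕ => (l : ℤ)) Nat.cast_injective g fun b hb => by
    by_cases h : 0 ≤ b
    · exact ⟨b.toNat, Int.toNat_of_nonneg h⟩
    · exact absurd (by simp [g, intCoeff_of_neg S.2.1 (not_le.mp h)]) hb
  have h2 := finsum_comp_eq (e := fun j : ℕ => (j : ℤ) - n)
    (fun a b h => by simpa using h) g fun b hb => by
      by_cases h : 0 ≤ n + b
      · exact ⟨(n + b).toNat, by simp only; omega⟩
      · exact absurd (by simp [g, intCoeff_of_neg S.1 (not_le.mp h)]) hb
  refine Eq.trans (finsum_congr fun j => ?_) (h2.trans (h1.symm.trans (finsum_congr fun l => ?_)))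
  · simp only [g, show n + ((j : ℤ) - n) = j by omega, intCoeff_natCast_op]
    split_ifs with h
    · rw [show (j : ℤ) - n = ((-(n - j)).toNat : ℕ) by omega, intCoeff_natCast_op]
    · rw [intCoeff_of_neg S.2.1 (by omega), LinearMap.zero_apply]
  · simp only [g, intCoeff_natCast_op]

/-- A creation series on the left leaves the product normally ordered. Only two sums need
exchanging, and the one over annihilation degrees is finite on each vector. -/
theorem lmulField_field (C : PowerSeries (Op K m)) (S : Ordered K m) :
    lmulField C S.field = Ordered.field ((C, 1) * S) := by
  refine field_ext fun n v => ?_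
  rw [modeOf_lmulField, modeOf_field]
  have hfin := lowering_finite S.2 v
  have h1 : ∀ j : ℕ, PowerSeries.coeff j C (modeOf S.field (n - j) v) = ∑ l ∈ hfin.toFinset,
      PowerSeries.coeff j C (intCoeff S.1 (n - j + l) (PowerSeries.coeff l S.2.1 v)) := by
    intro j
    rw [modeOf_field, finsum_eq_sum_of_support_subset (s := hfin.toFinset), map_sum]
    intro l hl
    simpa using fun h0 => hl (by simp only [h0, map_zero])
  simp only [h1]
  rw [finsum_sum_comm, finsum_eq_sum_of_support_subset (s := hfin.toFinset)]
  · refine Finset.sum_congr rfl fun l _ => ?_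
    rw [Prod.fst_mul, Prod.snd_mul, one_mul, intCoeff_mul_apply]
    exact finsum_congr fun j => by rw [show n - j + l = n + l - (j : ℤ) by ring]
  · intro l hl
    simpa using fun h0 => hl (by simp [Prod.snd_mul, h0])
  · intro l _
    refine (Set.finite_Iic (n + l).toNat).subset fun j hj => ?_
    by_contra h
    refine hj ?_
    change PowerSeries.coeff j C (intCoeff S.1 (n - j + l) (PowerSeries.coeff l S.2.1 v)) = 0
    rw [intCoeff_of_neg _ (by simp only [Set.mem_Iic] at h; omega), LinearMap.zero_apply, map_zero]

theorem rmulField_field (S : Ordered K m) (D : lowering K m) :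
    rmulField S.field D = Ordered.field (S * (1, D)) := by
  refine field_ext fun n v => ?_
  rw [modeOf_rmulField, modeOf_field]
  simp only [modeOf_field]
  let f : ℕ × ℕ → FockT K m := fun a => intCoeff S.1 (n + ((a.1 + a.2 : ℕ) : ℤ))
    (PowerSeries.coeff a.1 S.2.1 (PowerSeries.coeff a.2 D.1 v))
  have hf : (Function.support f).Finite :=
    (lowering_finite₂ S.2 D v).subset fun a ha h0 => ha (by simp only [f, h0, map_zero])
  have h1 := finsum_prod_snd_fst f hf
  rw [← finsum_antidiagonal f hf] at h1
  refine Eq.trans (finsum_congr fun l => finsum_congr fun l' => ?_)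
    (h1.trans (finsum_congr fun L => ?_))
  · simp only [f]
    rw [show n + (l : ℤ) + l' = n + ((l' + l : ℕ) : ℤ) by push_cast; ring]
  · rw [Prod.fst_mul, Prod.snd_mul, mul_one]
    change _ = intCoeff S.1 (n + L) (PowerSeries.coeff L (S.2.1 * D.1) v)
    rw [PowerSeries.coeff_mul, LinearMap.sum_apply, map_sum]
    refine Finset.sum_congr rfl fun a ha => ?_
    rw [Finset.HasAntidiagonal.mem_antidiagonal] at ha
    simp only [f, ha]
    rfl

/-- The annihilation half is a series in the inverse variable and so scales by ζ⁻¹; for ζ ≠ 0 the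
factor ζ^(n+l) ζ^(-l) reduces to ζ^n. -/
theorem scaleField_field {ζ : K} (hζ : ζ ≠ 0) (S : Ordered K m) :
    scaleField ζ S.field = (S.scale ζ).field := by
  refine field_ext fun n v => ?_
  rw [modeOf_scaleField, modeOf_field, modeOf_field, smul_finsum]
  refine finsum_congr fun l => ?_
  change _ = intCoeff (scaleSeries ζ S.1) (n + l) (PowerSeries.coeff l (scaleSeries ζ⁻¹ S.2.1) v)
  rw [intCoeff_scale, scaleSeries, PowerSeries.coeff_mk, LinearMap.smul_apply,
    LinearMap.smul_apply, map_smul, smul_smul]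
  congr 1
  rw [zpow_add₀ hζ, zpow_natCast, mul_assoc, ← mul_pow, mul_inv_cancel₀ hζ, one_pow, mul_one]

theorem field_one : (1 : Ordered K m).field = oneField K m := by
  refine field_ext fun n v => ?_
  rw [modeOf_field, modeOf_oneField, finsum_eq_single _ 0]
  · change intCoeff (1 : PowerSeries (Op K m)) (n + ((0 : ℕ) : ℤ))
      (PowerSeries.coeff 0 (1 : PowerSeries (Op K m)) v) = _
    rw [Nat.cast_zero, add_zero, PowerSeries.coeff_one, if_pos rfl, Module.End.one_apply]
    rcases lt_or_ge n 0 with h | h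
    · rw [intCoeff_of_neg _ h, if_neg (by omega), LinearMap.zero_apply]
    · lift n to ℕ using h
      rw [intCoeff_natCast_op, PowerSeries.coeff_one]
      simp only [Nat.cast_eq_zero]
      split_ifs <;> rfl
  · intro l hl
    change intCoeff (1 : PowerSeries (Op K m)) (n + l)
      (PowerSeries.coeff l (1 : PowerSeries (Op K m)) v) = 0
    rw [PowerSeries.coeff_one, if_neg hl, LinearMap.zero_apply, map_zero]

end Products

/-! ### Operator products -/

section OperatorProducts

variable {K : Type*} [Field K] {m : ℕ}

theorem atRatio_coeff (f : PowerSeries K) (s : ℕ) :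
    (atRatio f).coeff (toLex ((s : ℤ), -(s : ℤ))) = PowerSeries.coeff s f :=
  HahnSeries.embDomain_coeff (x := HahnSeries.toPowerSeries.symm f)

theorem atRatio_coeff_ne_zero {f : PowerSeries K} {g : Exps} (h : (atRatio f).coeff g ≠ 0) :
    ∃ s : ℕ, g = toLex ((s : ℤ), -(s : ℤ)) := by
  by_contra h1
  refine h (HahnSeries.embDomain_of_notMem_range (x := HahnSeries.toPowerSeries.symm f) ?_)
  rintro ⟨s, hs⟩
  exact h1 ⟨s, hs.symm⟩

/-- The module action sums over pairs of exponents adding to g. The support of a series in w/z lies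
on the ray (s, -s), so s alone indexes the sum. -/
theorem coeff_atRatio_smul (f : PowerSeries K) (O : HVertexOperator Exps K (FockT K m) (FockT K m))
    (v : FockT K m) (g : Exps) :
    ((HahnModule.of K).symm (atRatio f • O v)).coeff g = ∑ᶠ s : ℕ, PowerSeries.coeff s f •
      HVertexOperator.coeff O (toLex ((ofLex g).1 - s, (ofLex g).2 + s)) v := by
  rw [HahnModule.coeff_smul]
  set T := Finset.VAddAntidiagonal g (Set.VAddAntidiagonal.finite_of_isPWO
    (atRatio f).isPWO_support ((HahnModule.of K).symm (O v)).isPWO_support g) with hT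
  let G : Exps × Exps → FockT K m := fun ij =>
    (atRatio f).coeff ij.1 • ((HahnModule.of K).symm (O v)).coeff ij.2
  let e : ℕ → Exps × Exps := fun s =>
    (toLex ((s : ℤ), -(s : ℤ)), toLex ((ofLex g).1 - s, (ofLex g).2 + s))
  have he : Function.Injective e := fun a b h => by
    have h1 : (a : ℤ) = b := congrArg (fun x : Exps × Exps => (ofLex x.1).1) h
    exact_mod_cast h1
  have hadd : ∀ s, (e s).1 + (e s).2 = g := fun s => by
    apply ofLex.injective
    ext
    · change (s : ℤ) + ((ofLex g).1 - s) = _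
      ring
    · change -(s : ℤ) + ((ofLex g).2 + s) = _
      ring
  have h1 : ∑ ij ∈ T, G ij = ∑ᶠ ij, if ij ∈ T then G ij else 0 := by
    rw [finsum_eq_sum_of_support_subset (s := T)]
    · exact Finset.sum_congr rfl fun ij hij => (if_pos hij).symm
    · intro ij hij
      by_contra h
      exact hij (if_neg h)
  change ∑ ij ∈ T, G ij = _
  rw [h1, ← finsum_comp_eq he]
  · refine finsum_congr fun s => ?_
    have h2 : G (e s) = PowerSeries.coeff s f •
        HVertexOperator.coeff O (toLex ((ofLex g).1 - s, (ofLex g).2 + s)) v := by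
      change (atRatio f).coeff (toLex ((s : ℤ), -(s : ℤ))) • _ = _
      rw [atRatio_coeff]
      rfl
    rw [← h2]
    split_ifs with h
    · rfl
    · by_contra h0
      refine h ?_
      rw [hT, Finset.mem_vaddAntidiagonal]
      refine ⟨fun hz => h0 ?_, fun hz => h0 ?_, hadd s⟩
      · change _ = (atRatio f).coeff (e s).1 • _
        rw [hz, zero_smul]
      · change _ = _ • ((HahnModule.of K).symm (O v)).coeff (e s).2
        rw [hz, smul_zero]
  · intro ij hij
    have hmem : ij ∈ T := by
      by_contra h
      exact hij (if_neg h)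
    rw [hT, Finset.mem_vaddAntidiagonal] at hmem
    obtain ⟨s, hs⟩ := atRatio_coeff_ne_zero hmem.1
    refine ⟨s, Prod.ext hs.symm ?_⟩
    have h2 : (e s).1 + (e s).2 = (e s).1 + ij.2 :=
      (hadd s).trans (hmem.2.2.symm.trans (congrArg (· + ij.2) hs))
    exact add_left_cancel h2

theorem coeff_ordered₂ (S T : Ordered K m) (g : Exps) (v : FockT K m) :
    HVertexOperator.coeff (ordered₂ S T) g v = ∑ᶠ l : ℕ × ℕ,
      intCoeff S.1 ((ofLex g).2 + l.1) (intCoeff T.1 ((ofLex g).1 + l.2)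
        (PowerSeries.coeff l.1 S.2.1 (PowerSeries.coeff l.2 T.2.1 v))) := rfl

variable [CharZero K]

/-- The power series `exp (∑ c_n X ^ n)` in the operator product of two vertex operators. -/
def contraction (q t : K) (B A : Fin m → ℕ → K) : PowerSeries K :=
  expSeries K (posSeries fun n => (n : K) * (1 - q ^ n) / (1 - t ^ n) * ∑ k, B k n * A k n)

theorem ann_apply_cre (q t : K) (A B : Fin m → ℕ → K) (l : ℕ) (N : ℤ) (u : FockT K m) :
    PowerSeries.coeff l (ann q t B).1 (intCoeff (cre q t A) N u) =
      ∑ a ∈ Finset.HasAntidiagonal.antidiagonal l, PowerSeries.coeff a.1 (contraction q t B A) •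
        intCoeff (cre q t A) (N - a.1) (PowerSeries.coeff a.2 (ann q t B).1 u) := by
  rcases lt_or_ge N 0 with h | h
  · rw [intCoeff_of_neg _ h, LinearMap.zero_apply, map_zero]
    refine (Finset.sum_eq_zero fun a _ => ?_).symm
    rw [intCoeff_of_neg _ (by omega), LinearMap.zero_apply, smul_zero]
  · lift N to ℕ using h
    have h1 := congrArg (fun S : PowerSeries (Op K m) => PowerSeries.coeff N S u) (ann_mul_cre q t A B l)
    simp only [PowerSeries.coeff_C_mul, map_sum, LinearMap.sum_apply] at h1
    rw [intCoeff_natCast_op]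
    refine h1.trans (Finset.sum_congr rfl fun a _ => ?_)
    rw [coeff_smul_op, LinearMap.smul_apply, PowerSeries.coeff_X_pow_mul']
    congr 1
    split_ifs with h
    · rw [PowerSeries.coeff_mul_C, ← intCoeff_natCast_op, Nat.cast_sub h]
      rfl
    · rw [intCoeff_of_neg _ (by omega)]
      rfl

/-- Only the annihilation half of the first operator and the creation half of the second are out of
order. Exchanging them by `ann_apply_cre`, a contraction of degree s shifts the exponents by
(w/z)^s, which is how the scalar series acts. -/
theorem comp_vop (q t : K) (A B A' B' : Fin m → ℕ → K) (v : FockT K m) :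
    HVertexOperator.comp (vop q t A B).field (vop q t A' B').field v =
      atRatio (contraction q t B A') • ordered₂ (vop q t A B) (vop q t A' B') v := by
  refine (HahnModule.of K).symm.injective (HahnSeries.ext (funext fun g => ?_))
  rw [coeff_atRatio_smul]
  set a := (ofLex g).2 with ha
  set b := (ofLex g).1 with hb
  change modeOf (vop q t A B).field a (modeOf (vop q t A' B').field b v) = _
  have hfin := lowering_finite (ann q t B') v
  set c := contraction q t B A' with hc
  let w : ℕ → FockT K m := fun l' => PowerSeries.coeff l' (ann q t B').1 v
  -- The common summand of both sides: `l'` is the annihilation degree of the second operator, `x.1`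
  -- the degree of the contraction, and `x.2` the degree of the annihilation part of the first
  -- operator that survives.
  let F : ℕ → ℕ × ℕ → FockT K m := fun l' x => PowerSeries.coeff x.1 c •
    intCoeff (cre q t A) (a + ((x.1 + x.2 : ℕ) : ℤ)) (intCoeff (cre q t A') (b + l' - x.1)
      (PowerSeries.coeff x.2 (ann q t B).1 (w l')))
  have hw : ∀ l' ∉ hfin.toFinset, w l' = 0 := fun l' h => by simpa using h
  have hF0 : ∀ l' ∉ hfin.toFinset, ∀ x, F l' x = 0 := fun l' h x => by
    simp only [F, hw l' h, map_zero, smul_zero]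
  -- The contraction degree is bounded because the creation degree b + l' - x.1 cannot be negative,
  -- the other degree because annihilation series act locally finitely.
  have hFfin : ∀ l', (Function.support (F l')).Finite := by
    intro l'
    refine ((Set.finite_Iic (b + l').toNat).prod (lowering_finite (ann q t B) (w l'))).subset
      fun x hx => ⟨?_, fun h => hx ?_⟩
    · by_contra h
      refine hx ?_
      simp only [F]
      rw [intCoeff_of_neg (cre q t A') (by simp only [Set.mem_Iic] at h; omega),
        LinearMap.zero_apply, map_zero, smul_zero]
    · simp only [F]
      rw [h, map_zero, map_zero, smul_zero]
  have hL : modeOf (vop q t A B).field a (modeOf (vop q t A' B').field b v) =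
      ∑ l' ∈ hfin.toFinset, ∑ᶠ x, F l' x := by
    have h1 : modeOf (vop q t A' B').field b v =
        ∑ l' ∈ hfin.toFinset, intCoeff (cre q t A') (b + l') (w l') := by
      rw [modeOf_field]
      refine finsum_eq_sum_of_support_subset _ fun l' hl' => ?_
      by_contra h
      refine hl' ?_
      change intCoeff (cre q t A') (b + l') (w l') = 0
      rw [hw l' (by simpa using h), map_zero]
    rw [h1, map_sum]
    refine Finset.sum_congr rfl fun l' _ => ?_
    rw [modeOf_field, ← finsum_antidiagonal _ (hFfin l')]
    refine finsum_congr fun l => ?_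
    change intCoeff (cre q t A) (a + l) (PowerSeries.coeff l (ann q t B).1 _) = _
    rw [ann_apply_cre, map_sum]
    refine Finset.sum_congr rfl fun x hx => ?_
    rw [Finset.HasAntidiagonal.mem_antidiagonal] at hx
    rw [map_smul]
    simp only [F, hx]
    rfl
  have hR : ∀ s : ℕ, PowerSeries.coeff s c •
      HVertexOperator.coeff (ordered₂ (vop q t A B) (vop q t A' B')) (toLex (b - s, a + s)) v =
        ∑ l' ∈ hfin.toFinset, ∑ᶠ l, F l' (s, l) := by
    intro s
    rw [coeff_ordered₂, smul_finsum, ← finsum_prod_snd_fst, finsum_eq_sum_of_support_subset]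
    · refine Finset.sum_congr rfl fun l' _ => finsum_congr fun l => ?_
      simp only [F, w]
      change _ • intCoeff (cre q t A) (a + s + l) (intCoeff (cre q t A') (b - s + l') _) = _
      rw [show a + s + (l : ℤ) = a + ((s + l : ℕ) : ℤ) by push_cast; ring,
        show b - s + (l' : ℤ) = b + l' - s by ring]
      rfl
    · intro l' hl'
      by_contra h
      refine hl' (finsum_eq_zero_of_forall_eq_zero fun l => ?_)
      have : PowerSeries.coeff l' (vop q t A' B').2.1 v = 0 := hw l' (by simpa using h)
      simp only [this, map_zero, smul_zero]
    · exact (lowering_finite₂ (ann q t B) (ann q t B') v).subset fun l hl h0 => hl (by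
        have : PowerSeries.coeff l.1 (vop q t A B).2.1
          (PowerSeries.coeff l.2 (vop q t A' B').2.1 v) = 0 := h0
        simp only [this, map_zero, smul_zero])
  rw [hL, finsum_congr hR, finsum_sum_comm]
  · refine Finset.sum_congr rfl fun l' _ => ?_
    rw [finsum_curry _ (hFfin l')]
  · intro l' _
    refine ((hFfin l').image Prod.fst).subset fun s hs => ?_
    by_contra h
    refine hs (finsum_eq_zero_of_forall_eq_zero fun l => ?_)
    by_contra h0
    exact h ⟨(s, l), h0, rfl⟩

end OperatorProducts

/-! ### Scalar factors -/

section Scalars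

variable {K : Type*} [Field K]

theorem zVar_ne_zero : zVar K ≠ 0 := HahnSeries.single_ne_zero one_ne_zero

theorem atRatio_linear (a : K) :
    zVar K * atRatio (1 - PowerSeries.C a * PowerSeries.X) = zVar K - a • wVar K := by
  have h1 : atRatio (PowerSeries.C a * PowerSeries.X) =
      HahnSeries.single (toLex ((1 : ℤ), (-1 : ℤ))) a := by
    ext g
    by_cases hg : g = toLex ((1 : ℤ), (-1 : ℤ))
    · subst hg
      rw [HahnSeries.coeff_single_same]
      refine (atRatio_coeff _ 1).trans ?_
      rw [PowerSeries.coeff_C_mul, PowerSeries.coeff_one_X, mul_one]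
    · rw [HahnSeries.coeff_single_of_ne hg]
      by_contra h
      obtain ⟨s, rfl⟩ := atRatio_coeff_ne_zero h
      rw [atRatio_coeff, PowerSeries.coeff_C_mul, PowerSeries.coeff_X] at h
      split_ifs at h with hs
      · subst hs; exact hg rfl
      · exact h (mul_zero a)
  have h2 : a • wVar K = HahnSeries.single (toLex ((1 : ℤ), (0 : ℤ))) a := by
    ext g
    by_cases hg : g = toLex ((1 : ℤ), (0 : ℤ))
    · subst hg
      rw [HahnSeries.coeff_smul, wVar, HahnSeries.coeff_single_same, HahnSeries.coeff_single_same,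
        smul_eq_mul, mul_one]
    · rw [HahnSeries.coeff_smul, wVar, HahnSeries.coeff_single_of_ne hg,
        HahnSeries.coeff_single_of_ne hg, smul_zero]
  rw [map_sub, map_one, h1, mul_sub, mul_one, h2, zVar, HahnSeries.single_mul_single, one_mul]
  rfl

variable [CharZero K]

/-- The series `exp (∑ (c n / n) X ^ n)`. -/
def expLog (c : ℕ → K) : PowerSeries K := expSeries K (posSeries fun n => c n / n)

theorem expSeries_posSeries_mul (f g : ℕ → K) :
    expSeries K (posSeries f) * expSeries K (posSeries g) =
      expSeries K (posSeries (f + g)) := by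
  rw [posSeries_add, expSeries_add (constantCoeff_posSeries f) (constantCoeff_posSeries g)]
  all_goals exact fun _ _ => Commute.all _ _

theorem expLog_mul (c d : ℕ → K) : expLog c * expLog d = expLog (c + d) := by
  rw [expLog, expLog, expSeries_posSeries_mul, expLog]
  congr 2
  funext n
  simp [add_div]

/-- The exponent is log(1 - aX): its Euler derivative times 1 - aX is -aX, so 1 - aX solves the
equation of the exponential. -/
theorem expLog_neg_pow (a : K) :
    expLog (fun n => -a ^ n) = 1 - PowerSeries.C a * PowerSeries.X := by
  set L : PowerSeries K := posSeries fun n => -a ^ n / n with hL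
  have hE : euler (expSeries K L) = euler L * expSeries K L :=
    euler_expSeries (constantCoeff_posSeries _) (Commute.all _ _)
  have h1 : euler L * (1 - PowerSeries.C a * PowerSeries.X) = -(PowerSeries.C a * PowerSeries.X) := by
    ext n
    have hn : ∀ k : ℕ, PowerSeries.coeff (k + 1) (euler L) = -a ^ (k + 1) := fun k => by
      rw [coeff_euler, hL, coeff_posSeries, if_neg k.succ_ne_zero]
      have : ((k + 1 : ℕ) : K) ≠ 0 := Nat.cast_ne_zero.mpr k.succ_ne_zero
      field_simp
    have h0 : PowerSeries.coeff 0 (euler L) = 0 := by rw [coeff_euler]; simp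
    rw [mul_sub, mul_one, map_sub, map_neg, ← mul_assoc, mul_comm (euler L), mul_assoc,
      PowerSeries.coeff_C_mul, PowerSeries.coeff_C_mul, PowerSeries.coeff_X]
    rcases n with _ | _ | n
    · rw [h0]; simp
    · rw [hn, PowerSeries.coeff_succ_mul_X, h0]; simp
    · rw [hn, PowerSeries.coeff_succ_mul_X, hn]
      simp
      ring
  rw [expLog, ← sub_eq_zero]
  refine eq_zero_of_euler_eq K (S := L) ?_ ?_
  · simp [constantCoeff_expSeries]
  · rw [euler_sub, hE, mul_sub, h1, euler_sub, euler_one, euler_mul, euler_C]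
    have hX : euler (PowerSeries.X : PowerSeries K) = PowerSeries.X := by
      ext n
      rw [coeff_euler, PowerSeries.coeff_X]
      split_ifs with h <;> simp [h]
    rw [hX]; ring

/-- `exp (∑ (1 / n) (a ^ n + b ^ n - c ^ n - d ^ n) (w / z) ^ n)` is a rational function. -/
theorem atRatio_expLog (a b c d : K) :
    atRatio (expLog fun n => a ^ n + b ^ n - c ^ n - d ^ n) =
      (zVar K - c • wVar K) * (zVar K - d • wVar K) /
        ((zVar K - a • wVar K) * (zVar K - b • wVar K)) := by
  -- z - xw is z times a series in w/z with constant term 1, so denominators may be cleared.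
  have hne : ∀ x : K, zVar K - x • wVar K ≠ 0 := by
    intro x h
    rw [← atRatio_linear, mul_eq_zero, or_iff_right zVar_ne_zero] at h
    have h1 := congrArg (fun f : HahnSeries Exps K => f.coeff (toLex ((0 : ℕ), -((0 : ℕ) : ℤ)))) h
    simp only [HahnSeries.coeff_zero] at h1
    erw [atRatio_coeff] at h1
    simp at h1
  rw [eq_div_iff (mul_ne_zero (hne a) (hne b))]
  simp only [← atRatio_linear]
  have h1 : expLog (fun n => a ^ n + b ^ n - c ^ n - d ^ n) *
      ((1 - PowerSeries.C a * PowerSeries.X) * (1 - PowerSeries.C b * PowerSeries.X)) =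
      (1 - PowerSeries.C c * PowerSeries.X) * (1 - PowerSeries.C d * PowerSeries.X) := by
    rw [← expLog_neg_pow, ← expLog_neg_pow, ← expLog_neg_pow, ← expLog_neg_pow, expLog_mul,
      expLog_mul, expLog_mul]
    congr 1
    funext n
    simp only [Pi.add_apply]
    ring
  have h2 := congrArg atRatio h1
  rw [map_mul, map_mul, map_mul] at h2
  linear_combination zVar K * zVar K * h2

end Scalars

/-! ### Exponents of the currents `Λ_i` and `Λ_i^*`

For fixed `n > 0`, put `x = p ^ (n / 2)`. Up to common factors, the exponents of `Λ_i` and `Λ_i^*`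
are the following functions of `x`. -/

section Exponents

variable {K : Type*} [Field K]

/-- The factor `(x - x⁻¹) / (x ^ (-m) - x ^ m)` in the exponents of `α` and `β`. -/
def wCoeff (x : K) (m : ℕ) : K := (x - x⁻¹) / (x ^ (-(m : ℤ)) - x ^ (m : ℤ))

/-- The creation exponents of `Λ̃_i`. -/
def uTilde (x : K) (i k : ℕ) : K :=
  if k < i then (1 - x ^ (-2 : ℤ)) * x ^ (-(k : ℤ)) else if k = i then x ^ (-(k : ℤ)) else 0

/-- The creation exponents of `Λ_i`. -/
def uCoeff (x : K) (m i k : ℕ) : K := wCoeff x m * x ^ ((m : ℤ) - 1 - k) + uTilde x i k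

/-- The annihilation exponents of `Λ_i`. -/
def vCoeff (x : K) (m i k : ℕ) : K :=
  wCoeff x m * x ^ ((m : ℤ) - 1 - k) + if k = i then x ^ (k : ℤ) else 0

/-- The creation exponents of `Λ_i^*`. -/
def uStar (x : K) (m i k : ℕ) : K :=
  wCoeff x m * x ^ ((m : ℤ) - 3 - k) + if k = i then x ^ ((k : ℤ) - 2) else 0

/-- The annihilation exponents of `Λ̃_i^*`. -/
def vStarTilde (x : K) (i k : ℕ) : K :=
  if k < i then 0 else if k = i then x ^ (-(k : ℤ)) else -((x ^ 2 - 1) * x ^ (-(k : ℤ)))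

/-- The annihilation exponents of `Λ_i^*`. -/
def vStar (x : K) (m i k : ℕ) : K :=
  wCoeff x m * x ^ (1 - (m : ℤ) - k) + vStarTilde x i k

/-- The power of `z` by which the `i`-th factor of `Λ_k^*` is rescaled. -/
def omitWeight (x : K) (k i : ℕ) : K :=
  if i < k then x ^ (2 * (i : ℤ)) else if i = k then 0 else x ^ (2 * (i : ℤ) - 2)

/-! ### Geometric and telescoping sums of the exponents -/

variable {x : K} {m : ℕ}

/-- Together with the symmetry `wCoeff_inv`, this is all that the later cancellations use about
`wCoeff`. The condition on x makes the denominator x^(-m) - x^m nonzero. -/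
theorem wCoeff_eq (hx : x ≠ 0) (hm : x ^ (2 * m) ≠ 1) :
    wCoeff x m * (x ^ (2 * (m : ℤ)) - 1) = -(x ^ ((m : ℤ) - 1) * (x ^ 2 - 1)) := by
  have h : x ^ (-(m : ℤ)) - x ^ (m : ℤ) ≠ 0 := by
    intro h
    refine hm ?_
    rw [zpow_neg, zpow_natCast, sub_eq_zero, inv_eq_iff_eq_inv] at h
    rw [two_mul, pow_add]
    nth_rewrite 1 [h]
    exact inv_mul_cancel₀ (pow_ne_zero _ hx)
  rw [wCoeff, div_mul_eq_mul_div, div_eq_iff h, zpow_sub₀ hx, two_mul, zpow_add₀ hx, zpow_neg]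
  have := zpow_ne_zero (m : ℤ) hx
  field_simp
  ring

theorem sq_ne_one (hm : x ^ (2 * m) ≠ 1) : x ^ 2 - 1 ≠ 0 := by
  intro h
  rw [sub_eq_zero] at h
  exact hm (by rw [pow_mul, h, one_pow])

theorem sum_zpow_two_mul (hx : x ≠ 0) (n : ℕ) :
    (∑ i ∈ Finset.range n, x ^ (2 * (i : ℤ))) * (x ^ 2 - 1) = x ^ (2 * (n : ℤ)) - 1 := by
  induction n with
  | zero => simp
  | succ n ih =>
    rw [Finset.sum_range_succ, add_mul, ih, Nat.cast_succ, mul_add, zpow_add₀ hx]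
    have : x ^ (2 * 1 : ℤ) = x ^ 2 := zpow_natCast x 2
    rw [this]
    ring

theorem wCoeff_mul_sum (hx : x ≠ 0) (hm : x ^ (2 * m) ≠ 1) :
    wCoeff x m * ∑ i ∈ Finset.range m, x ^ (2 * (i : ℤ)) = -x ^ ((m : ℤ) - 1) := by
  have h := sq_ne_one hm
  refine mul_right_cancel₀ h ?_
  rw [mul_assoc, sum_zpow_two_mul hx, wCoeff_eq hx hm]
  ring

theorem wCoeff_inv : wCoeff x⁻¹ m = wCoeff x m := by
  rw [wCoeff, wCoeff, inv_inv, inv_zpow', inv_zpow', neg_neg, ← neg_sub x, ← neg_sub (x ^ (-(m : ℤ))),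
    neg_div_neg_eq]

theorem wCoeff_mul_sum_neg (hx : x ≠ 0) (hm : x ^ (2 * m) ≠ 1) :
    wCoeff x m * ∑ i ∈ Finset.range m, x ^ (-2 * (i : ℤ)) = -x ^ (1 - (m : ℤ)) := by
  have h := wCoeff_mul_sum (x := x⁻¹) (m := m) (inv_ne_zero hx)
    (by rw [inv_pow]; exact fun h => hm (inv_eq_one.mp h))
  rw [wCoeff_inv, inv_zpow'] at h
  simp only [inv_zpow'] at h
  rw [← show -((m : ℤ) - 1) = 1 - m by ring, ← h]
  simp only [neg_mul]

/-- The sum starts at i = k with x^k and then telescopes, since x^(2i) (1 - x^(-2)) = x^(2i) -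
x^(2i-2). -/
theorem sum_uTilde_left (hx : x ≠ 0) (k N : ℕ) :
    ∑ i ∈ Finset.range N, x ^ (2 * (i : ℤ)) * uTilde x i k =
      if k < N then x ^ (2 * (N : ℤ) - k - 2) else 0 := by
  induction N with
  | zero => simp
  | succ N ih =>
    rw [Finset.sum_range_succ, ih, uTilde]
    have hk := zpow_ne_zero (k : ℤ) hx
    have hN := zpow_ne_zero (N : ℤ) hx
    split_ifs <;> first | omega | skip
    all_goals
      try subst_vars
      try simp only [Nat.cast_succ, two_mul, zpow_add₀ hx, zpow_sub₀ hx, zpow_neg, zpow_ofNat]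
      field_simp
      try ring

theorem sum_uTilde_right (hx : x ≠ 0) (i N : ℕ) :
    ∑ k ∈ Finset.range N, x ^ (-(k : ℤ)) * uTilde x i k =
      if i < N then 1 else 1 - x ^ (-2 * (N : ℤ)) := by
  induction N with
  | zero => simp
  | succ N ih =>
    rw [Finset.sum_range_succ, ih, uTilde]
    have hk := zpow_ne_zero (i : ℤ) hx
    have hN := zpow_ne_zero (N : ℤ) hx
    split_ifs <;> first | omega | skip
    all_goals
      try subst_vars
      try simp only [Nat.cast_succ, neg_mul, two_mul, zpow_add₀ hx, zpow_neg, zpow_ofNat]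
      field_simp
      try ring

/-- Lowering the weights after k closes the gap left by k: the nonzero weights run through 1, x^2,
x^4, ... once each. -/
theorem sum_omitWeight (k N : ℕ) :
    ∑ i ∈ Finset.range N, omitWeight x k i =
      ∑ i ∈ Finset.range (if N ≤ k then N else N - 1), x ^ (2 * (i : ℤ)) := by
  induction N with
  | zero => simp
  | succ N ih =>
    rw [Finset.sum_range_succ, ih, omitWeight]
    rcases lt_trichotomy N k with h | h | h
    · rw [if_pos h.le, if_pos h, if_pos (Nat.succ_le_of_lt h), Finset.sum_range_succ]
    · rw [if_pos h.le, if_neg (by omega), if_pos h, if_neg (by omega), add_zero]; rfl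
    · rw [if_neg (by omega), if_neg (by omega), if_neg (by omega), if_neg (by omega)]
      obtain ⟨N, rfl⟩ := Nat.exists_eq_succ_of_ne_zero (by omega : N ≠ 0)
      simp only [Nat.succ_sub_one, Nat.succ_eq_add_one]
      rw [Finset.sum_range_succ]
      push_cast
      congr 2
      ring

/-- The telescoping of `sum_uTilde_left` runs one step behind after index k; for s = k the missing
diagonal term leaves the correction. -/
theorem sum_omitWeight_uTilde (hx : x ≠ 0) (k s N : ℕ) :
    ∑ i ∈ Finset.range N, omitWeight x k i * uTilde x i s =
      if N ≤ k then if s < N then x ^ (2 * (N : ℤ) - s - 2) else 0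
      else (if s < N then x ^ (2 * (N : ℤ) - s - 4) else 0) -
        if s = k then x ^ ((s : ℤ) - 2) else 0 := by
  induction N with
  | zero => simp
  | succ N ih =>
    rw [Finset.sum_range_succ, ih, uTilde, omitWeight]
    have hk := zpow_ne_zero (k : ℤ) hx
    have hs := zpow_ne_zero (s : ℤ) hx
    have hN := zpow_ne_zero (N : ℤ) hx
    split_ifs <;> first | omega | skip
    all_goals
      try subst_vars
      try simp only [Nat.cast_succ, two_mul, zpow_add₀ hx, zpow_sub₀ hx, zpow_neg, zpow_ofNat]
      field_simp
      try ring

theorem sum_vStarTilde_right (hx : x ≠ 0) (i N : ℕ) :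
    ∑ k ∈ Finset.range N, x ^ (-(k : ℤ)) * vStarTilde x i k =
      if i < N then x ^ (2 - 2 * (N : ℤ)) else 0 := by
  induction N with
  | zero => simp
  | succ N ih =>
    rw [Finset.sum_range_succ, ih, vStarTilde]
    have hk := zpow_ne_zero (i : ℤ) hx
    have hN := zpow_ne_zero (N : ℤ) hx
    split_ifs <;> first | omega | skip
    all_goals
      try subst_vars
      try simp only [Nat.cast_succ, two_mul, zpow_add₀ hx, zpow_sub₀ hx, zpow_neg, zpow_ofNat]
      field_simp
      try ring

theorem sum_vStarTilde_left (hx : x ≠ 0) (k N : ℕ) :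
    ∑ i ∈ Finset.range N, x ^ (2 * (i : ℤ)) * vStarTilde x i k =
      if k < N then x ^ (-(k : ℤ)) else -((x ^ (2 * (N : ℤ)) - 1) * x ^ (-(k : ℤ))) := by
  induction N with
  | zero => simp
  | succ N ih =>
    rw [Finset.sum_range_succ, ih, vStarTilde]
    have hk := zpow_ne_zero (k : ℤ) hx
    have hN := zpow_ne_zero (N : ℤ) hx
    split_ifs <;> first | omega | skip
    all_goals
      try subst_vars
      try simp only [Nat.cast_succ, two_mul, zpow_add₀ hx, zpow_neg, zpow_ofNat]
      field_simp
      try ring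

/-- The part quadratic in `wCoeff` collapses by `wCoeff_mul_sum_neg` to a linear term, which cancels
the sum of `wCoeff` against `uTilde`. Only the contribution of the component k = i survives. -/
theorem sum_vCoeff_mul_uCoeff (hx : x ≠ 0) (hm : x ^ (2 * m) ≠ 1) {i j : ℕ} (hi : i < m)
    (hj : j < m) : ∑ k ∈ Finset.range m, vCoeff x m i k * uCoeff x m j k =
      wCoeff x m * x ^ ((m : ℤ) - 1) +
        if i = j then 1 else if i < j then 1 - x ^ (-2 : ℤ) else 0 := by
  have h1 : ∀ k ∈ Finset.range m, vCoeff x m i k * uCoeff x m j k =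
      wCoeff x m * x ^ (2 * (m : ℤ) - 2) * (wCoeff x m * x ^ (-2 * (k : ℤ))) +
        wCoeff x m * x ^ ((m : ℤ) - 1) * (x ^ (-(k : ℤ)) * uTilde x j k) +
        if k = i then wCoeff x m * x ^ ((m : ℤ) - 1) + x ^ (i : ℤ) * uTilde x j i else 0 := by
    intro k _
    have hk : x ^ ((m : ℤ) - 1 - k) = x ^ ((m : ℤ) - 1) * x ^ (-(k : ℤ)) := by
      rw [← zpow_add₀ hx]; rfl
    have hk2 : x ^ (2 * (m : ℤ) - 2) * x ^ (-2 * (k : ℤ)) =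
        (x ^ ((m : ℤ) - 1) * x ^ (-(k : ℤ))) ^ 2 := by
      rw [← zpow_add₀ hx, ← zpow_add₀ hx, ← zpow_natCast, ← zpow_mul]
      congr 1; push_cast; ring
    have hk3 : x ^ (-(k : ℤ)) * x ^ (k : ℤ) = 1 := by
      rw [← zpow_add₀ hx, neg_add_cancel, zpow_zero]
    rw [vCoeff, uCoeff, hk]
    split_ifs with h
    · subst h
      linear_combination (-wCoeff x m ^ 2) * hk2 + wCoeff x m * x ^ ((m : ℤ) - 1) * hk3
    · linear_combination (-wCoeff x m ^ 2) * hk2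
  rw [Finset.sum_congr rfl h1, Finset.sum_add_distrib, Finset.sum_add_distrib, ← Finset.mul_sum,
    ← Finset.mul_sum, ← Finset.mul_sum, wCoeff_mul_sum_neg hx hm, sum_uTilde_right hx, if_pos hj,
    Finset.sum_ite_eq', if_pos (Finset.mem_range.mpr hi)]
  have h2 : x ^ (2 * (m : ℤ) - 2) * x ^ (1 - (m : ℤ)) = x ^ ((m : ℤ) - 1) := by
    rw [← zpow_add₀ hx]; congr 1; ring
  have h3 : x ^ (i : ℤ) * uTilde x j i =
      if i = j then 1 else if i < j then 1 - x ^ (-2 : ℤ) else 0 := by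
    have hk3 : x ^ (i : ℤ) * x ^ (-(i : ℤ)) = 1 := by
      rw [← zpow_add₀ hx, add_neg_cancel, zpow_zero]
    rw [uTilde]
    split_ifs <;> first | omega | linear_combination hk3 |
      linear_combination (1 - x ^ (-2 : ℤ)) * hk3 | ring
  rw [h3]
  linear_combination -wCoeff x m * h2

/-- The same cancellation as for Λ, but now the creation exponents carry the delta term, so the
component k = j survives. -/
theorem sum_vStar_mul_uStar (hx : x ≠ 0) (hm : x ^ (2 * m) ≠ 1) {i j : ℕ} (hi : i < m)
    (hj : j < m) : ∑ k ∈ Finset.range m, vStar x m i k * uStar x m j k =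
      wCoeff x m * x ^ (-1 - (m : ℤ)) +
        if i = j then x ^ (-2 : ℤ) else if i < j then x ^ (-2 : ℤ) - 1 else 0 := by
  have h1 : ∀ k ∈ Finset.range m, vStar x m i k * uStar x m j k =
      wCoeff x m * x ^ (-2 : ℤ) * (wCoeff x m * x ^ (-2 * (k : ℤ))) +
        wCoeff x m * x ^ ((m : ℤ) - 3) * (x ^ (-(k : ℤ)) * vStarTilde x i k) +
        if k = j then wCoeff x m * x ^ (-1 - (m : ℤ)) + x ^ ((j : ℤ) - 2) * vStarTilde x i j
          else 0 := by
    intro k _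
    have hk : x ^ ((m : ℤ) - 3 - k) = x ^ ((m : ℤ) - 3) * x ^ (-(k : ℤ)) := by
      rw [← zpow_add₀ hx]; rfl
    have hk2 : x ^ (1 - (m : ℤ) - k) * (x ^ ((m : ℤ) - 3) * x ^ (-(k : ℤ))) =
        x ^ (-2 : ℤ) * x ^ (-2 * (k : ℤ)) := by
      rw [← zpow_add₀ hx, ← zpow_add₀ hx, ← zpow_add₀ hx]
      congr 1; ring
    have hk3 : x ^ (1 - (m : ℤ) - k) * x ^ ((k : ℤ) - 2) = x ^ (-1 - (m : ℤ)) := by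
      rw [← zpow_add₀ hx]; congr 1; ring
    rw [vStar, uStar, hk]
    split_ifs with h
    · subst h
      linear_combination wCoeff x m ^ 2 * hk2 + wCoeff x m * hk3
    · linear_combination wCoeff x m ^ 2 * hk2
  rw [Finset.sum_congr rfl h1, Finset.sum_add_distrib, Finset.sum_add_distrib, ← Finset.mul_sum,
    ← Finset.mul_sum, ← Finset.mul_sum, wCoeff_mul_sum_neg hx hm, sum_vStarTilde_right hx,
    if_pos hi, Finset.sum_ite_eq', if_pos (Finset.mem_range.mpr hj)]
  have h2 : x ^ (-2 : ℤ) * x ^ (1 - (m : ℤ)) = x ^ (-1 - (m : ℤ)) := by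
    rw [← zpow_add₀ hx]; congr 1; ring
  have h4 : x ^ ((m : ℤ) - 3) * x ^ (2 - 2 * (m : ℤ)) = x ^ (-1 - (m : ℤ)) := by
    rw [← zpow_add₀ hx]; congr 1; ring
  have h3 : x ^ ((j : ℤ) - 2) * vStarTilde x i j =
      if i = j then x ^ (-2 : ℤ) else if i < j then x ^ (-2 : ℤ) - 1 else 0 := by
    have hk3 : x ^ ((j : ℤ) - 2) * x ^ (-(j : ℤ)) = x ^ (-2 : ℤ) := by
      rw [← zpow_add₀ hx]; congr 1; ring
    have hk4 : x ^ 2 * x ^ (-2 : ℤ) = 1 := by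
      rw [← zpow_natCast, ← zpow_add₀ hx]; simp
    rw [vStarTilde]
    split_ifs <;> first | omega | linear_combination hk3 |
      linear_combination -(x ^ 2 - 1) * hk3 - hk4 | ring
  rw [h3]
  linear_combination -wCoeff x m * h2 + wCoeff x m * h4

/-- The α-factors contribute -x^(2m-2-k), which is minus the telescoped sum of `uTilde`. -/
theorem sum_uCoeff (hx : x ≠ 0) (hm : x ^ (2 * m) ≠ 1) {k : ℕ} (hk : k < m) :
    ∑ i ∈ Finset.range m, x ^ (2 * (i : ℤ)) * uCoeff x m i k = 0 := by
  simp only [uCoeff, mul_add, Finset.sum_add_distrib]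
  rw [sum_uTilde_left hx, if_pos hk, ← Finset.sum_mul, ← mul_assoc, mul_comm _ (wCoeff x m),
    wCoeff_mul_sum hx hm, neg_mul, ← zpow_add₀ hx, neg_add_eq_zero]
  congr 1; ring

theorem sum_vCoeff (hx : x ≠ 0) (hm : x ^ (2 * m) ≠ 1) {k : ℕ} (hk : k < m) :
    ∑ i ∈ Finset.range m, x ^ (-2 * (i : ℤ)) * vCoeff x m i k = 0 := by
  simp only [vCoeff, mul_add, Finset.sum_add_distrib, mul_ite, mul_zero]
  rw [Finset.sum_ite_eq, if_pos (Finset.mem_range.mpr hk), ← Finset.sum_mul, ← mul_assoc,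
    mul_comm _ (wCoeff x m), wCoeff_mul_sum_neg hx hm, neg_mul, ← zpow_add₀ hx, ← zpow_add₀ hx,
    neg_add_eq_zero]
  congr 1; ring

theorem sum_uStar (hx : x ≠ 0) (hm : x ^ (2 * m) ≠ 1) {k : ℕ} (hk : k < m) :
    ∑ i ∈ Finset.range m, x ^ (-2 * (i : ℤ)) * uStar x m i k = 0 := by
  simp only [uStar, mul_add, Finset.sum_add_distrib, mul_ite, mul_zero]
  rw [Finset.sum_ite_eq, if_pos (Finset.mem_range.mpr hk), ← Finset.sum_mul, ← mul_assoc,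
    mul_comm _ (wCoeff x m), wCoeff_mul_sum_neg hx hm, neg_mul, ← zpow_add₀ hx, ← zpow_add₀ hx,
    neg_add_eq_zero]
  congr 1; ring

theorem sum_vStar (hx : x ≠ 0) (hm : x ^ (2 * m) ≠ 1) {k : ℕ} (hk : k < m) :
    ∑ i ∈ Finset.range m, x ^ (2 * (i : ℤ)) * vStar x m i k = 0 := by
  simp only [vStar, mul_add, Finset.sum_add_distrib]
  rw [sum_vStarTilde_left hx, if_pos hk, ← Finset.sum_mul, ← mul_assoc, mul_comm _ (wCoeff x m),
    wCoeff_mul_sum hx hm, neg_mul, ← zpow_add₀ hx, neg_add_eq_zero]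
  congr 1; ring

theorem sum_omitWeight_uCoeff (hx : x ≠ 0) (hm : x ^ (2 * m) ≠ 1) {k s : ℕ} (hk : k < m)
    (hs : s < m) :
    ∑ i ∈ Finset.range m, omitWeight x k i * uCoeff x m i s = -uStar x m k s := by
  obtain ⟨n, rfl⟩ := Nat.exists_eq_succ_of_ne_zero (by omega : m ≠ 0)
  simp only [uCoeff, mul_add, Finset.sum_add_distrib]
  rw [sum_omitWeight_uTilde hx, if_neg (by omega), if_pos hs, ← Finset.sum_mul, sum_omitWeight,
    if_neg (by omega), uStar]
  have h1 := wCoeff_mul_sum hx hm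
  -- The weights form a geometric sum of only m - 1 terms. Splitting off i = 0 writes the full sum
  -- as x^2 times this one plus 1, and the 1 yields the `wCoeff` term of Λ_k^*.
  have h5 : ∀ i : ℕ, x ^ (2 * ((i + 1 : ℕ) : ℤ)) = x ^ (2 : ℤ) * x ^ (2 * (i : ℤ)) := fun i => by
    rw [← zpow_add₀ hx]; congr 1; push_cast; ring
  rw [Finset.sum_range_succ', Finset.sum_congr rfl fun i _ => h5 i, ← Finset.mul_sum, Nat.cast_zero,
    mul_zero, zpow_zero] at h1
  have h2 : x ^ ((n.succ : ℤ) - 1) * x ^ ((n.succ : ℤ) - 3 - s) =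
      x ^ (2 * (n.succ : ℤ) - s - 4) := by
    rw [← zpow_add₀ hx]; congr 1; ring
  have h3 : x ^ ((n.succ : ℤ) - 1 - s) = x ^ ((n.succ : ℤ) - 3 - s) * x ^ (2 : ℤ) := by
    rw [← zpow_add₀ hx]; congr 1; ring
  rw [h3, ← h2, Nat.succ_sub_one]
  linear_combination x ^ ((n.succ : ℤ) - 3 - s) * h1

/-- Annihilation exponents scale with inverse powers, hence the weights at x⁻¹. Here the last term
of the geometric sum is split off instead of the first. -/
theorem sum_omitWeight_vCoeff (hx : x ≠ 0) (hm : x ^ (2 * m) ≠ 1) {k s : ℕ} (hk : k < m)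
    (hs : s < m) :
    ∑ i ∈ Finset.range m, omitWeight x⁻¹ k i * vCoeff x m i s = -vStar x m k s := by
  obtain ⟨n, rfl⟩ := Nat.exists_eq_succ_of_ne_zero (by omega : m ≠ 0)
  simp only [vCoeff, mul_add, Finset.sum_add_distrib, mul_ite, mul_zero]
  rw [Finset.sum_ite_eq, if_pos (Finset.mem_range.mpr hs), ← Finset.sum_mul, sum_omitWeight,
    if_neg (by omega), vStar, Nat.succ_sub_one]
  have h1 := wCoeff_mul_sum_neg hx hm
  rw [Finset.sum_range_succ] at h1
  have h2 : x ^ (-2 * (n : ℤ)) * x ^ ((n.succ : ℤ) - 1 - s) = x ^ (1 - (n.succ : ℤ) - s) := by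
    rw [← zpow_add₀ hx]; congr 1; push_cast; ring
  have h3 : x ^ (1 - (n.succ : ℤ)) * x ^ ((n.succ : ℤ) - 1 - s) = x ^ (-(s : ℤ)) := by
    rw [← zpow_add₀ hx]; congr 1; ring
  have h4 : omitWeight x⁻¹ k s * x ^ (s : ℤ) = x ^ (-(s : ℤ)) - vStarTilde x k s := by
    have h5 : x ^ (2 * (s : ℤ)) = x ^ (s : ℤ) * x ^ (s : ℤ) := by rw [two_mul, zpow_add₀ hx]
    have h6 := zpow_ne_zero (s : ℤ) hx
    rw [omitWeight, vStarTilde, inv_zpow, inv_zpow, zpow_sub₀ hx, h5, zpow_neg, zpow_ofNat]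
    split_ifs <;> field_simp <;> ring
  simp only [neg_mul, inv_zpow'] at h1 h2 ⊢
  rw [h4]
  linear_combination x ^ ((n.succ : ℤ) - 1 - s) * h1 - wCoeff x n.succ * h2 - h3

end Exponents

/-! ### The exponents of the images of the generators -/

section Images

variable {K : Type*} [Field K] {m : ℕ}

/-- Horner's scheme: the k-th term is multiplied by c once for each later component. -/
theorem foldl_smul_add {M : Type*} [AddCommGroup M] [Module K M] (c : K) {n : ℕ} (f : Fin n → M) :
    (List.finRange n).foldl (fun B k => c • B + f k) 0 = ∑ k : Fin n, c ^ (n - 1 - (k : ℕ)) • f k := by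
  induction n with
  | zero => simp
  | succ n ih =>
    rw [List.finRange_succ_last, List.foldl_append, List.foldl_map, ih fun k => f k.castSucc,
      Fin.sum_univ_castSucc]
    simp only [List.foldl_cons, List.foldl_nil, Finset.smul_sum, smul_smul, ← pow_succ']
    congr 1
    · refine Finset.sum_congr rfl fun k _ => ?_
      have := k.isLt
      rw [show n - 1 - (k : ℕ) + 1 = n + 1 - 1 - (k : ℕ) by omega, Fin.val_castSucc]
    · simp

theorem rhoB_eq (q t r : K) (n : ℤ) :
    rhoB q t r m n = ∑ k : Fin m,
      (r ^ (2 * n.natAbs)) ^ ((m : ℤ) - 1 - (k : ℕ)) • levelOneB q t r k n := by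
  have hc : (r ^ (-2 : ℤ)) ^ (-(n.natAbs : ℤ)) = r ^ (2 * n.natAbs) := by
    rw [← zpow_mul, ← zpow_natCast]; congr 1; push_cast; ring
  rw [rhoB, hc]
  refine (foldl_smul_add (M := Op K m) (r ^ (2 * n.natAbs)) fun k => levelOneB q t r k n).trans (Finset.sum_congr rfl fun k _ => ?_)
  have := k.isLt
  rw [show (m : ℤ) - 1 - (k : ℕ) = ((m - 1 - (k : ℕ) : ℕ) : ℤ) by omega, zpow_natCast]

theorem levelGamma_pow (r : K) (n : ℕ) :
    levelGamma r m ^ n = (r ^ (2 * n)) ^ (-(m : ℤ)) := by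
  rw [levelGamma, ← pow_mul, ← pow_mul, inv_pow, zpow_neg, zpow_natCast, ← pow_mul]
  congr 2; ring

theorem levelGamma_zpow_neg (r : K) (n : ℕ) :
    levelGamma r m ^ (-(n : ℤ)) = (r ^ (2 * n)) ^ (m : ℤ) := by
  rw [zpow_neg, zpow_natCast, levelGamma_pow, zpow_neg, inv_inv]

/-- The factor p^(n/2) - p^(-n/2) of the level one modes, divided by γ^n - γ^(-n) with γ = p^(-m/2),
is `wCoeff` at x = r^(2n). The two minus signs cancel here; for β one remains. -/
theorem rhoAlpha_eq (q t r : K) (ε : K) :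
    rhoAlpha q t r m ε = cre q t fun k n =>
      ε * ((1 - t ^ (-(n : ℤ))) / n * (wCoeff (r ^ (2 * n)) m *
        (r ^ (2 * n)) ^ ((m : ℤ) - 1 - (k : ℕ)))) := by
  rw [rhoAlpha, cre, creExponent]
  congr 1
  refine posSeries_congr fun n hn => ?_
  rw [rhoB_eq, Finset.smul_sum]
  refine Finset.sum_congr rfl fun k _ => ?_
  rw [levelOneB, smul_smul, smul_smul, Int.natAbs_neg, Int.natAbs_natCast, levelGamma_pow,
    levelGamma_zpow_neg, wCoeff]
  congr 1
  have h1 : r ^ (2 * (n : ℤ)) = r ^ (2 * n) := by rw [← zpow_natCast]; congr 1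
  have h2 : r ^ (-2 * (n : ℤ)) = (r ^ (2 * n))⁻¹ := by rw [neg_mul, zpow_neg, h1]
  rw [h1, h2]
  ring

theorem rhoBeta_eq (q t r : K) (ε : K) :
    rhoBeta q t r m ε = ann q t fun k n =>
      -(ε * ((1 - t ^ n) / n * (wCoeff (r ^ (2 * n)) m *
        (r ^ (2 * n)) ^ ((m : ℤ) - 1 - (k : ℕ))))) := by
  refine Subtype.ext ?_
  change expSeries K (posSeries _) = expSeries K (posSeries _)
  congr 1
  refine posSeries_congr fun n hn => ?_
  rw [rhoB_eq, Finset.smul_sum]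
  refine Finset.sum_congr rfl fun k _ => ?_
  dsimp only
  rw [levelOneB, smul_smul, smul_smul, Int.natAbs_natCast, levelGamma_pow,
    levelGamma_zpow_neg, wCoeff, zpow_natCast t]
  congr 1
  have h1 : r ^ (2 * (n : ℤ)) = r ^ (2 * n) := by rw [← zpow_natCast]; congr 1
  have h2 : r ^ (-2 * (n : ℤ)) = (r ^ (2 * n))⁻¹ := by rw [neg_mul, zpow_neg, h1]
  rw [h1, h2]
  ring

/-- The exponents `a` in the `k`-th tensor component. -/
def expAt (k : Fin m) (a : ℕ → K) : Fin m → ℕ → K := fun l n => if l = k then a n else 0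

theorem scale_creation (q t ζ : K) (k : Fin m) (c : ℕ → K) :
    scaleSeries ζ (creation q t k c) = cre q t (expAt k fun n => ζ ^ n * c n) := by
  rw [creation_eq, scale_cre]
  refine cre_congr q t fun n _ l => ?_
  simp only [expAt, mul_ite, mul_zero]

theorem scale_annihilation (q t ζ : K) (k : Fin m) (c : ℕ → K) :
    scaleLow ζ (annihilation q t k c) = ann q t (expAt k fun n => ζ⁻¹ ^ n * c n) := by
  rw [annihilation_eq, scale_ann]
  refine ann_congr q t fun n _ l => ?_
  simp only [expAt, mul_ite, mul_zero]

theorem vop_expAt_congr (q t : K) (k : Fin m) {a a' b b' : ℕ → K} (ha : ∀ n, n ≠ 0 → a n = a' n)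
    (hb : ∀ n, n ≠ 0 → b n = b' n) :
    vop q t (expAt k a) (expAt k b) = vop q t (expAt k a') (expAt k b') :=
  vop_congr q t (fun n hn l => by simp only [expAt, ha n hn])
    fun n hn l => by simp only [expAt, hb n hn]

theorem expAt_zero (k : Fin m) : expAt k (0 : ℕ → K) = 0 := by
  funext l n; simp [expAt]

theorem zpow_two_mul_pow (r : K) (e : ℤ) (n : ℕ) :
    (r ^ (2 * e)) ^ n = (r ^ (2 * n)) ^ e := by
  rw [← zpow_natCast, ← zpow_natCast, ← zpow_mul, ← zpow_mul]
  congr 1; push_cast; ring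

variable [CharZero K]

theorem prod_ofFn_expAt (q t : K) (a b : Fin m → ℕ → K) :
    (List.ofFn fun k => vop q t (expAt k (a k)) (expAt k (b k))).prod = vop q t a b := by
  rw [prod_ofFn_vop]
  congr 1
  all_goals
    funext l n
    simp [Finset.sum_apply, expAt]

theorem lambdaTilde_eq (q t : K) {r : K} (hr : r ≠ 0) (hp : r ^ 4 = q / t) (i : Fin m) :
    lambdaTilde q t r i = vop q t
      (fun k n => (1 - t ^ (-(n : ℤ))) / n * uTilde (r ^ (2 * n)) i k)
      (fun k n => -((1 - t ^ n) / n * if (k : ℕ) = i then (r ^ (2 * n)) ^ (((k : ℕ) : ℤ)) else 0)) := by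
  rw [← prod_ofFn_expAt, lambdaTilde, List.ofFn_eq_map]
  congr 2
  funext k
  have hpn : ∀ n : ℕ, (q / t) ^ (-(n : ℤ)) = (r ^ (2 * n)) ^ (-2 : ℤ) := fun n => by
    rw [← hp, ← zpow_natCast, ← zpow_natCast, ← zpow_mul, ← zpow_mul]
    congr 1; push_cast; ring
  have hlt : ∀ a b : Fin m, a < b ↔ (a : ℕ) < b := fun _ _ => Iff.rfl
  have heq : ∀ a b : Fin m, a = b ↔ (a : ℕ) = b := fun _ _ => Fin.ext_iff
  simp only [hlt, heq]
  by_cases h1 : (k : ℕ) < i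
  · rw [if_pos h1]
    rw [phiMinus, scale_creation, ← ann_zero q t, ← expAt_zero k]
    refine vop_expAt_congr q t k (fun n _ => ?_) fun n _ => ?_
    -- Components count from 0: the scale p^(-(2k+1)/4) and the factor p^(n/4) inside φ⁻ combine to
    -- x^(-k).
    · have h3 : (r ^ (-(2 * ((k : ℕ) : ℤ) + 1))) ^ n * r ^ n = (r ^ (2 * n)) ^ (-((k : ℕ) : ℤ)) := by
        rw [← mul_pow, ← zpow_two_mul_pow, ← zpow_add_one₀ hr]
        congr 2; ring
      rw [uTilde, if_pos h1, ← h3, hpn]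
      ring
    · rw [if_neg (by omega)]; simp
  rw [if_neg h1]
  by_cases h2 : (k : ℕ) = i
  · rw [if_pos h2, eta, Ordered.scale, scale_creation, scale_annihilation]
    refine vop_expAt_congr q t k (fun n _ => ?_) fun n _ => ?_
    · rw [uTilde, if_neg h1, if_pos h2, ← zpow_two_mul_pow, h2, neg_mul, mul_neg]
      ring
    · rw [if_pos h2, ← zpow_two_mul_pow, h2, ← zpow_neg, neg_mul, neg_neg]
      ring
  · rw [if_neg h2, ← vop_zero q t, ← expAt_zero k]
    refine vop_expAt_congr q t k (fun n _ => ?_) fun n _ => ?_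
    · rw [uTilde, if_neg h1, if_neg h2]; simp
    · rw [if_neg h2]; simp

/-- The exponents of `Λ_i`. -/
theorem lambda_eq (q t : K) {r : K} (hr : r ≠ 0) (hp : r ^ 4 = q / t) (i : Fin m) :
    lambda q t r i = vop q t
      (fun k n => (1 - t ^ (-(n : ℤ))) / n * uCoeff (r ^ (2 * n)) m i k)
      (fun k n => -((1 - t ^ n) / n * vCoeff (r ^ (2 * n)) m i k)) := by
  -- The trivial halves of the outer pairs are rewritten as exponentials of zero, so that all three
  -- factors have the form `vop` and their exponents add.
  rw [lambda, lambdaTilde_eq q t hr hp, rhoAlpha_eq, rhoBeta_eq, ← ann_zero q t,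
    ← cre_zero q t]
  change vop _ _ _ _ * _ * vop _ _ _ _ = _
  rw [← vop_add, ← vop_add]
  refine vop_congr q t (fun n _ k => ?_) fun n _ k => ?_
  · simp only [Pi.add_apply, Pi.zero_apply, uCoeff]; ring
  · simp only [Pi.add_apply, Pi.zero_apply, vCoeff]; ring

/-- The factor x^(m-2) in the annihilation exponents is kept apart because the rescaling by
p^((m-2)/2) in Λ_i^* removes it. -/
theorem lambdaTildeStar_eq (q t : K) {r : K} (hr : r ≠ 0) (hp : r ^ 4 = q / t) (i : Fin m) :
    lambdaTildeStar q t r i = vop q t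
      (fun k n => -((1 - t ^ (-(n : ℤ))) / n *
        if (k : ℕ) = i then (r ^ (2 * n)) ^ (((k : ℕ) : ℤ) - m) else 0))
      (fun k n => (1 - t ^ n) / n *
        ((r ^ (2 * n)) ^ ((m : ℤ) - 2) * vStarTilde (r ^ (2 * n)) i k)) := by
  rw [← prod_ofFn_expAt, lambdaTildeStar, List.ofFn_eq_map]
  congr 2
  funext k
  have hx : ∀ n : ℕ, r ^ (2 * n) ≠ 0 := fun n => pow_ne_zero _ hr
  have hpn : ∀ n : ℕ, (q / t) ^ (-(n : ℤ)) = (r ^ (2 * n)) ^ (-2 : ℤ) := fun n => by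
    rw [← hp, ← zpow_natCast, ← zpow_natCast, ← zpow_mul, ← zpow_mul]
    congr 1; push_cast; ring
  have hlt : ∀ a b : Fin m, a < b ↔ (a : ℕ) < b := fun _ _ => Iff.rfl
  have heq : ∀ a b : Fin m, a = b ↔ (a : ℕ) = b := fun _ _ => Fin.ext_iff
  have hinv : ∀ n : ℕ, r ^ (-2 * (n : ℤ)) = (r ^ (2 * n)) ^ (-1 : ℤ) := fun n => by
    rw [← zpow_natCast, ← zpow_mul]; congr 1; push_cast; ring
  simp only [hlt, heq]
  by_cases h1 : (k : ℕ) < i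
  · rw [if_pos h1]
    rw [← vop_zero q t, ← expAt_zero k]
    refine vop_expAt_congr q t k (fun n _ => ?_) fun n _ => ?_
    · rw [if_neg (by omega)]; simp
    · rw [vStarTilde, if_pos h1]; simp
  rw [if_neg h1]
  by_cases h2 : (k : ℕ) = i
  · rw [if_pos h2, xi, Ordered.scale, scale_creation, scale_annihilation]
    refine vop_expAt_congr q t k (fun n _ => ?_) fun n _ => ?_
    · have h3 : (r ^ (-2 * ((m : ℤ) - 1 - (i : ℕ)))) ^ n * (r ^ (2 * n)) ^ (-1 : ℤ) =
          (r ^ (2 * n)) ^ (((k : ℕ) : ℤ) - m) := by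
        rw [neg_mul, ← mul_neg, zpow_two_mul_pow, ← zpow_add₀ (hx n), h2]
        congr 1; ring
      rw [if_pos h2, ← h3, hinv]
      ring
    · have h3 : (r ^ (-2 * ((m : ℤ) - 1 - (i : ℕ))))⁻¹ ^ n * (r ^ (2 * n)) ^ (-1 : ℤ) =
          (r ^ (2 * n)) ^ ((m : ℤ) - 2) * (r ^ (2 * n)) ^ (-((k : ℕ) : ℤ)) := by
        rw [neg_mul, zpow_neg, inv_inv, zpow_two_mul_pow, ← zpow_add₀ (hx n),
          ← zpow_add₀ (hx n), h2]
        congr 1; ring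
      rw [vStarTilde, if_neg h1, if_pos h2, ← h3, hinv]
      ring
  · rw [if_neg h2, phiPlus, scale_annihilation, ← cre_zero q t, ← expAt_zero k]
    refine vop_expAt_congr q t k (fun n _ => ?_) fun n _ => ?_
    · rw [if_neg h2]; simp
    · have h3 : (r ^ (-(2 * ((m : ℤ) - 1 - (k : ℕ)) + 1)))⁻¹ ^ n * r ^ n =
          (r ^ (2 * n)) ^ ((m : ℤ) - 2) * (r ^ (2 * n)) ^ (-((k : ℕ) : ℤ)) * (r ^ (2 * n)) ^ 2 := by
        rw [← zpow_natCast (r ^ (2 * n)), ← zpow_add₀ (hx n), ← zpow_add₀ (hx n), ← mul_pow,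
          zpow_neg, inv_inv, ← zpow_two_mul_pow, ← zpow_add_one₀ hr]
        congr 2; push_cast; ring
      have h4 : (r ^ (2 * n)) ^ 2 * (r ^ (2 * n)) ^ (-2 : ℤ) = 1 := by
        rw [← zpow_natCast (r ^ (2 * n)), ← zpow_add₀ (hx n)]; simp
      rw [vStarTilde, if_neg h1, if_neg h2, hpn]
      linear_combination (-((1 - t ^ n) / n * (1 - (r ^ (2 * n)) ^ (-2 : ℤ)))) * h3 +
        (1 - t ^ n) / n * ((r ^ (2 * n)) ^ ((m : ℤ) - 2) * (r ^ (2 * n)) ^ (-((k : ℕ) : ℤ))) * h4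

/-- The exponents of `Λ_i^*`. -/
theorem lambdaStar_eq (q t : K) {r : K} (hr : r ≠ 0) (hp : r ^ 4 = q / t) (i : Fin m) :
    lambdaStar q t r i = vop q t
      (fun k n => -((1 - t ^ (-(n : ℤ))) / n * uStar (r ^ (2 * n)) m i k))
      (fun k n => (1 - t ^ n) / n * vStar (r ^ (2 * n)) m i k) := by
  have hx : ∀ n : ℕ, r ^ (2 * n) ≠ 0 := fun n => pow_ne_zero _ hr
  have hpn : ∀ n : ℕ, (q / t)⁻¹ ^ n = (r ^ (2 * n)) ^ (-2 : ℤ) := fun n => by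
    rw [← hp, ← zpow_natCast, ← zpow_natCast, ← zpow_natCast, ← zpow_neg_one, ← zpow_mul,
      ← zpow_mul, ← zpow_mul]
    congr 1; push_cast; ring
  rw [lambdaStar, lambdaTildeStar_eq q t hr hp, rhoAlpha_eq, rhoBeta_eq, scale_cre,
    scale_vop, scale_ann, ← ann_zero q t, ← cre_zero q t]
  change vop _ _ _ _ * _ * vop _ _ _ _ = _
  rw [← vop_add, ← vop_add]
  refine vop_congr q t (fun n _ k => ?_) fun n _ k => ?_
  · simp only [Pi.add_apply, Pi.zero_apply, uStar]
    have h1 : (r ^ (2 * n)) ^ ((m : ℤ) - 3 - (k : ℕ)) =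
        (r ^ (2 * n)) ^ (-2 : ℤ) * (r ^ (2 * n)) ^ ((m : ℤ) - 1 - (k : ℕ)) := by
      rw [← zpow_add₀ (hx n)]; congr 1; ring
    have h2 : (r ^ (2 * n)) ^ (((k : ℕ) : ℤ) - 2) =
        (r ^ (2 * n)) ^ ((m : ℤ) - 2) * (r ^ (2 * n)) ^ (((k : ℕ) : ℤ) - m) := by
      rw [← zpow_add₀ (hx n)]; congr 1; ring
    rw [zpow_two_mul_pow, hpn, h1, h2]
    split_ifs <;> ring
  · simp only [Pi.add_apply, Pi.zero_apply, vStar]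
    have h1 : ((levelGamma r m)⁻¹ ^ 2 * (q / t)⁻¹)⁻¹ ^ n =
        (r ^ (2 * n)) ^ (2 - 2 * (m : ℤ)) := by
      rw [inv_pow, mul_pow, hpn, ← pow_mul, inv_pow, Nat.mul_comm 2 n, pow_mul _ n 2, levelGamma_pow,
        Nat.mul_comm n 2,
        mul_inv, inv_inv, ← zpow_natCast, ← zpow_mul, ← zpow_neg, ← zpow_add₀ (hx n)]
      congr 1; push_cast; ring
    have h2 : (r ^ (2 * n)) ^ (1 - (m : ℤ) - (k : ℕ)) =
        (r ^ (2 * n)) ^ (2 - 2 * (m : ℤ)) * (r ^ (2 * n)) ^ ((m : ℤ) - 1 - (k : ℕ)) := by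
      rw [← zpow_add₀ (hx n)]; congr 1; ring
    have h3 : (r ^ (2 * n)) ^ (-((m : ℤ) - 2)) * (r ^ (2 * n)) ^ ((m : ℤ) - 2) = 1 := by
      rw [← zpow_add₀ (hx n), neg_add_cancel, zpow_zero]
    rw [← zpow_neg, ← mul_neg, zpow_two_mul_pow, h1, h2]
    linear_combination ((1 - t ^ n) / n * vStarTilde (r ^ (2 * n)) i k) * h3

end Images

/-! ### Images of the generating currents -/

section Currents

variable {K : Type*} [Field K] {m : ℕ}

theorem scaleLow_mul (ζ : K) (D E : lowering K m) :
    scaleLow ζ (D * E) = scaleLow ζ D * scaleLow ζ E :=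
  Subtype.ext (scaleSeries_mul ζ⁻¹ D.1 E.1)

theorem scaleLow_one (ζ : K) : scaleLow ζ (1 : lowering K m) = 1 :=
  Subtype.ext (scaleSeries_one ζ⁻¹)

theorem scaleLow_scaleLow (a b : K) (D : lowering K m) :
    scaleLow a (scaleLow b D) = scaleLow (a * b) D :=
  Subtype.ext ((scaleSeries_scaleSeries a⁻¹ b⁻¹ D.1).trans (by rw [← mul_inv]; rfl))

theorem one_scaleLow (D : lowering K m) : scaleLow 1 D = D :=
  Subtype.ext (by
    change scaleSeries (1 : K)⁻¹ D.1 = D.1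
    rw [inv_one]
    exact one_scaleSeries D.1)

/-- Rescaling of the variable, as a homomorphism of normally ordered operators. -/
def Ordered.scaleHom (ζ : K) : Ordered K m →* Ordered K m where
  toFun := Ordered.scale ζ
  map_one' := Prod.ext (scaleSeries_one ζ) (scaleLow_one ζ)
  map_mul' S T := Prod.ext (scaleSeries_mul ζ S.1 T.1) (scaleLow_mul ζ S.2 T.2)

theorem Ordered.scale_scale (a b : K) (S : Ordered K m) :
    (S.scale b).scale a = S.scale (a * b) :=
  Prod.ext (scaleSeries_scaleSeries a b S.1) (scaleLow_scaleLow a b S.2)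

theorem Ordered.scale_one_left (S : Ordered K m) : S.scale 1 = S :=
  Prod.ext (one_scaleSeries S.1) (one_scaleLow S.2)

theorem Ordered.one_scale (ζ : K) : (1 : Ordered K m).scale ζ = 1 :=
  (Ordered.scaleHom ζ).map_one

theorem Ordered.scale_prod_ofFn (ζ : K) {n : ℕ} (f : Fin n → Ordered K m) :
    (List.ofFn f).prod.scale ζ = (List.ofFn fun k => (f k).scale ζ).prod := by
  change Ordered.scaleHom ζ _ = _
  rw [map_list_prod, List.map_ofFn]
  rfl

theorem lmulField_sum {ι : Type*} (s : Finset ι) (C : PowerSeries (Op K m)) (c : ι → K)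
    (A : ι → VertexOperator K (FockT K m)) :
    lmulField C (∑ i ∈ s, c i • A i) = ∑ i ∈ s, c i • lmulField C (A i) := by
  change lmulLin C _ = _
  simp only [map_sum, map_smul]
  rfl

theorem rmulField_sum {ι : Type*} (s : Finset ι) (D : lowering K m) (c : ι → K)
    (A : ι → VertexOperator K (FockT K m)) :
    rmulField (∑ i ∈ s, c i • A i) D = ∑ i ∈ s, c i • rmulField (A i) D := by
  change rmulLin D _ = _
  simp only [map_sum, map_smul]
  rfl

theorem scaleField_sum {ι : Type*} (s : Finset ι) (ζ : K) (c : ι → K)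
    (A : ι → VertexOperator K (FockT K m)) :
    scaleField ζ (∑ i ∈ s, c i • A i) = ∑ i ∈ s, c i • scaleField ζ (A i) := by
  change scaleLin ζ _ = _
  simp only [map_sum, map_smul]
  rfl

/-- Each step of the fold rescales everything built from later components, so component k is
rescaled k times. The summand that chooses `e i` has passed through `φ k` for every k < i and never
meets the components after i. -/
theorem foldr_field {ζ : K} (hζ : ζ ≠ 0) {n : ℕ} (φ : Fin n → PowerSeries (Op K m))
    (e : Fin n → Ordered K m) (c : Fin n → K) :
    (List.finRange n).foldr
        (fun k X => c k • (e k).field + lmulField (φ k) (scaleField ζ X)) 0 =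
      ∑ i, c i • Ordered.field (List.ofFn fun k : Fin n =>
        if k < i then ((scaleSeries (ζ ^ (k : ℕ)) (φ k), 1) : Ordered K m)
        else if k = i then (e k).scale (ζ ^ (i : ℕ)) else 1).prod := by
  induction n with
  | zero => simp
  | succ n ih =>
    rw [List.finRange_succ, List.foldr_cons, List.foldr_map,
      ih (fun k => φ k.succ) (fun k => e k.succ) (fun k => c k.succ), Fin.sum_univ_succ,
      scaleField_sum, lmulField_sum]
    congr 1
    · congr 2
      rw [List.ofFn_succ, List.prod_cons, if_neg (lt_irrefl _), if_pos rfl, Fin.val_zero, pow_zero,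
        Ordered.scale_one_left, List.prod_eq_one, mul_one]
      intro S hS
      rw [List.mem_ofFn] at hS
      obtain ⟨k, rfl⟩ := hS
      rw [if_neg (Fin.not_lt_zero _), if_neg (Fin.succ_ne_zero _)]
    · refine Finset.sum_congr rfl fun i _ => ?_
      rw [scaleField_field hζ, lmulField_field, Ordered.scale_prod_ofFn, List.ofFn_succ,
        List.prod_cons, if_pos (Fin.succ_pos i), Fin.val_zero, pow_zero]
      congr 3
      · exact Prod.ext (one_scaleSeries (φ 0)).symm rfl
      · congr 2
        funext k
        simp only [Fin.succ_lt_succ_iff, Fin.succ_inj, Fin.val_succ]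
        split_ifs
        · refine Prod.ext ?_ (scaleLow_one ζ)
          exact (scaleSeries_scaleSeries ζ (ζ ^ (k : ℕ)) (φ k.succ)).trans (by rw [pow_succ'])
        · rw [Ordered.scale_scale, pow_succ']
        · exact Ordered.one_scale ζ

/-- Mirror image of `foldr_field`: the induction peels off the last component, and component k is
rescaled once for each later one. -/
theorem foldl_field {ζ : K} (hζ : ζ ≠ 0) {n : ℕ} (D : Fin n → lowering K m)
    (e : Fin n → Ordered K m) (c : Fin n → K) :
    (List.finRange n).foldl
        (fun X k => rmulField (scaleField ζ X) (D k) + c k • (e k).field) 0 =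
      ∑ i, c i • Ordered.field (List.ofFn fun k : Fin n =>
        if k < i then (1 : Ordered K m)
        else if k = i then (e k).scale (ζ ^ (n - 1 - (i : ℕ)))
        else (1, scaleLow (ζ ^ (n - 1 - (k : ℕ))) (D k))).prod := by
  induction n with
  | zero => simp
  | succ n ih =>
    rw [List.finRange_succ_last, List.foldl_append, List.foldl_map,
      ih (fun k => D k.castSucc) (fun k => e k.castSucc) (fun k => c k.castSucc),
      Fin.sum_univ_castSucc, List.foldl_cons, List.foldl_nil, scaleField_sum, rmulField_sum]
    congr 1
    · refine Finset.sum_congr rfl fun i _ => ?_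
      rw [scaleField_field hζ, rmulField_field, Ordered.scale_prod_ofFn, List.ofFn_succ_last,
        List.prod_append, List.prod_singleton, if_neg (by simp [Fin.le_last]),
        if_neg (Fin.castSucc_lt_last i).ne', Fin.val_last]
      congr 3
      · congr 2
        funext k
        have hk := k.isLt
        simp only [Fin.castSucc_lt_castSucc_iff, Fin.castSucc_inj, Fin.val_castSucc]
        have h1 : ∀ j : Fin n, ζ * ζ ^ (n - 1 - (j : ℕ)) = ζ ^ (n + 1 - 1 - (j : ℕ)) := fun j => by
          rw [← pow_succ']; congr 1; omega
        split_ifs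
        · exact Ordered.one_scale ζ
        · rw [Ordered.scale_scale, h1]
        · refine Prod.ext (scaleSeries_one ζ) ?_
          exact (scaleLow_scaleLow _ _ _).trans (by rw [h1])
      · rw [Nat.add_sub_cancel, Nat.sub_self, pow_zero, one_scaleLow]
    · congr 2
      rw [List.ofFn_succ_last, List.prod_append, List.prod_singleton, if_neg (lt_irrefl _),
        if_pos rfl, Fin.val_last, Nat.add_sub_cancel, Nat.sub_self, pow_zero,
        Ordered.scale_one_left, List.prod_eq_one, one_mul]
      intro S hS
      rw [List.mem_ofFn] at hS
      obtain ⟨k, rfl⟩ := hS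
      rw [if_pos (Fin.castSucc_lt_last k)]

theorem rhoXPlus_eq (q t : K) {r : K} (hr : r ≠ 0) (y : Fin m → Kˣ) :
    rhoXPlus q t r y = ∑ i, (y i : K) • (lambdaTilde q t r i).field := by
  rw [rhoXPlus, foldr_field (pow_ne_zero 2 (inv_ne_zero hr))
    (fun k => scaleSeries r⁻¹ (phiMinus q t r k)) (fun k => eta q t k) fun k => (y k : K)]
  refine Finset.sum_congr rfl fun i _ => ?_
  rw [lambdaTilde, ← List.ofFn_eq_map]
  congr 4
  funext k
  have h1 : ∀ j : ℕ, (r⁻¹ ^ 2) ^ j = r ^ (-2 * (j : ℤ)) := fun j => by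
    rw [← pow_mul, inv_pow, ← zpow_natCast, ← zpow_neg, neg_mul, Nat.cast_mul, Nat.cast_ofNat]
  have h2 : (r⁻¹ ^ 2) ^ (k : ℕ) * r⁻¹ = r ^ (-(2 * ((k : ℕ) : ℤ) + 1)) := by
    rw [h1, ← zpow_neg_one, ← zpow_add₀ hr]; congr 1; ring
  split_ifs
  · exact Prod.ext ((scaleSeries_scaleSeries _ _ _).trans (by rw [h2])) rfl
  · rw [h1]
  · rfl

theorem rhoXMinus_eq (q t : K) {r : K} (hr : r ≠ 0) (y : Fin m → Kˣ) :
    rhoXMinus q t r y = ∑ i, ((y i : K)⁻¹) • (lambdaTildeStar q t r i).field := by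
  rw [rhoXMinus, foldl_field (pow_ne_zero 2 (inv_ne_zero hr))
    (fun k => scaleLow r⁻¹ (phiPlus q t r k)) (fun k => xi q t r k) fun k => ((y k : K)⁻¹)]
  refine Finset.sum_congr rfl fun i _ => ?_
  rw [lambdaTildeStar, ← List.ofFn_eq_map]
  congr 4
  funext k
  have h1 : ∀ j : Fin m, (r⁻¹ ^ 2) ^ (m - 1 - (j : ℕ)) = r ^ (-2 * ((m : ℤ) - 1 - (j : ℕ))) :=
    fun j => by
      have := j.isLt
      rw [← pow_mul, inv_pow, ← zpow_natCast, ← zpow_neg]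
      congr 1; push_cast; omega
  have h2 : (r⁻¹ ^ 2) ^ (m - 1 - (k : ℕ)) * r⁻¹ = r ^ (-(2 * ((m : ℤ) - 1 - (k : ℕ)) + 1)) := by
    rw [h1, ← zpow_neg_one, ← zpow_add₀ hr]; congr 1; ring
  split_ifs
  · rfl
  · rw [h1]
  · exact Prod.ext rfl ((scaleLow_scaleLow _ _ _).trans (by rw [h2]))

theorem tOne_eq (q t : K) {r : K} (hr : r ≠ 0) (y : Fin m → Kˣ) :
    tOne q t r y = ∑ i, (y i : K) • (lambda q t r i).field := by
  rw [tOne, rhoXPlus_eq q t hr, rmulField_sum, lmulField_sum]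
  simp only [rmulField_field, lmulField_field, lambda, mul_assoc]

theorem tOneStar_eq (q t : K) {r : K} (hr : r ≠ 0) (hp : r ^ 4 = q / t) (y : Fin m → Kˣ) :
    tOneStar q t r y = ∑ i, ((y i : K)⁻¹) • (lambdaStar q t r i).field := by
  -- The shift p⁻¹ γ⁻¹ in t^* equals p^((m-2)/2), the scale in Λ_i^*.
  have h1 : (q / t)⁻¹ * (levelGamma r m)⁻¹ = r ^ (2 * ((m : ℤ) - 2)) := by
    rw [levelGamma, ← hp, ← pow_mul, inv_pow, inv_inv, ← zpow_natCast, ← zpow_natCast, ← zpow_neg,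
      ← zpow_add₀ hr]
    congr 1; push_cast; ring
  rw [tOneStar, rhoXMinus_eq q t hr, h1, scaleField_sum, rmulField_sum, lmulField_sum]
  simp only [scaleField_field (zpow_ne_zero _ hr), rmulField_field, lmulField_field, lambdaStar,
    mul_assoc]

end Currents

/-! ### Nondegeneracy -/

section Nondegeneracy

variable {K : Type*} [Field K] [CharZero K] {q t : K}

theorem ne_zero_of_algebraicIndependent (h : AlgebraicIndependent ℚ ![q, t]) : q ≠ 0 ∧ t ≠ 0 :=
  ⟨h.ne_zero 0, h.ne_zero 1⟩

theorem pow_ne_one_of_algebraicIndependent (h : AlgebraicIndependent ℚ ![q, t]) {n : ℕ}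
    (hn : n ≠ 0) : t ^ n ≠ 1 := by
  intro h1
  refine h.transcendental 1 ⟨Polynomial.X ^ n - 1, Polynomial.X_pow_sub_C_ne_zero
    (Nat.pos_of_ne_zero hn) (1 : ℚ), ?_⟩
  simp [h1]

theorem div_pow_ne_one_of_algebraicIndependent (h : AlgebraicIndependent ℚ ![q, t]) {n : ℕ}
    (hn : n ≠ 0) : (q / t) ^ n ≠ 1 := by
  intro h1
  have ht := (ne_zero_of_algebraicIndependent h).2
  rw [div_pow, div_eq_one_iff_eq (pow_ne_zero n ht)] at h1
  have h2 : (MvPolynomial.X 0 ^ n : MvPolynomial (Fin 2) ℚ) = MvPolynomial.X 1 ^ n :=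
    h (by simpa using h1)
  -- Evaluation at (0, 1) refutes the polynomial identity.
  have h3 := congrArg (MvPolynomial.eval ![(0 : ℚ), 1]) h2
  simp [hn] at h3

end Nondegeneracy

/-! ### Exponents of the structure function -/

section Structure

variable {K : Type*} [Field K] {m : ℕ}

theorem div_pow_pow {q t r : K} (hp : r ^ 4 = q / t) (i n : ℕ) :
    ((q / t) ^ i) ^ n = (r ^ (2 * n)) ^ (2 * (i : ℤ)) := by
  rw [← hp, ← zpow_natCast, ← zpow_natCast, ← zpow_natCast, ← zpow_natCast, ← zpow_mul, ← zpow_mul,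
    ← zpow_mul]
  congr 1; push_cast; ring

theorem inv_div_pow_pow {q t r : K} (hp : r ^ 4 = q / t) (i n : ℕ) :
    (((q / t) ^ i)⁻¹) ^ n = (r ^ (2 * n)) ^ (-2 * (i : ℤ)) := by
  rw [inv_pow, div_pow_pow hp, neg_mul, zpow_neg]

theorem fSeries_exponent {q t r : K} (hp : r ^ 4 = q / t) (m n : ℕ) :
    ((q / t) ^ ((((1 : ℕ) : ℤ) - 1) * n) - (q / t) ^ (((m : ℤ) - 1) * n)) /
      (1 - (q / t) ^ (m * n)) =
        (1 - (r ^ (2 * n)) ^ (2 * (m : ℤ) - 2)) / (1 - (r ^ (2 * n)) ^ (2 * (m : ℤ))) := by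
  have h1 : (q / t) ^ (((m : ℤ) - 1) * n) = (r ^ (2 * n)) ^ (2 * (m : ℤ) - 2) := by
    rw [← hp, ← zpow_natCast, ← zpow_natCast, ← zpow_mul, ← zpow_mul]
    congr 1; push_cast; ring
  have h2 : (q / t) ^ (m * n) = (r ^ (2 * n)) ^ (2 * (m : ℤ)) := by
    rw [← hp, ← zpow_natCast, ← zpow_natCast, ← zpow_natCast, ← zpow_mul, ← zpow_mul]
    congr 1; push_cast; ring
  rw [h1, h2, Nat.cast_one, sub_self, zero_mul, zpow_zero]

theorem fSeries_exponent_eq {x : K} (hx : x ≠ 0) (hm : x ^ (2 * m) ≠ 1) :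
    (1 - x ^ (2 * (m : ℤ) - 2)) / (1 - x ^ (2 * (m : ℤ))) =
      1 + wCoeff x m * x ^ ((m : ℤ) - 1) := by
  have h : 1 - x ^ (2 * (m : ℤ)) ≠ 0 := sub_ne_zero.mpr fun h => hm (by
    rw [h, ← zpow_natCast]; congr 1)
  have h1 := wCoeff_eq hx hm
  have h2 : x ^ ((m : ℤ) - 1) * x ^ ((m : ℤ) - 1) = x ^ (2 * (m : ℤ) - 2) := by
    rw [← zpow_add₀ hx]; congr 1; ring
  have h3 : x ^ (2 * (m : ℤ) - 2) * x ^ 2 = x ^ (2 * (m : ℤ)) := by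
    rw [← zpow_natCast, ← zpow_add₀ hx]; congr 1; push_cast; ring
  rw [div_eq_iff h]
  linear_combination x ^ ((m : ℤ) - 1) * h1 - (x ^ 2 - 1) * h2 - h3

/-- The quantity of `fSeries_exponent_eq` in a second form, whose `wCoeff` term matches that of
`sum_vStar_mul_uStar`. -/
theorem fSeries_exponent_eq_star {x : K} (hx : x ≠ 0) (hm : x ^ (2 * m) ≠ 1) :
    (1 - x ^ (2 * (m : ℤ) - 2)) / (1 - x ^ (2 * (m : ℤ))) =
      x ^ (-2 : ℤ) + wCoeff x m * x ^ (-1 - (m : ℤ)) := by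
  have h : 1 - x ^ (2 * (m : ℤ)) ≠ 0 := sub_ne_zero.mpr fun h => hm (by
    rw [h, ← zpow_natCast]; congr 1)
  have h1 := wCoeff_eq hx hm
  have h2 : x ^ ((m : ℤ) - 1) * x ^ (-1 - (m : ℤ)) = x ^ (-2 : ℤ) := by
    rw [← zpow_add₀ hx]; congr 1; ring
  have h3 : x ^ (-2 : ℤ) * x ^ (2 * (m : ℤ)) = x ^ (2 * (m : ℤ) - 2) := by
    rw [← zpow_add₀ hx, neg_add_eq_sub]
  have h4 : x ^ (-2 : ℤ) * x ^ 2 = 1 := by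
    rw [← zpow_natCast x 2, ← zpow_add₀ hx]; simp
  rw [div_eq_iff h]
  linear_combination x ^ (-1 - (m : ℤ)) * h1 - (x ^ 2 - 1) * h2 - h4 + h3

theorem expLog_congr {c d : ℕ → K} (h : ∀ n, n ≠ 0 → c n = d n) : expLog c = expLog d := by
  rw [expLog, expLog, posSeries_congr fun n hn => ?_]
  rw [h n hn]

theorem expLog_zero : expLog (0 : ℕ → K) = 1 := by
  rw [expLog, ← expSeries_zero (K := K), ← posSeries_zero]
  congr 2
  funext n
  simp

end Structure

section Embeddings

variable {K : Type*} [Field K] {m : ℕ}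

/-! ### Sums over order embeddings -/

theorem bijective_eval_zero : Function.Bijective fun j : Fin 1 ↪o Fin m => j 0 := by
  refine ⟨fun j j' h => ?_, fun k => ⟨OrderEmbedding.ofStrictMono (fun _ => k)
    (Subsingleton.strictMono _), rfl⟩⟩
  ext a
  rw [Subsingleton.elim a 0]
  exact congrArg Fin.val h

/-- T_1, defined through the representation, agrees with the general sum. This lets T_{m-1} be
treated uniformly, including m = 2. -/
theorem tCurrent_eq (q t : K) {r : K} (hr : r ≠ 0) (y : Fin m → Kˣ) (i : ℕ) :
    tCurrent q t r y i = ∑ j : Fin i ↪o Fin m, (∏ a, (y (j a) : K)) •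
      (List.ofFn fun a : Fin i => (lambda q t r (j a)).scale ((q / t) ^ (a : ℕ))).prod.field := by
  rw [tCurrent]
  split_ifs with h
  · subst h
    rw [tOne_eq q t hr]
    refine (Fintype.sum_bijective _ bijective_eval_zero _ _ fun j => ?_).symm
    simp [Ordered.scale_one_left]
  · rfl

theorem orderEmbedding_eq_refl (j : Fin m ↪o Fin m) : j = RelEmbedding.refl _ := by
  have h := (j.strictMono.range_inj (strictMono_id (α := Fin m))).mp (by
    rw [Set.range_id, (Finite.injective_iff_surjective.mp j.injective).range_eq])
  exact DFunLike.coe_injective h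

theorem sum_orderEmbedding_self {M : Type*} [AddCommMonoid M] (f : (Fin m ↪o Fin m) → M) :
    ∑ j, f j = f (RelEmbedding.refl _) :=
  Finset.sum_eq_single_of_mem _ (Finset.mem_univ _) fun j _ hj =>
    absurd (orderEmbedding_eq_refl j) hj

/-- By counting, an embedding misses some k. Factored through `succAbove k` it becomes an order
embedding of `Fin n` into itself, hence the identity. -/
theorem bijective_succAboveOrderEmb (n : ℕ) :
    Function.Bijective (Fin.succAboveOrderEmb : Fin (n + 1) → Fin n ↪o Fin (n + 1)) := by
  refine ⟨fun k k' h => Fin.succAbove_left_injective (congrArg DFunLike.coe h), fun j => ?_⟩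
  obtain ⟨k, hk⟩ : ∃ k, ∀ a, j a ≠ k := by
    by_contra! h
    simpa using Fintype.card_le_of_surjective j h
  choose b hb using fun a => Fin.exists_succAbove_eq (hk a)
  have hmono : StrictMono b := fun a a' h => by
    rw [← k.succAboveOrderEmb.lt_iff_lt, Fin.succAboveOrderEmb_apply, Fin.succAboveOrderEmb_apply,
      hb, hb]
    exact j.strictMono h
  refine ⟨k, DFunLike.ext _ _ fun a => ?_⟩
  have h1 : b a = a :=
    congrArg (fun e : Fin n ↪o Fin n => e a) (orderEmbedding_eq_refl (OrderEmbedding.ofStrictMono b hmono))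
  rw [Fin.succAboveOrderEmb_apply, ← hb a, h1]

end Embeddings

/-! ### Products of the currents -/

section Main

variable {K : Type*} [Field K] [CharZero K] {m : ℕ}

theorem prod_lambda_eq (q t : K) {r : K} (hr : r ≠ 0) (hp : r ^ 4 = q / t) {N : ℕ}
    (σ : Fin N → Fin m) (c : Fin N → K) :
    (List.ofFn fun a => (lambda q t r (σ a)).scale (c a)).prod = vop q t
      (fun k n => (1 - t ^ (-(n : ℤ))) / n * ∑ a, c a ^ n * uCoeff (r ^ (2 * n)) m (σ a) k)
      (fun k n => -((1 - t ^ n) / n * ∑ a, (c a)⁻¹ ^ n * vCoeff (r ^ (2 * n)) m (σ a) k)) := by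
  simp only [lambda_eq q t hr hp, scale_vop]
  rw [prod_ofFn_vop]
  refine vop_congr q t (fun n _ k => ?_) fun n _ k => ?_
  · rw [Finset.sum_apply, Finset.sum_apply, Finset.mul_sum]
    exact Finset.sum_congr rfl fun a _ => by ring
  · rw [Finset.sum_apply, Finset.sum_apply, Finset.mul_sum, ← Finset.sum_neg_distrib]
    exact Finset.sum_congr rfl fun a _ => by ring

theorem prod_lambdaStar_eq (q t : K) {r : K} (hr : r ≠ 0) (hp : r ^ 4 = q / t) {N : ℕ}
    (σ : Fin N → Fin m) (c : Fin N → K) :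
    (List.ofFn fun a => (lambdaStar q t r (σ a)).scale (c a)).prod = vop q t
      (fun k n => -((1 - t ^ (-(n : ℤ))) / n * ∑ a, c a ^ n * uStar (r ^ (2 * n)) m (σ a) k))
      (fun k n => (1 - t ^ n) / n * ∑ a, (c a)⁻¹ ^ n * vStar (r ^ (2 * n)) m (σ a) k) := by
  simp only [lambdaStar_eq q t hr hp, scale_vop]
  rw [prod_ofFn_vop]
  refine vop_congr q t (fun n _ k => ?_) fun n _ k => ?_
  · rw [Finset.sum_apply, Finset.sum_apply, Finset.mul_sum, ← Finset.sum_neg_distrib]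
    exact Finset.sum_congr rfl fun a _ => by ring
  · rw [Finset.sum_apply, Finset.sum_apply, Finset.mul_sum]
    exact Finset.sum_congr rfl fun a _ => by ring

theorem pow_two_mul_ne_one {q t r : K} (hqt : AlgebraicIndependent ℚ ![q, t]) (hp : r ^ 4 = q / t)
    {n : ℕ} (hn : n ≠ 0) (hm : m ≠ 0) : (r ^ (2 * n)) ^ (2 * m) ≠ 1 := by
  rw [← pow_mul, show 2 * n * (2 * m) = 4 * (n * m) by ring, pow_mul, hp]
  exact div_pow_ne_one_of_algebraicIndependent hqt (mul_ne_zero hn hm)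

theorem root_ne_zero {q t r : K} (hqt : AlgebraicIndependent ℚ ![q, t]) (hp : r ^ 4 = q / t) :
    r ≠ 0 := by
  rintro rfl
  have h := ne_zero_of_algebraicIndependent hqt
  exact div_ne_zero h.1 h.2 (by rw [← hp]; simp)

theorem prod_lambda_eq_one {q t r : K} (hqt : AlgebraicIndependent ℚ ![q, t])
    (hp : r ^ 4 = q / t) (hm : m ≠ 0) :
    (List.ofFn fun i : Fin m => (lambda q t r i).scale ((q / t) ^ (i : ℕ))).prod = 1 := by
  have hr := root_ne_zero hqt hp
  rw [prod_lambda_eq q t hr hp (fun i => i), ← vop_zero q t]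
  refine vop_congr q t (fun n hn k => ?_) fun n hn k => ?_
  · simp only [div_pow_pow hp]
    rw [Fin.sum_univ_eq_sum_range fun i => (r ^ (2 * n)) ^ (2 * (i : ℤ)) *
      uCoeff (r ^ (2 * n)) m i k,
      sum_uCoeff (pow_ne_zero _ hr) (pow_two_mul_ne_one hqt hp hn hm) k.isLt, mul_zero]
    rfl
  · simp only [inv_div_pow_pow hp]
    rw [Fin.sum_univ_eq_sum_range fun i => (r ^ (2 * n)) ^ (-2 * (i : ℤ)) *
      vCoeff (r ^ (2 * n)) m i k,
      sum_vCoeff (pow_ne_zero _ hr) (pow_two_mul_ne_one hqt hp hn hm) k.isLt, mul_zero, neg_zero]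
    rfl

theorem prod_lambdaStar_eq_one {q t r : K} (hqt : AlgebraicIndependent ℚ ![q, t])
    (hp : r ^ 4 = q / t) (hm : m ≠ 0) :
    (List.ofFn fun i : Fin m => (lambdaStar q t r i).scale ((q / t)⁻¹ ^ (i : ℕ))).prod = 1 := by
  have hr := root_ne_zero hqt hp
  rw [prod_lambdaStar_eq q t hr hp (fun i => i), ← vop_zero q t]
  refine vop_congr q t (fun n hn k => ?_) fun n hn k => ?_
  · simp only [inv_pow (q / t), inv_div_pow_pow hp]
    rw [Fin.sum_univ_eq_sum_range fun i => (r ^ (2 * n)) ^ (-2 * (i : ℤ)) *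
      uStar (r ^ (2 * n)) m i k,
      sum_uStar (pow_ne_zero _ hr) (pow_two_mul_ne_one hqt hp hn hm) k.isLt, mul_zero, neg_zero]
    rfl
  · simp only [inv_pow (q / t), inv_inv, div_pow_pow hp]
    rw [Fin.sum_univ_eq_sum_range fun i => (r ^ (2 * n)) ^ (2 * (i : ℤ)) *
      vStar (r ^ (2 * n)) m i k,
      sum_vStar (pow_ne_zero _ hr) (pow_two_mul_ne_one hqt hp hn hm) k.isLt, mul_zero]
    rfl

/-- `Λ_k^*` as a product over the indices different from `k`. -/
theorem prod_lambda_succAbove {n : ℕ} {q t r : K} (hqt : AlgebraicIndependent ℚ ![q, t])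
    (hp : r ^ 4 = q / t) (k : Fin (n + 1)) :
    (List.ofFn fun a : Fin n =>
      (lambda q t r (k.succAbove a)).scale ((q / t) ^ (a : ℕ))).prod = lambdaStar q t r k := by
  have hr := root_ne_zero hqt hp
  have hweight : ∀ (x : K) (a : Fin n),
      x ^ (2 * ((a : ℕ) : ℤ)) = omitWeight x k (k.succAbove a) := by
    intro x a
    rw [omitWeight]
    rcases lt_or_ge a.castSucc k with h | h
    · rw [Fin.succAbove_of_castSucc_lt _ _ h, if_pos (Fin.lt_def.mp h), Fin.val_castSucc]
    · have h1 : (k : ℕ) ≤ a := h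
      rw [Fin.succAbove_of_le_castSucc _ _ h, Fin.val_succ, if_neg (by omega), if_neg (by omega)]
      congr 1; push_cast; ring
  -- The weight at the omitted index is 0, so the sum extends to all indices.
  have hsum : ∀ (x : K) (f : ℕ → K),
      ∑ a : Fin n, omitWeight x k (k.succAbove a) * f (k.succAbove a) =
        ∑ i ∈ Finset.range (n + 1), omitWeight x k i * f i := by
    intro x f
    rw [← Fin.sum_univ_eq_sum_range (fun i => omitWeight x k i * f i),
      Fin.sum_univ_succAbove _ k]
    have : omitWeight x k k = 0 := by rw [omitWeight, if_neg (lt_irrefl _), if_pos rfl]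
    rw [this, zero_mul, zero_add]
  rw [prod_lambda_eq q t hr hp, lambdaStar_eq q t hr hp]
  refine vop_congr q t (fun N hN s => ?_) fun N hN s => ?_
  · simp only [div_pow_pow hp, hweight]
    rw [hsum _ fun i => uCoeff (r ^ (2 * N)) (n + 1) i s,
      sum_omitWeight_uCoeff (pow_ne_zero _ hr)
        (pow_two_mul_ne_one hqt hp hN n.succ_ne_zero) k.isLt s.isLt, mul_neg]
  · have hinv : ∀ a : Fin n, (((q / t) ^ (a : ℕ))⁻¹) ^ N =
        omitWeight (r ^ (2 * N))⁻¹ k (k.succAbove a) := fun a => by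
      rw [← hweight, inv_div_pow_pow hp, neg_mul, zpow_neg, inv_zpow]
    simp only [hinv]
    rw [hsum _ fun i => vCoeff (r ^ (2 * N)) (n + 1) i s,
      sum_omitWeight_vCoeff (pow_ne_zero _ hr)
        (pow_two_mul_ne_one hqt hp hN n.succ_ne_zero) k.isLt s.isLt, mul_neg, neg_neg]

theorem prod_ofFn_succAbove {M : Type*} [Monoid M] {n : ℕ} (f : Fin (n + 1) → M) (k : Fin (n + 1))
    (hk : f k = 1) : (List.ofFn f).prod = (List.ofFn fun a => f (k.succAbove a)).prod := by
  induction n with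
  | zero =>
    obtain rfl : k = 0 := Fin.fin_one_eq_zero k
    simp [List.ofFn_succ, hk]
  | succ n ih =>
    rw [List.ofFn_succ, List.prod_cons]
    rcases Fin.eq_zero_or_eq_succ k with rfl | ⟨j, rfl⟩
    · rw [hk, one_mul]; rfl
    · rw [ih (fun i => f i.succ) j hk, List.ofFn_succ, List.prod_cons, Fin.succ_succAbove_zero]
      simp only [Fin.succ_succAbove_succ]

theorem lambdaStar_eq_prod {q t r : K} (hqt : AlgebraicIndependent ℚ ![q, t])
    (hp : r ^ 4 = q / t) (k : Fin m) :
    lambdaStar q t r k = (List.ofFn fun i : Fin m =>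
      if i < k then (lambda q t r i).scale ((q / t) ^ (i : ℕ))
      else if i = k then 1
      else (lambda q t r i).scale ((q / t) ^ ((i : ℕ) - 1))).prod := by
  obtain ⟨n, rfl⟩ := Nat.exists_eq_succ_of_ne_zero (Fin.pos k).ne'
  rw [prod_ofFn_succAbove _ k (by rw [if_neg (lt_irrefl _), if_pos rfl]),
    ← prod_lambda_succAbove hqt hp k]
  congr 2
  funext a
  rcases lt_or_ge a.castSucc k with h | h
  · rw [Fin.succAbove_of_castSucc_lt _ _ h, if_pos h, Fin.val_castSucc]
  · have h1 : k < a.succ := Fin.lt_def.mpr (Nat.lt_succ_of_le h)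
    rw [Fin.succAbove_of_le_castSucc _ _ h, if_neg h1.not_gt, if_neg h1.ne', Fin.val_succ,
      Nat.add_sub_cancel]

/-- Terms match under omitting one index k: the product of all y_i⁻¹ with the remaining y_i leaves
y_k⁻¹. -/
theorem tOneStar_eq_tCurrent {q t r : K} (hqt : AlgebraicIndependent ℚ ![q, t])
    (hp : r ^ 4 = q / t) (hm : m ≠ 0) (y : Fin m → Kˣ) :
    tOneStar q t r y = (∏ i, ((y i : K))⁻¹) • tCurrent q t r y (m - 1) := by
  obtain ⟨n, rfl⟩ := Nat.exists_eq_succ_of_ne_zero hm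
  have hr := root_ne_zero hqt hp
  rw [tOneStar_eq q t hr hp, tCurrent_eq q t hr, Finset.smul_sum]
  refine Fintype.sum_bijective _ (bijective_succAboveOrderEmb n) _ _ fun k => ?_
  have h1 : (∏ a, ((y (k.succAbove a) : K))⁻¹) * ∏ a, (y (k.succAboveOrderEmb a) : K) = 1 := by
    refine Eq.trans (Finset.prod_mul_distrib (f := fun a => ((y (k.succAbove a) : K))⁻¹)
      (g := fun a => (y (k.succAbove a) : K))).symm ?_
    exact Finset.prod_eq_one fun a _ => inv_mul_cancel₀ (y (k.succAbove a)).ne_zero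
  rw [smul_smul, Fin.prod_univ_succAbove _ k, mul_assoc]
  refine Eq.trans ?_ (congrArg (fun c => ((y k : K)⁻¹ * c) • _) h1).symm
  rw [mul_one, ← prod_lambda_succAbove hqt hp k]
  rfl

/-! ### Operator products of the currents -/

/-- The product of `f_{1,m}` and a contraction. -/
theorem fSeries_mul_contraction {q t r : K} (hqt : AlgebraicIndependent ℚ ![q, t])
    (hp : r ^ 4 = q / t) (A B : Fin m → ℕ → K) (κ : ℕ → K)
    (h : ∀ n : ℕ, n ≠ 0 → (1 - t ^ n) / n * ((1 - t ^ (-(n : ℤ))) / n) *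
      ((1 - (r ^ (2 * n)) ^ (2 * (m : ℤ) - 2)) / (1 - (r ^ (2 * n)) ^ (2 * (m : ℤ))) - κ n) +
        ∑ k, B k n * A k n = 0) :
    fSeries q t 1 m * contraction q t B A =
      expLog fun n => (1 - q ^ n) * (1 - t ^ (-(n : ℤ))) * κ n := by
  rw [fSeries, contraction, expSeries_posSeries_mul, expLog]
  congr 1
  refine posSeries_congr fun n hn => ?_
  have hn' : (n : K) ≠ 0 := Nat.cast_ne_zero.mpr hn
  have ht : 1 - t ^ n ≠ 0 :=
    sub_ne_zero.mpr (pow_ne_one_of_algebraicIndependent hqt hn).symm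
  have h1 := eq_neg_of_add_eq_zero_right (h n hn)
  -- The Heisenberg factor n (1 - q^n)/(1 - t^n) turns (1 - t^n)(1 - t^(-n))/n^2 into the prefactor
  -- of the exponent of f_{1,m}.
  rw [Pi.add_apply, h1, mul_assoc, mul_div_assoc, mul_div_assoc, fSeries_exponent hp]
  field_simp
  ring

/-- The second argument of `gammaPlus` is p. The exponent expands as 1 + p^(-n) - q^(-n) - (q
p⁻¹)^n, giving two linear factors below and two above. -/
theorem atRatio_expLog_gammaPlus {q t r : K} (hq : q ≠ 0) (ht : t ≠ 0) (hp : r ^ 4 = q / t) :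
    atRatio (expLog fun n => (1 - q ^ n) * (1 - t ^ (-(n : ℤ))) * (r ^ (2 * n)) ^ (-2 : ℤ)) =
      gammaPlus q (q / t) := by
  have h := atRatio_expLog 1 (q / t)⁻¹ q⁻¹ (q * (q / t)⁻¹)
  rw [one_smul] at h
  rw [gammaPlus, ← h]
  congr 1
  refine expLog_congr fun n _ => ?_
  have h1 : (r ^ (2 * n)) ^ (-2 : ℤ) = (q / t)⁻¹ ^ n := by
    rw [zpow_neg, inv_pow, ← hp, ← pow_mul]
    norm_cast
    rw [← pow_mul]
    congr 2; ring
  rw [h1, zpow_neg, zpow_natCast, inv_div, div_pow, mul_pow, div_pow, inv_pow, one_pow]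
  field_simp
  ring

/-- Here the expansion is 1 + p^n - q^n - (q⁻¹ p)^n, as q⁻¹ p = t⁻¹. -/
theorem atRatio_expLog_gammaMinus {q t : K} (hq : q ≠ 0) (ht : t ≠ 0) :
    atRatio (expLog fun n => (1 - q ^ n) * (1 - t ^ (-(n : ℤ))) * 1) =
      gammaMinus q (q / t) := by
  have h := atRatio_expLog 1 (q / t) q (q⁻¹ * (q / t))
  rw [one_smul] at h
  rw [gammaMinus, ← h]
  congr 1
  refine expLog_congr fun n _ => ?_
  rw [zpow_neg, zpow_natCast, mul_pow, div_pow, inv_pow, one_pow]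
  field_simp
  ring

theorem lambda_comp_lambda {q t r : K} (hqt : AlgebraicIndependent ℚ ![q, t])
    (hp : r ^ 4 = q / t) (hm : m ≠ 0) (i j : Fin m) (v : FockT K m) :
    atRatio (fSeries q t 1 m) •
        HVertexOperator.comp (lambda q t r i).field (lambda q t r j).field v =
      (if i = j then 1
        else if i < j then gammaPlus q (q / t)
        else gammaMinus q (q / t)) • ordered₂ (lambda q t r i) (lambda q t r j) v := by
  have hr := root_ne_zero hqt hp
  obtain ⟨hq, ht⟩ := ne_zero_of_algebraicIndependent hqt
  rw [lambda_eq q t hr hp, lambda_eq q t hr hp, comp_vop, smul_smul, ← map_mul]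
  congr 1
  -- The function supplied is 1 + c x^(m-1), with c = `wCoeff x m`, minus the bilinear sum of
  -- `sum_vCoeff_mul_uCoeff`.
  rw [fSeries_mul_contraction hqt hp _ _ (fun n => if i = j then 0
    else if i < j then (r ^ (2 * n)) ^ (-2 : ℤ) else 1)]
  · split_ifs with h1 h2
    · simp only [mul_zero]
      exact (congrArg atRatio expLog_zero).trans (map_one _)
    · exact atRatio_expLog_gammaPlus hq ht hp
    · exact atRatio_expLog_gammaMinus hq ht
  · intro n hn
    have hx : r ^ (2 * n) ≠ 0 := pow_ne_zero _ hr
    have hx2 := pow_two_mul_ne_one hqt hp hn hm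
    have h1 := sum_vCoeff_mul_uCoeff hx hx2 i.isLt j.isLt
    rw [← Fin.sum_univ_eq_sum_range
      fun k => vCoeff (r ^ (2 * n)) m i k * uCoeff (r ^ (2 * n)) m j k] at h1
    rw [fSeries_exponent_eq hx hx2]
    have h2 : ∀ k : Fin m, -((1 - t ^ n) / n * vCoeff (r ^ (2 * n)) m i k) *
        ((1 - t ^ (-(n : ℤ))) / n * uCoeff (r ^ (2 * n)) m j k) =
        -((1 - t ^ n) / n * ((1 - t ^ (-(n : ℤ))) / n)) *
          (vCoeff (r ^ (2 * n)) m i k * uCoeff (r ^ (2 * n)) m j k) := fun k => by ring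
    rw [Finset.sum_congr rfl fun k _ => h2 k, ← Finset.mul_sum, h1]
    simp only [Fin.ext_iff, Fin.lt_def]
    split_ifs <;> ring

theorem lambdaStar_comp_lambdaStar {q t r : K} (hqt : AlgebraicIndependent ℚ ![q, t])
    (hp : r ^ 4 = q / t) (hm : m ≠ 0) (i j : Fin m) (v : FockT K m) :
    atRatio (fSeries q t 1 m) •
        HVertexOperator.comp (lambdaStar q t r i).field (lambdaStar q t r j).field v =
      (if i = j then 1
        else if i < j then gammaMinus q (q / t)
        else gammaPlus q (q / t)) • ordered₂ (lambdaStar q t r i) (lambdaStar q t r j) v := by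
  have hr := root_ne_zero hqt hp
  obtain ⟨hq, ht⟩ := ne_zero_of_algebraicIndependent hqt
  rw [lambdaStar_eq q t hr hp, lambdaStar_eq q t hr hp, comp_vop, smul_smul, ← map_mul]
  congr 1
  -- Subtracting from x^(-2) exchanges the two off-diagonal values: x^(-2) - (x^(-2) - 1) = 1 for i
  -- < j, and x^(-2) for i > j.
  rw [fSeries_mul_contraction hqt hp _ _ (fun n => if i = j then 0
    else if i < j then 1 else (r ^ (2 * n)) ^ (-2 : ℤ))]
  · split_ifs with h1 h2
    · simp only [mul_zero]
      exact (congrArg atRatio expLog_zero).trans (map_one _)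
    · exact atRatio_expLog_gammaMinus hq ht
    · exact atRatio_expLog_gammaPlus hq ht hp
  · intro n hn
    have hx : r ^ (2 * n) ≠ 0 := pow_ne_zero _ hr
    have hx2 := pow_two_mul_ne_one hqt hp hn hm
    have h1 := sum_vStar_mul_uStar hx hx2 i.isLt j.isLt
    rw [← Fin.sum_univ_eq_sum_range
      fun k => vStar (r ^ (2 * n)) m i k * uStar (r ^ (2 * n)) m j k] at h1
    rw [fSeries_exponent_eq_star hx hx2]
    have h2 : ∀ k : Fin m, (1 - t ^ n) / n * vStar (r ^ (2 * n)) m i k *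
        -((1 - t ^ (-(n : ℤ))) / n * uStar (r ^ (2 * n)) m j k) =
        -((1 - t ^ n) / n * ((1 - t ^ (-(n : ℤ))) / n)) *
          (vStar (r ^ (2 * n)) m i k * uStar (r ^ (2 * n)) m j k) := fun k => by ring
    rw [Finset.sum_congr rfl fun k _ => h2 k, ← Finset.mul_sum, h1]
    simp only [Fin.ext_iff, Fin.lt_def]
    split_ifs <;> ring

theorem tCurrent_self {q t r : K} (hqt : AlgebraicIndependent ℚ ![q, t]) (hp : r ^ 4 = q / t)
    (hm : m ≠ 0) (y : Fin m → Kˣ) : tCurrent q t r y m = (∏ i, (y i : K)) • oneField K m := by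
  rw [tCurrent_eq q t (root_ne_zero hqt hp), sum_orderEmbedding_self, ← field_one,
    ← prod_lambda_eq_one hqt hp hm]
  rfl

theorem tCurrentStar_self {q t r : K} (hqt : AlgebraicIndependent ℚ ![q, t]) (hp : r ^ 4 = q / t)
    (hm : 2 ≤ m) (y : Fin m → Kˣ) :
    tCurrentStar q t r y m = (∏ i, ((y i : K))⁻¹) • oneField K m := by
  -- m ≥ 2 excludes the branch i = 1, where the current is defined through the representation.
  rw [tCurrentStar, if_neg (by omega), sum_orderEmbedding_self, ← field_one,
    ← prod_lambdaStar_eq_one hqt hp (by omega)]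
  rfl

end Main

end LevelRep

end

theorem mainTheorem6 {K : Type*} [Field K] [CharZero K] (q t r : K)
    (hqt : AlgebraicIndependent ℚ ![q, t]) (hr : r ^ 4 = q / t)
    (m : ℕ) (hm : 2 ≤ m) (y : Fin m → Kˣ) :
    -- operator products of the currents `Λ_i`
    (∀ (i j : Fin m) (v : LevelRep.FockT K m),
      LevelRep.atRatio (LevelRep.fSeries q t 1 m) •
          HVertexOperator.comp (LevelRep.lambda q t r i).field (LevelRep.lambda q t r j).field v =
        (if i = j then 1
          else if i < j then LevelRep.gammaPlus q (q / t)
          else LevelRep.gammaMinus q (q / t)) •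
          LevelRep.ordered₂ (LevelRep.lambda q t r i) (LevelRep.lambda q t r j) v) ∧
    -- the full product of the `Λ_i`, and `T_m`
    ((List.ofFn fun i : Fin m =>
        (LevelRep.lambda q t r i).scale ((q / t) ^ (i : ℕ))).prod.field = LevelRep.oneField K m ∧
      LevelRep.tCurrent q t r y m = (∏ i, (y i : K)) • LevelRep.oneField K m) ∧
    -- `Λ_k^*` in terms of the `Λ_i`, and `T_1^*` in terms of `T_{m-1}`
    ((∀ k : Fin m, (LevelRep.lambdaStar q t r k).field =
        (List.ofFn fun i : Fin m =>
          if i < k then (LevelRep.lambda q t r i).scale ((q / t) ^ (i : ℕ))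
          else if i = k then 1
          else (LevelRep.lambda q t r i).scale ((q / t) ^ ((i : ℕ) - 1))).prod.field) ∧
      LevelRep.tCurrentStar q t r y 1 =
        (∏ i, ((y i : K))⁻¹) • LevelRep.tCurrent q t r y (m - 1)) ∧
    -- operator products of the currents `Λ_i^*`
    (∀ (i j : Fin m) (v : LevelRep.FockT K m),
      LevelRep.atRatio (LevelRep.fSeries q t 1 m) •
          HVertexOperator.comp (LevelRep.lambdaStar q t r i).field
            (LevelRep.lambdaStar q t r j).field v =
        (if i = j then 1
          else if i < j then LevelRep.gammaMinus q (q / t)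
          else LevelRep.gammaPlus q (q / t)) •
          LevelRep.ordered₂ (LevelRep.lambdaStar q t r i) (LevelRep.lambdaStar q t r j) v) ∧
    -- the full product of the `Λ_i^*`, and `T_m^*`
    ((List.ofFn fun i : Fin m =>
        (LevelRep.lambdaStar q t r i).scale ((q / t)⁻¹ ^ (i : ℕ))).prod.field =
          LevelRep.oneField K m ∧
      LevelRep.tCurrentStar q t r y m = (∏ i, ((y i : K))⁻¹) • LevelRep.oneField K m) := by
  have hm0 : m ≠ 0 := by omega
  refine ⟨LevelRep.lambda_comp_lambda hqt hr hm0, ⟨?_, LevelRep.tCurrent_self hqt hr hm0 y⟩,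
    ⟨fun k => congrArg LevelRep.Ordered.field (LevelRep.lambdaStar_eq_prod hqt hr k), ?_⟩,
    LevelRep.lambdaStar_comp_lambdaStar hqt hr hm0, ?_, LevelRep.tCurrentStar_self hqt hr hm y⟩
  · rw [LevelRep.prod_lambda_eq_one hqt hr hm0, LevelRep.field_one]
  · rw [LevelRep.tCurrentStar, if_pos rfl, LevelRep.tOneStar_eq_tCurrent hqt hr hm0]
  · rw [LevelRep.prod_lambdaStar_eq_one hqt hr hm0, LevelRep.field_one]
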